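/- Let $1\le N<M$. Let $A=(A^i_j)$ be a real $N\times M$ matrix in banded form, i.e. $A^i_i=1$ and $A^i_j=0$ if $j<i$ or $j>M-N+i$, all of whose maximal minors are positive (the banded representative of a point of the totally positive Grassmannian $Gr^{TP}(N,M)$). Let $\hat A$ be obtained from $A$ by dividing each row by its sum, and let $x_{r,s}=\Delta^{[N-r+1,\dots,N]}_{[N-r+1+s,\dots,N+s]}(A)$, $r\in[N]$, $s\in[M-N]$ (the FZ-basis). Below, $\Delta_{[j_1,\dots,j_n]}$ is the minor of $\hat A$ formed by its last $n$ rows and the columns $j_1,\dots,j_n$. Let $k_1<\dots<k_M$ be real, let $\vec t=(t_1,t_2,\dots)$ be real with $\theta(\lambda,\vec t)=\sum_{n\ge1}\lambda^nt_n$ convergent for all $\lambda$, let $\theta_j=\theta(k_j,\vec t)$ and $f^{(i)}(\vec t)=\sum_{j=1}^M\hat A^{N-i+1}_je^{\theta_j}$. For $\xi>1$ put $\lambda_1=0$, $\lambda_l=-\xi^{2(l-2)}$, $\alpha_l=\xi^{2l-5}$ for $l\in[2,M-N+1]$ (the same on every sheet, $\lambda^{(r)}_l=\lambda_l$, $\alpha^{(r)}_l=\alpha_l$).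 For $r\in[N]$ and real $\mathring B^{(r)}_l,b^{(r)}_k$ set, recursively in $r$, $$\Psi^{(r)}(\lambda,\vec t)=\sum_{l=1}^{M-N+1}\mathring B^{(r)}_l\,\frac{\prod_{j\ne l}(\lambda-\lambda_j)}{\prod_{k=1}^{M-N}(\lambda-b^{(r)}_k)}\,V^{(r)}_l(\vec t),$$ where $V^{(1)}_l=e^{\theta_{N+l-1}}$ and, for $r\ge2$, $V^{(r)}_1=e^{\theta_{N-r+1}}$, $V^{(r)}_l(\vec t)=\Psi^{(r-1)}(\alpha_l,\vec t)$ for $l\ge2$. Consider the conditions $$\text{(i)}\ \lim_{\lambda\to\infty}\Psi^{(r)}(\lambda,\vec t)=\frac{f^{(r)}(\vec t)+\sum_{j=1}^{r-1}\epsilon^{(r)}_jf^{(r-j)}(\vec t)}{1+\sum_{j=1}^{r-1}\epsilon^{(r)}_j},\qquad \text{(ii)}\ \Psi^{(r)}(\lambda_n,\vec t)=V^{(r)}_n(\vec t),\ n\in[M-N+1],$$ for all $\vec t$, with real $\epsilon^{(r)}_j$ such that $1+\sum_j\epsilon^{(r)}_j\ne0$. Here $\Psi^{(1)}$ is the function determined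 by (i), (ii) for $r=1$ (no $\epsilon$). **Constants.** $\hat B^{(1)}_j=\hat A^N_{N+j-1}$; for $r\ge2$, $\hat B^{(r)}_1=\hat A^{N-r+1}_{N-r+1}$ and, for $j\in[2,M-N+1]$, $$\hat B^{(r)}_j=\frac{\Delta_{[N-r+j,\dots,N+j-1]}\sum_{s=N-r+2}^{N-r+j}\Delta_{[s,N-r+j+1,\dots,N+j-2]}}{\Delta_{[N-r+j+1,\dots,N+j-1]}\,\Delta_{[N-r+j,\dots,N+j-2]}}.$$ For $n\in[2,M-N+1]$ let $D^{(r)}_n=\sum_{s=N-r+1}^{N-r+n-1}\Delta_{[s,N-r+n,\dots,N+n-2]}$; let $(\hat E^{(r)[n]})_j=\Delta_{[j,N-r+n,\dots,N+n-2]}/D^{(r)}_n$ for $N-r+1\le j\le N-r+n-1$ and $0$ for the other $j$. Let $\hat\sigma^{(1)}_{n,s}=\hat A^N_s/\sum_{q=N}^{N+n-2}\hat A^N_q$ and, for $r\ge2$, let $\hat\sigma^{(r)}_{n,s}\cdot\sum_{i=1}^{n-1}\hat B^{(r)}_i$ be: $\hat B^{(r)}_1$ for $s=N-r+1$; $\sum_{j=s+r-N}^{n-1}\hat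 B^{(r)}_j\hat\sigma^{(r-1)}_{j,s}$ for $s\in[N-r+2,N-r+n-1]$; $\hat B^{(r)}_{n-1}\hat\sigma^{(r-1)}_{n-1,s}+\hat B^{(r)}_n\hat\sigma^{(r-1)}_{n,s}$ (first term absent if $n=2$) for $s\in[N-r+n,N+n-2]$; $\sum_{j=n}^{s-N+1}\hat B^{(r)}_j\hat\sigma^{(r-1)}_{j,s}$ for $s\in[N+n-1,M]$. Put $\sigma^{(r)}_{n,s}=\hat\sigma^{(r)}_{n,s}D^{(r)}_n$ and, for $j\in[r-1]$, $$\eta^{(r)}_j=\frac{\sigma^{(r-1)}_{M-N+1,M-r+j+1}\,\hat A^{N-r+1}_{M-r+1}}{\sigma^{(r-1)}_{M-N+1,M-r+1}\,\hat A^{N-r+j+1}_{M-r+j+1}}.$$ **Theorem.** There is $\xi_0>1$, depending only on $A$, such that for all $\xi>\xi_0$ and successively for $r=1,\dots,N$ the conditions (i), (ii) have a solution; its coefficients $\mathring B^{(r)}_l$, parameters $\epsilon^{(r)}_j$ and poles $b^{(r)}_k$ (up to order) are uniquely determined and do not depend on $k_1,\dots,k_M$; and, suitably ordered, $\lambda_{k+1}<b^{(r)}_k<\lambda_k$.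 Put $B^{(r)}_l=\mathring B^{(r)}_l(1+\sum_j\epsilon^{(r)}_j)$. For every $r\in[2,N]$: 1. for $\xi>\xi_0$, the $B^{(r)}_l$, the $\epsilon^{(r)}_j$ and the elementary symmetric functions of $b^{(r)}_1,\dots,b^{(r)}_{M-N}$ are rational functions of $\xi$ whose coefficients depend only on $x_{l,s}$, $l\in[r]$, $s\in[M-N]$; 2. $\Psi^{(r)}(\lambda,\vec t)>0$ for all real $\lambda>0$, all $\vec t$ and all $\xi>\xi_0$; 3. for $\xi>\xi_0$, $B^{(r)}_l>0$, $\epsilon^{(r)}_j>0$ and $B^{(r)}_1=\hat A^{N-r+1}_{N-r+1}$; as $\xi\to\infty$, $B^{(r)}_l=\hat B^{(r)}_l(1+O(\xi^{-1}))$ for $l\in[2,M-N+1]$ and $\epsilon^{(r)}_j=\eta^{(r)}_j\xi^{-j}(1+O(\xi^{-1}))$ with $\eta^{(r)}_j>0$, $j\in[r-1]$; 4. for $k\in[M-N]$, as $\xi\to\infty$, $b^{(r)}_k=-\xi^{2(k-1)}\,\dfrac{\sum_{l=1}^k\hat B^{(r)}_l}{\sum_{l=1}^{k+1}\hat B^{(r)}_l}\,(1+O(\xi^{-1}))$;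 5. for $n\in[2,M-N+1]$ there are functions $E^{(r)[n]}_j(\xi)$, not depending on $\vec t$ or on the $k_i$, with $\Psi^{(r)}(\alpha_n,\vec t)=\sum_{j=1}^ME^{(r)[n]}_je^{\theta_j}$ for $\xi>\xi_0$ and all $\vec t$, and $$\Psi^{(r)}(\alpha_n,\vec t)=\Big\{\sum_{j=N-r+1}^{N-r+n-1}\Delta_{[j,N-r+n,\dots,N+n-2]}e^{\theta_j}+\sum_{j=N-r+n}^{N+n-2}\frac{\sigma^{(r)}_{n,j}e^{\theta_j}}{\xi^{j-N+r-n+1}}+\sum_{j=N+n-1}^M\frac{\Delta_{[N-r+n,\dots,N+n-2,j]}e^{\theta_j}}{\xi^{r+2(j-N-n+1)}}\Big\}\frac{1+O(\xi^{-1})}{D^{(r)}_n},$$ both for the coefficient of each $e^{\theta_j}$, $j\in[N-r+1,M]$, separately and for the sum, uniformly in $\vec t$ and in $k_1<\dots<k_M$. For $j\in[N-r+n,N+n-2]$, $\sigma^{(r)}_{n,j}$ is positive and depends only on $x_{l,s}$, $l\in[r]$, $s\in[M-N]$. Moreover, for $\xi>\xi_0$, $E^{(r)[n]}_j=0$ for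 $j\in[N-r]$, and $E^{(r)[n]}_j$ is a rational function of $\xi$ for $j\in[N-r+1,M]$; and $\lim_{\xi\to\infty}E^{(r)[n]}_j=(\hat E^{(r)[n]})_j$ for all $j\in[M]$. -/

import Mathlib

open Filter Topology Asymptotics

namespace VacuumKP

noncomputable section

/-! All indices are one-based natural numbers, as is usual for matrices of phases and minors.
Throughout `1 ≤ N < M`; sheets are numbered `1, …, N` and each sheet carries `M - N` poles. -/

/-! ### Points of the totally positive Grassmannian in banded form -/

/-- One-based matrix entry (row `i`, column `j`), extended by zero outside the matrix. -/
def entry {N M : ℕ} (A : Matrix (Fin N) (Fin M) ℝ) (i j : ℕ) : ℝ :=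
  if h : (1 ≤ i ∧ i ≤ N) ∧ (1 ≤ j ∧ j ≤ M) then
    A ⟨i - 1, by omega⟩ ⟨j - 1, by omega⟩
  else 0

/-- `A` is the banded representative of a point of `Gr^TP(N, M)`: all maximal minors are
positive, the entries `A^i_i` are `1`, and `A^i_j = 0` for `j < i` and for `j > M - N + i`. -/
structure IsBandedTP {N M : ℕ} (A : Matrix (Fin N) (Fin M) ℝ) : Prop where
  diag : ∀ (i : Fin N) (j : Fin M), (j : ℕ) = (i : ℕ) → A i j = 1
  band : ∀ (i : Fin N) (j : Fin M), (j : ℕ) < i ∨ M - N + (i : ℕ) < j → A i j = 0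
  minors_pos : ∀ c : Fin N ↪o Fin M, 0 < (A.submatrix id c).det

/-- The matrix with each row divided by its sum. -/
def hatA {N M : ℕ} (A : Matrix (Fin N) (Fin M) ℝ) : Matrix (Fin N) (Fin M) ℝ :=
  fun i j => A i j / ∑ s, A i s

/-- The minor formed by the last `n` rows and the columns `c 0, c 1, …, c (n - 1)`. -/
def lastMinor {N M : ℕ} (A : Matrix (Fin N) (Fin M) ℝ) (n : ℕ) (c : ℕ → ℕ) : ℝ :=
  Matrix.det (Matrix.of fun a b : Fin n => entry A (N - n + 1 + (a : ℕ)) (c b))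

/-- `Δ_{[p, p+1, …, p+n-1]}`. -/
def minorRun {N M : ℕ} (A : Matrix (Fin N) (Fin M) ℝ) (n p : ℕ) : ℝ :=
  lastMinor A n (fun b => p + b)

/-- `Δ_{[j; p, p+1, …, p+n-2]}`, of order `n`. -/
def minorHead {N M : ℕ} (A : Matrix (Fin N) (Fin M) ℝ) (n j p : ℕ) : ℝ :=
  lastMinor A n (fun b => if b = 0 then j else p + (b - 1))

/-- `Δ_{[p, p+1, …, p+n-2; j]}`, of order `n`. -/
def minorTail {N M : ℕ} (A : Matrix (Fin N) (Fin M) ℝ) (n p j : ℕ) : ℝ :=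
  lastMinor A n (fun b => if b + 1 < n then p + b else j)

/-- The Fomin-Zelevinsky basis
`x_{r,s} = Δ^{[N-r+1, …, N]}_{[N-r+1+s, …, N+s]}(A)` of the point represented by the banded
matrix `A`. -/
def fzCoord {N M : ℕ} (A : Matrix (Fin N) (Fin M) ℝ) (r s : ℕ) : ℝ :=
  minorRun A r (N - r + 1 + s)

/-- The part `x_{l,s}`, `1 ≤ l ≤ r`, `1 ≤ s ≤ M - N`, of the Fomin-Zelevinsky basis. -/
def fzCoords {N M : ℕ} (A : Matrix (Fin N) (Fin M) ℝ) (r : ℕ) : Fin r → Fin (M - N) → ℝ :=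
  fun l s => fzCoord A ((l : ℕ) + 1) ((s : ℕ) + 1)

/-! ### The leading-order constants. Here `H` is the row-normalized matrix `hatA A`. -/

/-- The constants `B̂^{(r)}_j`, `1 ≤ j ≤ M - N + 1`. -/
def hatB {N M : ℕ} (H : Matrix (Fin N) (Fin M) ℝ) (r j : ℕ) : ℝ :=
  if r = 1 then entry H N (N + j - 1)
  else if j = 1 then entry H (N - r + 1) (N - r + 1)
  else
    minorRun H r (N - r + j) *
        (∑ s ∈ Finset.Icc (N - r + 2) (N - r + j), minorHead H (r - 1) s (N - r + j + 1)) /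
      (minorRun H (r - 1) (N - r + j + 1) * minorRun H (r - 1) (N - r + j))

/-- `∑_{s=N-r+1}^{N-r+n-1} Δ_{[s; N-r+n, …, N+n-2]}`. -/
def minorSum {N M : ℕ} (H : Matrix (Fin N) (Fin M) ℝ) (r n : ℕ) : ℝ :=
  ∑ s ∈ Finset.Icc (N - r + 1) (N - r + n - 1), minorHead H r s (N - r + n)

/-- The entries `(Ê^{(r)[n]})_j` for `2 ≤ n ≤ M - N + 1`. -/
def hatE {N M : ℕ} (H : Matrix (Fin N) (Fin M) ℝ) (r n j : ℕ) : ℝ :=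
  if N - r + 1 ≤ j ∧ j ≤ N - r + n - 1 then
    minorHead H r j (N - r + n) / minorSum H r n
  else 0

/-- The constants `σ̂^{(r)}_{n,s}`, `2 ≤ n ≤ M - N + 1`, `N - r + 1 ≤ s ≤ M`, by recursion on `r`
(a term with `n - 1 = 1` in the third case is absent). -/
def hatSigma {N M : ℕ} (H : Matrix (Fin N) (Fin M) ℝ) : ℕ → ℕ → ℕ → ℝ
  | 0 => fun _ _ => 0
  | 1 => fun n s => entry H N s / ∑ q ∈ Finset.Icc N (N + n - 2), entry H N q
  | r + 2 => fun n s =>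
      (if s = N - (r + 2) + 1 then hatB H (r + 2) 1
       else if s ≤ N - (r + 2) + n - 1 then
         ∑ j ∈ Finset.Icc (s + (r + 2) - N) (n - 1), hatB H (r + 2) j * hatSigma H (r + 1) j s
       else if s ≤ N + n - 2 then
         (if n = 2 then 0 else hatB H (r + 2) (n - 1) * hatSigma H (r + 1) (n - 1) s)
           + hatB H (r + 2) n * hatSigma H (r + 1) n s
       else
         ∑ j ∈ Finset.Icc n (s - N + 1), hatB H (r + 2) j * hatSigma H (r + 1) j s) /
      ∑ i ∈ Finset.Icc 1 (n - 1), hatB H (r + 2) i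

/-- The constants `σ^{(r)}_{n,j} = σ̂^{(r)}_{n,j} · ∑_s Δ_{[s; N-r+n, …, N+n-2]}`. -/
def sigma {N M : ℕ} (H : Matrix (Fin N) (Fin M) ℝ) (r n j : ℕ) : ℝ :=
  hatSigma H r n j * minorSum H r n

/-- The constants `η^{(r)}_j`, `1 ≤ j ≤ r - 1`. -/
def eta {N M : ℕ} (H : Matrix (Fin N) (Fin M) ℝ) (r j : ℕ) : ℝ :=
  (sigma H (r - 1) (M - N + 1) (M - r + j + 1) * entry H (N - r + 1) (M - r + 1)) /
    (sigma H (r - 1) (M - N + 1) (M - r + 1) * entry H (N - r + j + 1) (M - r + j + 1))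

/-- The leading term in `ξ` of the coefficient of `e^{θ_j}`, `N - r + 1 ≤ j ≤ M`, in
`Ψ^{(r)}(α_n^{(r)}, t)`. -/
def leadCoef {N M : ℕ} (H : Matrix (Fin N) (Fin M) ℝ) (r n j : ℕ) (ξ : ℝ) : ℝ :=
  (if j ≤ N - r + n - 1 then minorHead H r j (N - r + n)
   else if j ≤ N + n - 2 then
     sigma H r n j / ξ ^ ((j : ℤ) - N + r - n + 1)
   else
     minorTail H r (N - r + n) j / ξ ^ ((r : ℤ) + 2 * ((j : ℤ) - N - n + 1))) /
  minorSum H r n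

/-! ### Times, phases and heat-hierarchy solutions -/

/-- Admissible times: `t i` stands for `t_{i+1}`, and `θ(λ, t) = ∑ λ^n t_n` converges for all
`λ`. In particular all finitely supported sequences are admissible. -/
def IsTime (t : ℕ → ℝ) : Prop :=
  ∀ z : ℂ, Summable fun i : ℕ => z ^ (i + 1) * (t i : ℂ)

/-- `θ(x, t)` at a real point `x`; so `θ_j(t) = theta (k j) t`. -/
def theta (x : ℝ) (t : ℕ → ℝ) : ℝ := ∑' i : ℕ, x ^ (i + 1) * t i

/-- The Sato vacuum wave function `Ψ^{(0)}(λ, t) = e^{θ(λ, t)}` on the sheet `Γ_0`. -/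
def sato (z : ℂ) (t : ℕ → ℝ) : ℂ := Complex.exp (∑' i : ℕ, z ^ (i + 1) * (t i : ℂ))

theorem sato_ofReal (x : ℝ) (t : ℕ → ℝ) : sato (x : ℂ) t = (Real.exp (theta x t) : ℂ) := by
  simp [sato, theta, Complex.ofReal_exp, Complex.ofReal_tsum]

/-- `f^{(i)}(t) = ∑_j Â^{N-i+1}_j e^{θ_j(t)}`. -/
def heatSol {N M : ℕ} (H : Matrix (Fin N) (Fin M) ℝ) (k : ℕ → ℝ) (i : ℕ) (t : ℕ → ℝ) : ℝ :=
  ∑ j ∈ Finset.Icc 1 M, entry H (N - i + 1) j * Real.exp (theta (k j) t)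

/-! ### Marked points and the wave function on the sheets -/

/-- `λ_1 = 0`, `λ_l = -ξ^{2(l-2)}` for `l ≥ 2`. -/
def lamPt (ξ : ℝ) (l : ℕ) : ℝ := if l = 1 then 0 else -ξ ^ (2 * (l - 2))

/-- `α_s = ξ^{2s-5}`. -/
def alphaPt (ξ : ℝ) (s : ℕ) : ℝ := ξ ^ (2 * (s : ℤ) - 5)

/-- `∑_{l=1}^{K+1} C_l ∏_{j≠l} (z - λ_j) / ∏_{m=1}^{K} (z - b_m) · V_l`. -/
def sheetFun (K : ℕ) (ξ : ℝ) (C b : ℕ → ℝ) (V : ℕ → ℂ) (z : ℂ) : ℂ :=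
  ∑ l ∈ Finset.Icc 1 (K + 1),
    (C l : ℂ) * ((∏ j ∈ (Finset.Icc 1 (K + 1)).erase l, (z - (lamPt ξ j : ℂ))) /
      ∏ m ∈ Finset.Icc 1 K, (z - (b m : ℂ))) * V l

/-- The functions `V^{(r)}_l(t)`, `r ≥ 1`, where `prev` is the wave function `Ψ^{(r-1)}`. -/
def sheetValue (N : ℕ) (k : ℕ → ℝ) (ξ : ℝ) (prev : ℂ → (ℕ → ℝ) → ℂ) (r l : ℕ) (t : ℕ → ℝ) : ℂ :=
  if r = 1 then sato (k (N + l - 1) : ℂ) t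
  else if l = 1 then sato (k (N - r + 1) : ℂ) t
  else prev (alphaPt ξ l : ℂ) t

/-- The wave functions `Ψ^{(r)}(λ, t)` built recursively from coefficients `C r l`
(usually written `B̊^{(r)}_l`) and poles `b r m`. -/
def Psi (N M : ℕ) (k : ℕ → ℝ) (ξ : ℝ) (C b : ℕ → ℕ → ℝ) : ℕ → ℂ → (ℕ → ℝ) → ℂ
  | 0 => sato
  | r + 1 => fun z t =>
      sheetFun (M - N) ξ (C (r + 1)) (b (r + 1))
        (fun l => sheetValue N k ξ (Psi N M k ξ C b r) (r + 1) l t) z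

/-- `1 + ∑_{j=1}^{r-1} ε^{(r)}_j`. -/
def epsNorm (eps : ℕ → ℕ → ℝ) (r : ℕ) : ℝ := 1 + ∑ j ∈ Finset.Icc 1 (r - 1), eps r j

/-- The two conditions on `Ψ^{(r)}`: its limit at the infinity point `Q_r` of the sheet
`Γ_r` and its values at the marked points `λ_n^{(r)}`. The parameter `ε^{(r)}_j` multiplies
`f^{(r-j)}`. -/
structure SheetConditions {N M : ℕ} (H : Matrix (Fin N) (Fin M) ℝ) (k : ℕ → ℝ) (ξ : ℝ)
    (C eps b : ℕ → ℕ → ℝ) (r : ℕ) : Prop where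
  norm_ne : epsNorm eps r ≠ 0
  limit : ∀ t, IsTime t →
    Tendsto (fun z : ℂ => Psi N M k ξ C b r z t) (cocompact ℂ)
      (𝓝 (((heatSol H k r t + ∑ j ∈ Finset.Icc 1 (r - 1), eps r j * heatSol H k (r - j) t) /
        epsNorm eps r : ℝ) : ℂ))
  glue : ∀ t, IsTime t → ∀ n ∈ Finset.Icc 1 (M - N + 1),
    Psi N M k ξ C b r (lamPt ξ n : ℂ) t = sheetValue N k ξ (Psi N M k ξ C b (r - 1)) r n t

/-- The elementary symmetric function of degree `s` in `b_1, …, b_K`. -/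
def esymmPoles (K : ℕ) (b : ℕ → ℝ) (s : ℕ) : ℝ :=
  ∑ S ∈ (Finset.Icc 1 K).powersetCard s, ∏ m ∈ S, b m

/-- `g(ξ) = g₀(ξ) (1 + O(ξ⁻¹))` as `ξ → ∞`. -/
def LeadingOrder (g g₀ : ℝ → ℝ) : Prop :=
  (fun ξ => g ξ - g₀ ξ) =O[atTop] fun ξ => g₀ ξ * ξ⁻¹

end

end VacuumKP

open VacuumKP

/-!
The limit condition on `Ψ^{(r)}` is an identity between combinations of the exponentials `e^{θ_s}`,
which are linearly independent (`coeff_eq_zero_of_sum_exp_eq_zero`). Since the limit of `Ψ^{(r)}` at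
infinity does not involve the poles (`tendsto_sheetFun`), the condition is a square linear system
for the `B^{(r)}_l` and the `ε^{(r)}_j` (`system_iff`), with coefficients built from the values of
`Ψ^{(r-1)}` at the points `α_n`. The `k_i` do not occur in it.

*Asymptotics.* By induction on `r`, the coefficient of `e^{θ_s}` in `Ψ^{(r)}(α_n)` is a rational
function of `ξ` of the exact order `ξ^{-e}`, `e = gapExp N r n s`. Multiplying the rows of the
system and the unknowns `ε^{(r)}_j` by powers of `ξ` makes the system regular at `ξ = ∞`
(`BandTP.hasRatLimit_sysMat`), with a limiting matrix which is triangular up to a permutation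
(`BandTP.limMat_det_ne_zero`). So Cramer's rule (`HasRatLimit.inv_mulVec`) gives solutions that are
rational in `ξ`, with an error `O(ξ⁻¹)` around the solution of the limiting system. In the step to
the next `r` the value at `α_n` is a weighted mean of the `V_l`, and the order of the weights
(`weightExp`) decides which terms survive; they are the ones collected in the recursion for
`hatSigma` (`BandTP.sum_weight_vhat`).

*Closed formulas.* The limiting system is solved by `hatB` and `eta` (`BandTP.limMat_mulVec`). The
reason is the three-term Plücker relation, in the following form. Let `redRow H r p` be the
combination of the last `r` rows, with coefficient one at the top row, that vanishes at the columns
`p, …, p + r - 2`. Then `redRow H r (p + 1) - redRow H r p` is a multiple of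
`redRow H (r - 1) (p + 1)` (`BandTP.redRow_step`), because it is a combination of lower rows
which vanishes at as many consecutive columns as determine it up to a factor. The factor is `hatB`,
up to normalization, and the sums over `l` telescope (`BandTP.sum_hatB_mul`). Total positivity of
the Grassmannian point makes all minors of the last rows positive (`IsBandedTP.lastMinor_pos`),
hence also all limits, and therefore all coefficients for large `ξ`.

*Poles.* In every `f^{(i)}` and every `V^{(r)}_l` the coefficients of the exponentials have sum one,
and so have the coefficients of `Ψ^{(r)}` (`GoodParam.sum_Bcoef`). Hence the numerators
`∏_{j≠l} (λ - λ_j)`, weighted with them, add up to a monic polynomial. The interpolation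
conditions say that the `b^{(r)}_k` are its roots. As the coefficients are positive, there is one
root between any two consecutive `λ_l` (`exists_interlacing`), and elementary two-sided estimates
(`pole_bounds`) give its leading term.

*Dependence on the coordinates.* The minors `x_{l,s}` with `l ≤ r` determine the last `r` rows of
the banded matrix (`IsBandedTP.brow_eq_of_fzCoords`), and nothing else enters the systems for the
first `r` sheets.
-/

namespace VacuumKP

noncomputable section

/-! ### Rational germs at infinity -/

/-- `f` agrees with a rational function for all large arguments. -/
def RatGerm (f : ℝ → ℝ) : Prop :=
  ∃ R : RatFunc ℝ, ∀ᶠ ξ in atTop, f ξ = R.eval (RingHom.id ℝ) ξ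

theorem eventually_denom_ne_zero (R : RatFunc ℝ) :
    ∀ᶠ ξ in atTop, Polynomial.eval₂ (RingHom.id ℝ) ξ R.denom ≠ 0 := by
  filter_upwards [Polynomial.eventually_atTop_not_isRoot R.denom R.denom_ne_zero] with ξ hξ
  exact hξ

namespace RatGerm

variable {f g : ℝ → ℝ}

theorem congr (hf : RatGerm f) (h : g =ᶠ[atTop] f) : RatGerm g := by
  obtain ⟨R, hR⟩ := hf
  exact ⟨R, by filter_upwards [hR, h] with ξ h1 h2; rw [h2, h1]⟩

theorem const (c : ℝ) : RatGerm fun _ => c :=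
  ⟨RatFunc.C c, Eventually.of_forall fun ξ => by simp⟩

theorem id : RatGerm fun ξ => ξ :=
  ⟨RatFunc.X, Eventually.of_forall fun ξ => by simp⟩

theorem add (hf : RatGerm f) (hg : RatGerm g) : RatGerm fun ξ => f ξ + g ξ := by
  obtain ⟨R, hR⟩ := hf
  obtain ⟨S, hS⟩ := hg
  refine ⟨R + S, ?_⟩
  filter_upwards [hR, hS, eventually_denom_ne_zero R, eventually_denom_ne_zero S] with ξ h1 h2 h3 h4
  rw [h1, h2, RatFunc.eval_add _ _ h3 h4]

theorem mul (hf : RatGerm f) (hg : RatGerm g) : RatGerm fun ξ => f ξ * g ξ := by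
  obtain ⟨R, hR⟩ := hf
  obtain ⟨S, hS⟩ := hg
  refine ⟨R * S, ?_⟩
  filter_upwards [hR, hS, eventually_denom_ne_zero R, eventually_denom_ne_zero S] with ξ h1 h2 h3 h4
  rw [h1, h2, RatFunc.eval_mul _ _ h3 h4]

theorem inv (hf : RatGerm f) : RatGerm fun ξ => (f ξ)⁻¹ := by
  obtain ⟨R, hR⟩ := hf
  refine ⟨R⁻¹, ?_⟩
  filter_upwards [hR, eventually_denom_ne_zero R, eventually_denom_ne_zero R⁻¹] with ξ h1 h2 h3
  rw [h1]
  by_cases h0 : R = 0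
  · simp [h0]
  · have := RatFunc.eval_mul _ _ h2 h3
    rw [mul_inv_cancel₀ h0, RatFunc.eval_one] at this
    exact (eq_inv_of_mul_eq_one_right this.symm).symm

theorem neg (hf : RatGerm f) : RatGerm fun ξ => -f ξ := by
  simpa using (const (-1)).mul hf

theorem div (hf : RatGerm f) (hg : RatGerm g) : RatGerm fun ξ => f ξ / g ξ := by
  simpa [div_eq_mul_inv] using hf.mul hg.inv

theorem sum {ι : Type*} (s : Finset ι) {F : ι → ℝ → ℝ} (h : ∀ i ∈ s, RatGerm (F i)) :
    RatGerm fun ξ => ∑ i ∈ s, F i ξ := by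
  classical
  induction s using Finset.induction_on with
  | empty => simpa using const 0
  | insert i s hi ih =>
    simpa [Finset.sum_insert hi] using
      (h i (by simp)).add (ih fun j hj => h j (by simp [hj]))

theorem prod {ι : Type*} (s : Finset ι) {F : ι → ℝ → ℝ} (h : ∀ i ∈ s, RatGerm (F i)) :
    RatGerm fun ξ => ∏ i ∈ s, F i ξ := by
  classical
  induction s using Finset.induction_on with
  | empty => simpa using const 1
  | insert i s hi ih =>
    simpa [Finset.prod_insert hi] using
      (h i (by simp)).mul (ih fun j hj => h j (by simp [hj]))

theorem pow (hf : RatGerm f) (n : ℕ) : RatGerm fun ξ => f ξ ^ n := by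
  simpa using prod (Finset.range n) (F := fun _ => f) fun _ _ => hf

end RatGerm

/-- `f` is a rational germ at infinity and `f(ξ) = c + O(ξ⁻¹)`; equivalently, `f` is a germ of
a rational function which is regular at infinity with value `c` there. -/
structure HasRatLimit (f : ℝ → ℝ) (c : ℝ) : Prop where
  rat : RatGerm f
  isBigO : (fun ξ => f ξ - c) =O[atTop] fun ξ => ξ⁻¹

namespace HasRatLimit

variable {f g : ℝ → ℝ} {c d : ℝ}

theorem congr (hf : HasRatLimit f c) (h : g =ᶠ[atTop] f) : HasRatLimit g c :=
  ⟨hf.rat.congr h, hf.isBigO.congr' (by filter_upwards [h] with ξ hξ; rw [hξ]) EventuallyEq.rfl⟩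

theorem tendsto (hf : HasRatLimit f c) : Tendsto f atTop (𝓝 c) := by
  have := (hf.isBigO.trans_tendsto tendsto_inv_atTop_zero).add_const c
  simpa using this

theorem const (c : ℝ) : HasRatLimit (fun _ => c) c :=
  ⟨RatGerm.const c, by simpa using isBigO_zero _ _⟩

theorem add (hf : HasRatLimit f c) (hg : HasRatLimit g d) :
    HasRatLimit (fun ξ => f ξ + g ξ) (c + d) :=
  ⟨hf.rat.add hg.rat, (hf.isBigO.add hg.isBigO).congr_left fun ξ => by ring⟩

theorem mul (hf : HasRatLimit f c) (hg : HasRatLimit g d) :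
    HasRatLimit (fun ξ => f ξ * g ξ) (c * d) := by
  refine ⟨hf.rat.mul hg.rat, ?_⟩
  have h1 : (fun ξ => (f ξ - c) * g ξ) =O[atTop] fun ξ => ξ⁻¹ := by
    simpa using hf.isBigO.mul (hg.tendsto.isBigO_one ℝ)
  exact (h1.add (hg.isBigO.const_mul_left c)).congr_left fun ξ => by ring

theorem inv (hf : HasRatLimit f c) (hc : c ≠ 0) : HasRatLimit (fun ξ => (f ξ)⁻¹) c⁻¹ := by
  refine ⟨hf.rat.inv, ?_⟩
  have h1 : (fun ξ => (f ξ - c) * ((f ξ)⁻¹ * -c⁻¹)) =O[atTop] fun ξ => ξ⁻¹ := by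
    simpa using hf.isBigO.mul (((hf.tendsto.inv₀ hc).mul_const (-c⁻¹)).isBigO_one ℝ)
  refine h1.congr' ?_ EventuallyEq.rfl
  filter_upwards [hf.tendsto.eventually_ne hc] with ξ hξ
  field_simp
  ring

theorem div (hf : HasRatLimit f c) (hg : HasRatLimit g d) (hd : d ≠ 0) :
    HasRatLimit (fun ξ => f ξ / g ξ) (c / d) := by
  simpa [div_eq_mul_inv] using hf.mul (hg.inv hd)

theorem neg (hf : HasRatLimit f c) : HasRatLimit (fun ξ => -f ξ) (-c) := by
  simpa using (const (-1)).mul hf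

theorem sub (hf : HasRatLimit f c) (hg : HasRatLimit g d) :
    HasRatLimit (fun ξ => f ξ - g ξ) (c - d) := by
  simpa [sub_eq_add_neg] using hf.add hg.neg

theorem sum {ι : Type*} (s : Finset ι) {F : ι → ℝ → ℝ} {c : ι → ℝ}
    (h : ∀ i ∈ s, HasRatLimit (F i) (c i)) :
    HasRatLimit (fun ξ => ∑ i ∈ s, F i ξ) (∑ i ∈ s, c i) := by
  classical
  induction s using Finset.induction_on with
  | empty => simpa using const 0
  | insert i s hi ih =>
    simpa [Finset.sum_insert hi] using
      (h i (by simp)).add (ih fun j hj => h j (by simp [hj]))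

theorem prod {ι : Type*} (s : Finset ι) {F : ι → ℝ → ℝ} {c : ι → ℝ}
    (h : ∀ i ∈ s, HasRatLimit (F i) (c i)) :
    HasRatLimit (fun ξ => ∏ i ∈ s, F i ξ) (∏ i ∈ s, c i) := by
  classical
  induction s using Finset.induction_on with
  | empty => simpa using const 1
  | insert i s hi ih =>
    simpa [Finset.prod_insert hi] using
      (h i (by simp)).mul (ih fun j hj => h j (by simp [hj]))

theorem inv_pow_succ (n : ℕ) : HasRatLimit (fun ξ => ξ⁻¹ ^ (n + 1)) 0 := by
  refine ⟨(RatGerm.id.inv).pow _, ?_⟩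
  have h1 : (fun ξ : ℝ => ξ⁻¹ ^ n * ξ⁻¹) =O[atTop] fun ξ : ℝ => ξ⁻¹ := by
    simpa using ((((tendsto_inv_atTop_zero (𝕜 := ℝ)).pow n).isBigO_one ℝ).mul
      (isBigO_refl (fun ξ : ℝ => ξ⁻¹) atTop))
  exact h1.congr_left fun ξ => by rw [sub_zero, pow_succ]

/-- A surplus of powers of `ξ⁻¹` kills the limit. -/
theorem inv_pow (n : ℕ) : HasRatLimit (fun ξ => ξ⁻¹ ^ n) (if n = 0 then 1 else 0) := by
  cases n with
  | zero => simpa using const 1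
  | succ n => simpa using inv_pow_succ n

theorem det {ι : Type*} [Fintype ι] [DecidableEq ι] {F : ℝ → Matrix ι ι ℝ} {F₀ : Matrix ι ι ℝ}
    (h : ∀ i j, HasRatLimit (fun ξ => F ξ i j) (F₀ i j)) :
    HasRatLimit (fun ξ => (F ξ).det) F₀.det := by
  simp only [Matrix.det_apply']
  exact sum _ fun σ _ => (const _).mul (prod _ fun i _ => h _ _)

/-- Cramer's rule at infinity: the solution of a linear system whose coefficients are regular at
infinity is regular there, if the limiting system is nonsingular, and its limit solves the limiting
system. -/
theorem inv_mulVec {ι : Type*} [Fintype ι] [DecidableEq ι] {F : ℝ → Matrix ι ι ℝ}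
    {F₀ : Matrix ι ι ℝ} {v : ℝ → ι → ℝ} {v₀ x₀ : ι → ℝ}
    (h : ∀ i j, HasRatLimit (fun ξ => F ξ i j) (F₀ i j))
    (hv : ∀ i, HasRatLimit (fun ξ => v ξ i) (v₀ i)) (h₀ : F₀.det ≠ 0)
    (hx : F₀.mulVec x₀ = v₀) (i : ι) :
    HasRatLimit (fun ξ => ((F ξ)⁻¹.mulVec (v ξ)) i) (x₀ i) := by
  have key : ∀ (G : Matrix ι ι ℝ) (w : ι → ℝ),
      (G⁻¹.mulVec w) i = G.cramer w i / G.det := by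
    intro G w
    rw [Matrix.inv_def, Matrix.smul_mulVec, Ring.inverse_eq_inv', Matrix.cramer_eq_adjugate_mulVec]
    simp [div_eq_inv_mul]
  have hx' : x₀ = F₀⁻¹.mulVec v₀ := by
    rw [← hx, Matrix.mulVec_mulVec, Matrix.nonsing_inv_mul _ (Ne.isUnit h₀), Matrix.one_mulVec]
  rw [hx', key]
  simp only [key]
  refine div ?_ (det h) h₀
  simp only [Matrix.cramer_apply]
  refine det fun a b => ?_
  by_cases hb : b = i
  · simpa [Matrix.updateCol_apply, hb] using hv a
  · simpa [Matrix.updateCol_apply, hb] using h a b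

/-- If `f` has the nonzero limit `c`, then `w f` has the leading term `w c`. -/
theorem leadingOrder (hf : HasRatLimit f c) (hc : c ≠ 0) {F G w : ℝ → ℝ}
    (hF : ∀ᶠ ξ in atTop, F ξ = w ξ * f ξ) (hG : ∀ᶠ ξ in atTop, G ξ = w ξ * c) :
    LeadingOrder F G := by
  unfold LeadingOrder
  have h1 : (fun ξ => w ξ * (f ξ - c)) =O[atTop] fun ξ => w ξ * (c * ξ⁻¹) :=
    (isBigO_refl w atTop).mul (hf.isBigO.trans (isBigO_self_const_mul hc _ _))
  refine h1.congr' ?_ ?_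
  · filter_upwards [hF, hG] with ξ h2 h3
    rw [h2, h3]; ring
  · filter_upwards [hG] with ξ h3
    rw [h3]; ring

end HasRatLimit

/-! ### Interlacing poles -/

open Polynomial in
theorem degree_prod_sub_prod_lt {ι κ F : Type*} [Field F] {s : Finset ι} {t : Finset κ}
    (f : ι → F) (g : κ → F) (h : s.card = t.card) :
    (∏ i ∈ s, (X - C (f i)) - ∏ i ∈ t, (X - C (g i))).degree < (t.card : WithBot ℕ) := by
  have hs : (∏ i ∈ s, (X - C (f i))).Monic := monic_prod_of_monic _ _ fun i _ => monic_X_sub_C _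
  have ht : (∏ i ∈ t, (X - C (g i))).Monic := monic_prod_of_monic _ _ fun i _ => monic_X_sub_C _
  have hds : (∏ i ∈ s, (X - C (f i))).degree = (s.card : WithBot ℕ) := by
    rw [degree_prod]; simp
  have hdt : (∏ i ∈ t, (X - C (g i))).degree = (t.card : WithBot ℕ) := by
    rw [degree_prod]; simp
  rw [← h, ← hds]
  exact degree_sub_lt_left (by rw [hds, hdt, h]) hs.ne_zero
    (by rw [hs.leadingCoeff, ht.leadingCoeff])

/-- The node polynomial `∏_{j ≠ l} (z - p_j)`, with indices running from `1` to `K + 1`. -/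
def nodeProd {F : Type*} [Field F] (K : ℕ) (p : ℕ → F) (l : ℕ) (z : F) : F :=
  ∏ j ∈ (Finset.Icc 1 (K + 1)).erase l, (z - p j)

theorem nodeProd_eq_zero {F : Type*} [Field F] {K : ℕ} {p : ℕ → F} {l n : ℕ}
    (hn : n ∈ Finset.Icc 1 (K + 1)) (hln : l ≠ n) : nodeProd K p l (p n) = 0 :=
  Finset.prod_eq_zero (Finset.mem_erase.2 ⟨hln.symm, hn⟩) (sub_self _)

theorem sum_mul_nodeProd {F : Type*} [Field F] {K : ℕ} {p : ℕ → F} {n : ℕ} (c : ℕ → F)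
    (hn : n ∈ Finset.Icc 1 (K + 1)) :
    ∑ l ∈ Finset.Icc 1 (K + 1), c l * nodeProd K p l (p n) = c n * nodeProd K p n (p n) := by
  rw [Finset.sum_eq_single n]
  · intro l _ hl
    rw [nodeProd_eq_zero hn hl, mul_zero]
  · exact fun h => absurd hn h

theorem card_erase_Icc {K l : ℕ} (hl : l ∈ Finset.Icc 1 (K + 1)) :
    ((Finset.Icc 1 (K + 1)).erase l).card = K := by
  rw [Finset.card_erase_of_mem hl]; simp

/-- The combination of node polynomials is monic of degree `K`, because its coefficients have sum
one; so it is determined by its values at `K` points. -/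
theorem sum_nodeProd_eq_prod {K : ℕ} {p c b : ℕ → ℝ}
    (hc : ∑ l ∈ Finset.Icc 1 (K + 1), c l = 1) {x : ℕ → ℝ}
    (hx : Set.InjOn x (Finset.Icc 1 K : Finset ℕ))
    (h : ∀ m ∈ Finset.Icc 1 K, ∑ l ∈ Finset.Icc 1 (K + 1), c l * nodeProd K p l (x m) =
      ∏ i ∈ Finset.Icc 1 K, (x m - b i)) :
    ∑ l ∈ Finset.Icc 1 (K + 1), Polynomial.C (c l) *
      ∏ j ∈ (Finset.Icc 1 (K + 1)).erase l, (Polynomial.X - Polynomial.C (p j)) =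
      ∏ i ∈ Finset.Icc 1 K, (Polynomial.X - Polynomial.C (b i)) := by
  have hKc : (Finset.Icc 1 K).card = K := by simp
  refine Polynomial.eq_of_degree_sub_lt_of_eval_finset_eq ((Finset.Icc 1 K).image x) ?_ ?_
  · rw [Finset.card_image_of_injOn hx]
    have e : ∑ l ∈ Finset.Icc 1 (K + 1), Polynomial.C (c l) *
        ∏ j ∈ (Finset.Icc 1 (K + 1)).erase l, (Polynomial.X - Polynomial.C (p j)) -
        ∏ i ∈ Finset.Icc 1 K, (Polynomial.X - Polynomial.C (b i)) =
        ∑ l ∈ Finset.Icc 1 (K + 1), c l •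
          (∏ j ∈ (Finset.Icc 1 (K + 1)).erase l, (Polynomial.X - Polynomial.C (p j)) -
          ∏ i ∈ Finset.Icc 1 K, (Polynomial.X - Polynomial.C (b i))) := by
      simp only [smul_sub, Finset.sum_sub_distrib]
      rw [← Finset.sum_smul, hc, one_smul]
      simp only [Polynomial.smul_eq_C_mul]
    rw [e, ← Polynomial.mem_degreeLT]
    refine Submodule.sum_mem _ fun l hl => Submodule.smul_mem _ _ ?_
    rw [Polynomial.mem_degreeLT]
    exact degree_prod_sub_prod_lt _ _ (by rw [card_erase_Icc hl, hKc])
  · intro y hy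
    obtain ⟨m, hm, rfl⟩ := Finset.mem_image.1 hy
    simpa [Polynomial.eval_finsetSum, Polynomial.eval_prod, nodeProd] using h m hm

/-- The sign of the node polynomial alternates along decreasing nodes. -/
theorem nodeProd_sign {K : ℕ} {p : ℕ → ℝ} (hp : StrictAntiOn p (Finset.Icc 1 (K + 1) : Finset ℕ))
    {n : ℕ} (hn : n ∈ Finset.Icc 1 (K + 1)) :
    0 < (-1) ^ (n - 1) * nodeProd K p n (p n) := by
  have hn' := Finset.mem_Icc.1 hn
  have e : (Finset.Icc 1 (K + 1)).erase n = Finset.Icc 1 (n - 1) ∪ Finset.Icc (n + 1) (K + 1) := by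
    ext j
    simp only [Finset.mem_erase, Finset.mem_union, Finset.mem_Icc]
    omega
  have hd : Disjoint (Finset.Icc 1 (n - 1)) (Finset.Icc (n + 1) (K + 1)) := by
    rw [Finset.disjoint_left]
    intro j
    simp only [Finset.mem_Icc]
    omega
  have e2 : (-1 : ℝ) ^ (n - 1) = ∏ j ∈ Finset.Icc 1 (n - 1), (-1 : ℝ) := by simp
  rw [nodeProd, e, Finset.prod_union hd, e2, ← mul_assoc, ← Finset.prod_mul_distrib]
  refine mul_pos (Finset.prod_pos fun j hj => ?_) (Finset.prod_pos fun j hj => ?_)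
  · rw [Finset.mem_Icc] at hj
    have := hp (Finset.mem_coe.2 (Finset.mem_Icc.2 (by omega : 1 ≤ j ∧ j ≤ K + 1)))
      (Finset.mem_coe.2 hn) (by omega : j < n)
    linarith
  · rw [Finset.mem_Icc] at hj
    have := hp (Finset.mem_coe.2 hn)
      (Finset.mem_coe.2 (Finset.mem_Icc.2 (by omega : 1 ≤ j ∧ j ≤ K + 1))) (by omega : n < j)
    linarith

/-- A combination of node polynomials with positive coefficients has a root between any two
consecutive nodes. -/
theorem exists_interlacing {K : ℕ} {p c : ℕ → ℝ}
    (hp : StrictAntiOn p (Finset.Icc 1 (K + 1) : Finset ℕ))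
    (hc : ∑ l ∈ Finset.Icc 1 (K + 1), c l = 1) (hpos : ∀ l ∈ Finset.Icc 1 (K + 1), 0 < c l) :
    ∃ b : ℕ → ℝ, (∀ m ∈ Finset.Icc 1 K, p (m + 1) < b m ∧ b m < p m) ∧
      ∑ l ∈ Finset.Icc 1 (K + 1), Polynomial.C (c l) *
      ∏ j ∈ (Finset.Icc 1 (K + 1)).erase l, (Polynomial.X - Polynomial.C (p j)) =
      ∏ i ∈ Finset.Icc 1 K, (Polynomial.X - Polynomial.C (b i)) := by
  set Q : ℝ → ℝ := fun z => ∑ l ∈ Finset.Icc 1 (K + 1), c l * nodeProd K p l z with hQ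
  have hcont : Continuous Q := by
    simp only [hQ, nodeProd]
    fun_prop
  have hsign : ∀ n ∈ Finset.Icc 1 (K + 1), 0 < (-1) ^ (n - 1) * Q (p n) := by
    intro n hn
    simp only [hQ, sum_mul_nodeProd c hn]
    have := mul_pos (hpos n hn) (nodeProd_sign hp hn)
    linarith
  have hroot : ∀ m ∈ Finset.Icc 1 K, ∃ y, (p (m + 1) < y ∧ y < p m) ∧ Q y = 0 := by
    intro m hm
    rw [Finset.mem_Icc] at hm
    have hlt : p (m + 1) < p m := hp (Finset.mem_coe.2 (Finset.mem_Icc.2 (by omega)))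
      (Finset.mem_coe.2 (Finset.mem_Icc.2 (by omega))) (Nat.lt_succ_self m)
    have s1 := hsign m (Finset.mem_Icc.2 (by omega))
    have s2 := hsign (m + 1) (Finset.mem_Icc.2 (by omega))
    obtain ⟨d, rfl⟩ : ∃ d, m = d + 1 := ⟨m - 1, by omega⟩
    simp only [Nat.add_sub_cancel, pow_succ] at s1 s2
    rcases neg_one_pow_eq_or ℝ d with hd | hd
    · rw [hd] at s1 s2
      obtain ⟨y, hy, hy0⟩ := intermediate_value_Ioo hlt.le hcont.continuousOn
        (show (0 : ℝ) ∈ Set.Ioo (Q (p (d + 1 + 1))) (Q (p (d + 1))) from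
          ⟨by linarith, by linarith⟩)
      exact ⟨y, hy, hy0⟩
    · rw [hd] at s1 s2
      obtain ⟨y, hy, hy0⟩ := intermediate_value_Ioo' hlt.le hcont.continuousOn
        (show (0 : ℝ) ∈ Set.Ioo (Q (p (d + 1))) (Q (p (d + 1 + 1))) from
          ⟨by linarith, by linarith⟩)
      exact ⟨y, hy, hy0⟩
  choose! b hb hb0 using hroot
  refine ⟨b, hb, sum_nodeProd_eq_prod hc (x := b) ?_ fun m hm => ?_⟩
  · have hanti : StrictAntiOn b (Finset.Icc 1 K : Finset ℕ) := by
      intro i hi j hj hij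
      have h1 := (hb i hi).1
      have h2 := (hb j hj).2
      have hi' := Finset.mem_Icc.1 hi
      have hj' := Finset.mem_Icc.1 hj
      have h3 : p j ≤ p (i + 1) := hp.antitoneOn (Finset.mem_coe.2 (Finset.mem_Icc.2 (by omega)))
        (Finset.mem_coe.2 (Finset.mem_Icc.2 (by omega))) (by omega)
      linarith
    exact hanti.injOn
  · have h0 := hb0 m hm
    simp only [hQ] at h0
    rw [h0, Finset.prod_eq_zero hm (sub_self _)]

theorem eval_sum_nodeProd_eq {K : ℕ} {p c b : ℕ → ℝ}
    (h : ∑ l ∈ Finset.Icc 1 (K + 1), Polynomial.C (c l) *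
      ∏ j ∈ (Finset.Icc 1 (K + 1)).erase l, (Polynomial.X - Polynomial.C (p j)) =
      ∏ i ∈ Finset.Icc 1 K, (Polynomial.X - Polynomial.C (b i))) (x : ℝ) :
    ∑ l ∈ Finset.Icc 1 (K + 1), c l * nodeProd K p l x = ∏ i ∈ Finset.Icc 1 K, (x - b i) := by
  simpa [Polynomial.eval_finsetSum, Polynomial.eval_prod, nodeProd] using
    congrArg (Polynomial.eval x) h

/-- Poles are determined up to order by the values of their monic polynomial at `K` points. -/
theorem map_val_eq_of_prod_eq {K : ℕ} {b b' x : ℕ → ℝ}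
    (hx : Set.InjOn x (Finset.Icc 1 K : Finset ℕ))
    (h : ∀ m ∈ Finset.Icc 1 K,
      ∏ i ∈ Finset.Icc 1 K, (x m - b i) = ∏ i ∈ Finset.Icc 1 K, (x m - b' i)) :
    (Finset.Icc 1 K).val.map b = (Finset.Icc 1 K).val.map b' := by
  have e : ∏ i ∈ Finset.Icc 1 K, (Polynomial.X - Polynomial.C (b i)) =
      ∏ i ∈ Finset.Icc 1 K, (Polynomial.X - Polynomial.C (b' i)) := by
    refine Polynomial.eq_of_degree_sub_lt_of_eval_finset_eq ((Finset.Icc 1 K).image x) ?_ ?_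
    · rw [Finset.card_image_of_injOn hx]
      exact degree_prod_sub_prod_lt _ _ rfl
    · intro y hy
      obtain ⟨m, hm, rfl⟩ := Finset.mem_image.1 hy
      simpa [Polynomial.eval_prod] using h m hm
  have e2 : ∀ d : ℕ → ℝ, (∏ i ∈ Finset.Icc 1 K, (Polynomial.X - Polynomial.C (d i))).roots =
      (Finset.Icc 1 K).val.map d := by
    intro d
    rw [← Polynomial.roots_multiset_prod_X_sub_C ((Finset.Icc 1 K).val.map d), Multiset.map_map]
    rfl
  rw [← e2, ← e2, e]

/-- The elementary symmetric functions of the poles are linear in the coefficients. -/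
theorem esymmPoles_eq {K : ℕ} {p c b : ℕ → ℝ}
    (h : ∑ l ∈ Finset.Icc 1 (K + 1), Polynomial.C (c l) *
      ∏ j ∈ (Finset.Icc 1 (K + 1)).erase l, (Polynomial.X - Polynomial.C (p j)) =
      ∏ i ∈ Finset.Icc 1 K, (Polynomial.X - Polynomial.C (b i))) {s : ℕ} (hs : s ≤ K) :
    esymmPoles K b s = ∑ l ∈ Finset.Icc 1 (K + 1), c l *
      ∑ S ∈ ((Finset.Icc 1 (K + 1)).erase l).powersetCard s, ∏ m ∈ S, p m := by
  have key : ∀ (t : Finset ℕ) (d : ℕ → ℝ), t.card = K →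
      (∏ i ∈ t, (Polynomial.X - Polynomial.C (d i))).coeff (K - s) =
        (-1) ^ s * ∑ S ∈ t.powersetCard s, ∏ m ∈ S, d m := by
    intro t d ht
    have h1 := Multiset.prod_X_sub_C_coeff (t.val.map d) (k := K - s) (by simp [ht])
    rw [Multiset.map_map, Multiset.card_map, Finset.card_val, ht, Nat.sub_sub_self hs,
      Finset.esymm_map_val] at h1
    exact h1
  have h2 := congrArg (fun P => (-1) ^ s * Polynomial.coeff P (K - s)) h
  simp only [Polynomial.finsetSum_coeff, Polynomial.coeff_C_mul] at h2
  rw [key _ b (by simp), ← mul_assoc, ← mul_pow, neg_one_mul, neg_neg, one_pow, one_mul] at h2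
  rw [esymmPoles, ← h2, Finset.mul_sum]
  refine Finset.sum_congr rfl fun l hl => ?_
  rw [key _ p (card_erase_Icc hl), mul_left_comm, ← mul_assoc ((-1 : ℝ) ^ s), ← mul_pow,
    neg_one_mul, neg_neg, one_pow, one_mul]

/-! ### Behaviour at infinity -/

theorem tendsto_prod_sub_div_pow {ι : Type*} (s : Finset ι) (f : ι → ℂ) :
    Tendsto (fun z : ℂ => (∏ i ∈ s, (z - f i)) / z ^ s.card) (cocompact ℂ) (𝓝 1) := by
  have hinv : Tendsto (fun z : ℂ => z⁻¹) (cocompact ℂ) (𝓝 0) := by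
    rw [← Metric.cobounded_eq_cocompact]
    exact tendsto_inv₀_cobounded
  have h1 : ∀ i ∈ s, Tendsto (fun z : ℂ => 1 - f i * z⁻¹) (cocompact ℂ) (𝓝 1) := fun i _ => by
    simpa using (hinv.const_mul (f i)).const_sub 1
  have h2 := tendsto_finsetProd s h1
  rw [Finset.prod_const_one] at h2
  refine h2.congr' ?_
  have h0 : ∀ᶠ z : ℂ in cocompact ℂ, z ≠ 0 := isCompact_singleton.compl_mem_cocompact
  filter_upwards [h0] with z hz
  rw [← Finset.prod_const, ← Finset.prod_div_distrib]
  refine Finset.prod_congr rfl fun i _ => ?_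
  field_simp

theorem tendsto_prod_div_prod {ι κ : Type*} {s : Finset ι} {t : Finset κ} (f : ι → ℂ) (g : κ → ℂ)
    (h : s.card = t.card) :
    Tendsto (fun z : ℂ => (∏ i ∈ s, (z - f i)) / ∏ i ∈ t, (z - g i)) (cocompact ℂ) (𝓝 1) := by
  have h1 := (tendsto_prod_sub_div_pow s f).div (tendsto_prod_sub_div_pow t g) one_ne_zero
  rw [div_one] at h1
  refine h1.congr' ?_
  have h0 : ∀ᶠ z : ℂ in cocompact ℂ, z ≠ 0 := isCompact_singleton.compl_mem_cocompact
  filter_upwards [h0] with z hz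
  rw [Pi.div_apply, h, div_div_div_cancel_right₀ (pow_ne_zero _ hz)]

/-- The value of a wave function at infinity does not depend on its poles. -/
theorem tendsto_sheetFun (K : ℕ) (ξ : ℝ) (C b : ℕ → ℝ) (V : ℕ → ℂ) :
    Tendsto (fun z => sheetFun K ξ C b V z) (cocompact ℂ)
      (𝓝 (∑ l ∈ Finset.Icc 1 (K + 1), (C l : ℂ) * V l)) := by
  unfold sheetFun
  refine tendsto_finsetSum _ fun l hl => ?_
  have h := tendsto_prod_div_prod (s := (Finset.Icc 1 (K + 1)).erase l) (t := Finset.Icc 1 K)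
    (fun j => (lamPt ξ j : ℂ)) (fun m => (b m : ℂ)) (by rw [card_erase_Icc hl]; simp)
  simpa using (h.const_mul (C l : ℂ)).mul_const (V l)

/-- The marked points decrease, so they can serve as the nodes of `exists_interlacing`. -/
theorem lamPt_strictAntiOn {ξ : ℝ} (hξ : 1 < ξ) (K : ℕ) :
    StrictAntiOn (lamPt ξ) (Finset.Icc 1 (K + 1) : Finset ℕ) := by
  intro i hi j hj hij
  have hi' := Finset.mem_Icc.1 (Finset.mem_coe.1 hi)
  unfold lamPt
  rw [if_neg (by omega : j ≠ 1)]
  split_ifs with h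
  · have : 0 < ξ ^ (2 * (j - 2)) := pow_pos (by linarith) _
    linarith
  · have := pow_lt_pow_right₀ hξ (by omega : 2 * (i - 2) < 2 * (j - 2))
    linarith

section Minors

/-! ### Minors of the last rows -/

/-- The entries of the `i`-th row counted from the bottom. -/
def brow {N M : ℕ} (H : Matrix (Fin N) (Fin M) ℝ) (i s : ℕ) : ℝ := entry H (N - i + 1) s

/-- Band structure and positivity of all minors formed by the last rows, with columns restricted to
the positions where such a minor can be nonzero. -/
structure BandTP {N M : ℕ} (H : Matrix (Fin N) (Fin M) ℝ) : Prop where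
  hN : 1 ≤ N
  hNM : N < M
  support : ∀ i s, 1 ≤ i → i ≤ N → (s < N - i + 1 ∨ M - i + 1 < s) → brow H i s = 0
  minor_pos : ∀ n c, n ≤ N → (∀ b, b < n → N - n + 1 ≤ c b ∧ c b ≤ M) →
    (∀ b, b + 1 < n → c b < c (b + 1)) → 0 < lastMinor H n c

variable {N M : ℕ} {H : Matrix (Fin N) (Fin M) ℝ}

theorem lastMinor_eq_det_brow (H : Matrix (Fin N) (Fin M) ℝ) {n : ℕ} (hn : n ≤ N) (c : ℕ → ℕ) :
    lastMinor H n c = Matrix.det (Matrix.of fun x y : Fin n => brow H (n - x) (c y)) := by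
  unfold lastMinor brow
  congr 1
  ext x y
  have := x.2
  simp only [Matrix.of_apply]
  congr 1
  omega

theorem lastMinor_congr {H H' : Matrix (Fin N) (Fin M) ℝ} {n r : ℕ} (hn : n ≤ r) (hr : r ≤ N)
    (h : ∀ i s, 1 ≤ i → i ≤ r → brow H i s = brow H' i s) (c : ℕ → ℕ) :
    lastMinor H n c = lastMinor H' n c := by
  rw [lastMinor_eq_det_brow H (by omega), lastMinor_eq_det_brow H' (by omega)]
  congr 1
  ext x y
  have := x.2
  exact h _ _ (by omega) (by omega)

theorem entry_eq (H : Matrix (Fin N) (Fin M) ℝ) {i j : ℕ} (hi : i < N) (hj : j < M) :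
    entry H (i + 1) (j + 1) = H ⟨i, hi⟩ ⟨j, hj⟩ := by
  unfold entry
  rw [dif_pos (by omega)]
  rfl

/-- A maximal minor whose first columns are `1, …, N - n` reduces to a minor of the last `n` rows,
because the left upper block is unitriangular and the left lower block vanishes. -/
theorem IsBandedTP.lastMinor_pos {A : Matrix (Fin N) (Fin M) ℝ} (hA : IsBandedTP A) (hNM : N < M)
    {n : ℕ} {c : ℕ → ℕ} (hn : n ≤ N) (hc : ∀ b, b < n → N - n + 1 ≤ c b ∧ c b ≤ M)
    (hmono : ∀ b, b + 1 < n → c b < c (b + 1)) : 0 < lastMinor A n c := by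
  obtain ⟨m, rfl⟩ : ∃ m, N = m + n := ⟨N - n, by omega⟩
  have hmono' : ∀ b d, b < d → d < n → c b < c d := by
    intro b d hbd
    induction d, hbd using Nat.le_induction with
    | base => exact fun h => hmono b h
    | succ d hd ih => exact fun h => (ih (by omega)).trans (hmono d h)
  let F : Fin (m + n) → Fin M := fun i =>
    if h : (i : ℕ) < m then ⟨i, by omega⟩
    else ⟨c (i - m) - 1, by have := hc (i - m) (by omega); omega⟩
  have hF : StrictMono F := by
    intro i j hij
    have hij' : (i : ℕ) < j := hij
    have hi := i.2
    have hj := j.2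
    simp only [F, Fin.lt_def]
    by_cases h1 : (i : ℕ) < m <;> by_cases h2 : (j : ℕ) < m
    · simpa [h1, h2] using hij'
    · have := hc (j - m) (by omega)
      simp only [h1, h2, dif_pos, dif_neg, not_false_eq_true]
      omega
    · omega
    · have a1 := hc (i - m) (by omega)
      have a2 := hc (j - m) (by omega)
      have a3 := hmono' (i - m) (j - m) (by omega) (by omega)
      simp only [h1, h2, dif_neg, not_false_eq_true]
      omega
  have key := hA.minors_pos (OrderEmbedding.ofStrictMono F hF)
  rw [← Matrix.det_submatrix_equiv_self (finSumFinEquiv (m := m) (n := n)),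
    ← Matrix.fromBlocks_toBlocks (Matrix.submatrix _ _ _)] at key
  have h21 : ((A.submatrix id (OrderEmbedding.ofStrictMono F hF)).submatrix
      (finSumFinEquiv (m := m) (n := n)) finSumFinEquiv).toBlocks₂₁ = 0 := by
    ext i j
    have hj := j.2
    simp only [Matrix.toBlocks₂₁, Matrix.of_apply, Matrix.submatrix_apply, id, Matrix.zero_apply,
      finSumFinEquiv_apply_left, finSumFinEquiv_apply_right, OrderEmbedding.coe_ofStrictMono]
    apply hA.band
    left
    simp [F]
    omega
  have h11 : ((A.submatrix id (OrderEmbedding.ofStrictMono F hF)).submatrix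
      (finSumFinEquiv (m := m) (n := n)) finSumFinEquiv).toBlocks₁₁.det = 1 := by
    rw [Matrix.det_of_isUpperTriangular]
    · refine Finset.prod_eq_one fun i _ => ?_
      simp only [Matrix.toBlocks₁₁, Matrix.of_apply, Matrix.submatrix_apply, id,
        finSumFinEquiv_apply_left, OrderEmbedding.coe_ofStrictMono]
      apply hA.diag
      simp [F]
    · intro i j hij
      simp only [id] at hij
      simp only [Matrix.toBlocks₁₁, Matrix.of_apply, Matrix.submatrix_apply, id,
        finSumFinEquiv_apply_left, OrderEmbedding.coe_ofStrictMono]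
      apply hA.band
      left
      simpa [F] using hij
  rw [h21, Matrix.det_fromBlocks_zero₂₁, h11, one_mul] at key
  refine key.trans_eq ?_
  unfold lastMinor
  congr 1
  ext x y
  have hx := x.2
  have hy := y.2
  have h3 := hc y hy
  simp only [Matrix.toBlocks₂₂, Matrix.of_apply, Matrix.submatrix_apply, id,
    finSumFinEquiv_apply_right, OrderEmbedding.coe_ofStrictMono]
  unfold entry
  rw [dif_pos (by omega)]
  congr 1
  · ext; simp
  · simp [F]

theorem IsBandedTP.bandTP {A : Matrix (Fin N) (Fin M) ℝ} (hA : IsBandedTP A) (hN : 1 ≤ N)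
    (hNM : N < M) : BandTP A where
  hN := hN
  hNM := hNM
  support i s h1 h2 h3 := by
    unfold brow entry
    split_ifs with h
    · apply hA.band
      simp only
      omega
    · rfl
  minor_pos _ _ hn hc hmono := hA.lastMinor_pos hNM hn hc hmono

theorem minorHead_eq_det (H : Matrix (Fin N) (Fin M) ℝ) {q : ℕ} (hq : q + 1 ≤ N) (s p : ℕ) :
    minorHead H (q + 1) s p = Matrix.det (Matrix.of fun x y : Fin (q + 1) =>
      brow H (q + 1 - x) (if (y : ℕ) = 0 then s else p + ((y : ℕ) - 1))) :=
  lastMinor_eq_det_brow H hq _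

theorem minorHead_eq_zero (H : Matrix (Fin N) (Fin M) ℝ) {r s p : ℕ} (hr : r ≤ N)
    (h1 : p ≤ s) (h2 : s + 2 ≤ p + r) : minorHead H r s p = 0 := by
  obtain ⟨q, rfl⟩ : ∃ q, r = q + 1 := ⟨r - 1, by omega⟩
  rw [minorHead_eq_det H hr]
  refine Matrix.det_zero_of_column_eq (i := ⟨0, by omega⟩) (j := ⟨s - p + 1, by omega⟩)
    (by simp) fun x => ?_
  simp only [Matrix.of_apply, Nat.add_sub_cancel, if_true, Nat.add_eq_zero_iff, one_ne_zero,
    and_false, if_false]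
  congr 1
  omega

/-- Laplace expansion along the first column. -/
theorem exists_minorHead_expansion (H : Matrix (Fin N) (Fin M) ℝ) {q : ℕ} (hq : q + 1 ≤ N)
    (p : ℕ) : ∃ κ : Fin q → ℝ, ∀ s, minorHead H (q + 1) s p =
      minorRun H q p * brow H (q + 1) s + ∑ x : Fin q, κ x * brow H (q - x) s := by
  refine ⟨fun x => (-1) ^ ((x : ℕ) + 1) * Matrix.det (Matrix.of fun (y z : Fin q) =>
    brow H (q + 1 - (x.succ.succAbove y : Fin (q + 1))) (p + z)), fun s => ?_⟩
  rw [minorHead_eq_det H hq, Matrix.det_succ_column_zero, Fin.sum_univ_succ]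
  congr 1
  · unfold minorRun
    rw [lastMinor_eq_det_brow H (by omega)]
    simp only [Fin.val_zero, pow_zero, one_mul, Matrix.of_apply, if_true, Nat.sub_zero]
    rw [mul_comm]
    congr 2
    ext x y
    simp
  · refine Finset.sum_congr rfl fun x _ => ?_
    simp only [Matrix.of_apply, Fin.val_zero, if_true, Fin.val_succ]
    rw [mul_right_comm, Nat.add_sub_add_right]
    congr 3

theorem minorTail_eq (H : Matrix (Fin N) (Fin M) ℝ) {r : ℕ} (h1 : 1 ≤ r) (p s : ℕ) :
    minorTail H r p s = (-1) ^ (r - 1) * minorHead H r s p := by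
  obtain ⟨q, rfl⟩ : ∃ q, r = q + 1 := ⟨r - 1, by omega⟩
  unfold minorTail minorHead lastMinor
  have h := Matrix.det_permute' (finRotate (q + 1)) (Matrix.of fun a b : Fin (q + 1) =>
    entry H (N - (q + 1) + 1 + (a : ℕ)) (if (b : ℕ) = 0 then s else p + ((b : ℕ) - 1)))
  rw [sign_finRotate, Nat.add_sub_cancel] at h
  have h3 : (((((-1 : ℤˣ) ^ q : ℤˣ) : ℤ)) : ℝ) = (-1) ^ q := by simp
  rw [h3] at h
  rw [Nat.add_sub_cancel, ← h]
  congr 1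
  ext x y
  simp only [Matrix.of_apply, Matrix.submatrix_apply, id]
  congr 1
  by_cases hy : (y : ℕ) + 1 < q + 1
  · rw [coe_finRotate_of_ne_last (by rintro rfl; simp at hy)]
    simp [hy]
  · have : y = Fin.last q := by ext; simp; omega
    subst this
    simp

/-- A linear combination of the last `q` rows vanishing at `q` consecutive columns vanishes. -/
theorem BandTP.combination_eq_zero (hH : BandTP H) {q p : ℕ} (hq : q ≤ N) (hp1 : N - q + 1 ≤ p)
    (hp2 : p + q ≤ M + 1) (κ : Fin q → ℝ)
    (h : ∀ s, p ≤ s → s < p + q → ∑ x : Fin q, κ x * brow H (q - x) s = 0) : κ = 0 := by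
  have hdet : 0 < lastMinor H q (fun b => p + b) :=
    hH.minor_pos _ _ hq (fun b hb => by omega) (fun b _ => by omega)
  rw [lastMinor_eq_det_brow H hq] at hdet
  refine Matrix.eq_zero_of_vecMul_eq_zero hdet.ne' ?_
  ext y
  simpa [Matrix.vecMul, dotProduct] using h (p + y) (by omega) (by omega)

theorem BandTP.minorRun_pos (hH : BandTP H) {q p : ℕ} (hq : q ≤ N) (hp1 : N - q + 1 ≤ p)
    (hp2 : p + q ≤ M + 1) : 0 < minorRun H q p :=
  hH.minor_pos _ _ hq (fun b hb => by omega) (fun b _ => by omega)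

theorem BandTP.minorHead_pos (hH : BandTP H) {r s p : ℕ} (hr : r ≤ N) (hs : N - r + 1 ≤ s)
    (hsp : s < p) (hp : p + r ≤ M + 2) (hsM : s ≤ M) : 0 < minorHead H r s p := by
  refine hH.minor_pos _ _ hr (fun b hb => ?_) (fun b hb => ?_)
  · split_ifs <;> omega
  · rw [if_neg (Nat.succ_ne_zero b)]
    split_ifs <;> omega

/-- If the columns lie to the right of the band of the top row, then only the top row contributes to
the entry in the first column. -/
theorem BandTP.minorHead_eq_mul (hH : BandTP H) {q : ℕ} (hq : q + 1 ≤ N) (s : ℕ) :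
    minorHead H (q + 1) s (M - q + 1) = minorRun H q (M - q + 1) * brow H (q + 1) s := by
  have hNM := hH.hNM
  obtain ⟨κ, hκ⟩ := exists_minorHead_expansion H hq (M - q + 1)
  have h0 : κ = 0 := by
    refine hH.combination_eq_zero (p := M - q + 1) (by omega) (by omega) (by omega) κ
      fun t h1 h2 => ?_
    have h3 := hκ t
    rw [minorHead_eq_zero H hq h1 (by omega), hH.support (q + 1) t (by omega) hq (by omega)] at h3
    linarith
  rw [hκ, h0]
  simp

theorem BandTP.brow_pos (hH : BandTP H) {i s : ℕ} (h1 : 1 ≤ i) (hi : i ≤ N) (hs1 : N - i + 1 ≤ s)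
    (hs2 : s + i ≤ M + 1) : 0 < brow H i s := by
  obtain ⟨q, rfl⟩ : ∃ q, i = q + 1 := ⟨i - 1, by omega⟩
  have hNM := hH.hNM
  have h2 := hH.minorHead_eq_mul hi s
  have h3 := hH.minorHead_pos (r := q + 1) (s := s) (p := M - q + 1) hi hs1 (by omega) (by omega)
    (by omega)
  have h4 := hH.minorRun_pos (q := q) (p := M - q + 1) (by omega) (by omega) (by omega)
  rw [h2] at h3
  exact pos_of_mul_pos_right h3 h4.le

/-! ### Row normalization -/

/-- The row sum of the `i`-th row counted from the bottom. -/
def rowSum {N M : ℕ} (A : Matrix (Fin N) (Fin M) ℝ) (i : ℕ) : ℝ := ∑ s ∈ Finset.Icc 1 M, brow A i s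

theorem sum_Icc_eq_sum_fin {M : ℕ} (f : ℕ → ℝ) :
    ∑ s ∈ Finset.Icc 1 M, f s = ∑ j : Fin M, f (j + 1) := by
  rw [Fin.sum_univ_eq_sum_range (fun j => f (j + 1)) M, Finset.range_eq_Ico,
    Finset.sum_Ico_add' f 0 M 1]
  rfl

theorem brow_hatA (A : Matrix (Fin N) (Fin M) ℝ) (i s : ℕ) :
    brow (hatA A) i s = brow A i s / rowSum A i := by
  unfold rowSum
  unfold brow
  by_cases h : (1 ≤ N - i + 1 ∧ N - i + 1 ≤ N) ∧ (1 ≤ s ∧ s ≤ M)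
  · obtain ⟨t, rfl⟩ : ∃ t, s = t + 1 := ⟨s - 1, by omega⟩
    rw [sum_Icc_eq_sum_fin, entry_eq _ (by omega) (by omega), entry_eq _ (by omega) (by omega),
      hatA]
    congr 1
    exact Finset.sum_congr rfl fun j _ => (entry_eq _ _ j.2).symm
  · have h0 : ∀ B : Matrix (Fin N) (Fin M) ℝ, entry B (N - i + 1) s = 0 := fun B => dif_neg h
    simp [h0]

theorem BandTP.brow_nonneg (hH : BandTP H) {i : ℕ} (h1 : 1 ≤ i) (hi : i ≤ N) (s : ℕ) :
    0 ≤ brow H i s := by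
  by_cases h : s < N - i + 1 ∨ M - i + 1 < s
  · rw [hH.support i s h1 hi h]
  · have := hH.hNM
    exact (hH.brow_pos h1 hi (by omega) (by omega)).le

theorem BandTP.rowSum_pos (hH : BandTP H) {i : ℕ} (h1 : 1 ≤ i) (hi : i ≤ N) : 0 < rowSum H i := by
  have := hH.hNM
  exact Finset.sum_pos' (fun s _ => hH.brow_nonneg h1 hi s)
    ⟨N - i + 1, Finset.mem_Icc.2 (by omega), hH.brow_pos h1 hi le_rfl (by omega)⟩

theorem BandTP.rowSum_hatA (hH : BandTP H) {i : ℕ} (h1 : 1 ≤ i) (hi : i ≤ N) :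
    rowSum (hatA H) i = 1 := by
  have h := (hH.rowSum_pos h1 hi).ne'
  unfold rowSum at h ⊢
  simp only [brow_hatA]
  rw [← Finset.sum_div]
  exact div_self h

theorem BandTP.hatA (hH : BandTP H) : BandTP (hatA H) where
  hN := hH.hN
  hNM := hH.hNM
  support i s h1 h2 h3 := by rw [brow_hatA, hH.support i s h1 h2 h3, zero_div]
  minor_pos n c hn hc hmono := by
    have h := hH.minor_pos n c hn hc hmono
    rw [lastMinor_eq_det_brow _ hn] at h ⊢
    have h2 : (Matrix.of fun x y : Fin n => brow (VacuumKP.hatA H) (n - x) (c y)) =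
        Matrix.of fun x y : Fin n => (rowSum H (n - x))⁻¹ *
          (Matrix.of fun x y : Fin n => brow H (n - x) (c y)) x y := by
      ext x y
      simp [brow_hatA, div_eq_inv_mul]
    rw [h2, Matrix.det_mul_column]
    refine mul_pos (Finset.prod_pos fun x _ => inv_pos.2 (hH.rowSum_pos ?_ ?_)) h
    · have := x.2; omega
    · omega

/-! ### Reduced rows and the leading constants -/

/-- The `r`-th row from the bottom, modified by a combination of the rows below it so as to vanish
at the columns `p, …, p + r - 2`, written as a quotient of minors. -/
def redRow {N M : ℕ} (H : Matrix (Fin N) (Fin M) ℝ) (r p s : ℕ) : ℝ :=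
  minorHead H r s p / minorRun H (r - 1) p

/-- The sum of the entries of a reduced row to the left of its gap, which begins at the column
`N - r + n`. -/
def redSum {N M : ℕ} (H : Matrix (Fin N) (Fin M) ℝ) (r n : ℕ) : ℝ :=
  ∑ s ∈ Finset.Icc (N - r + 1) (N - r + n - 1), redRow H r (N - r + n) s

theorem redSum_eq (H : Matrix (Fin N) (Fin M) ℝ) (r n : ℕ) :
    redSum H r n = minorSum H r n / minorRun H (r - 1) (N - r + n) := by
  unfold redSum minorSum redRow
  rw [Finset.sum_div]

theorem redRow_eq_zero (H : Matrix (Fin N) (Fin M) ℝ) {r s p : ℕ} (hr : r ≤ N)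
    (h1 : p ≤ s) (h2 : s + 2 ≤ p + r) : redRow H r p s = 0 := by
  rw [redRow, minorHead_eq_zero H hr h1 h2, zero_div]

theorem BandTP.exists_redRow_expansion (hH : BandTP H) {q p : ℕ} (hq : q + 1 ≤ N)
    (hp1 : N - q + 1 ≤ p) (hp2 : p + q ≤ M + 1) : ∃ κ : Fin q → ℝ, ∀ s,
      redRow H (q + 1) p s = brow H (q + 1) s + ∑ x : Fin q, κ x * brow H (q - x) s := by
  obtain ⟨κ, hκ⟩ := exists_minorHead_expansion H hq p
  have h := (hH.minorRun_pos (q := q) (p := p) (by omega) hp1 hp2).ne'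
  refine ⟨fun x => κ x / minorRun H q p, fun s => ?_⟩
  rw [redRow, hκ, Nat.add_sub_cancel, add_div, mul_div_cancel_left₀ _ h, Finset.sum_div]
  congr 1
  exact Finset.sum_congr rfl fun x _ => by ring

theorem BandTP.redRow_pos (hH : BandTP H) {r s p : ℕ} (h1 : 1 ≤ r) (hr : r ≤ N)
    (hs : N - r + 1 ≤ s) (hsp : s < p) (hp : p + r ≤ M + 2) (hsM : s ≤ M) :
    0 < redRow H r p s :=
  div_pos (hH.minorHead_pos hr hs hsp hp hsM)
    (hH.minorRun_pos (by omega) (by omega) (by omega))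

/-- The three-term Plücker relation: moving the gap of a reduced row by one column to the right
changes the row by a multiple of a reduced row of the next lower order. Both sides are combinations
of the lower rows, and they agree at so many columns that they are equal. -/
theorem BandTP.redRow_step (hH : BandTP H) {q p : ℕ} (hq : q + 2 ≤ N) (hp1 : N - q ≤ p)
    (hp2 : p + q + 1 ≤ M) (s : ℕ) :
    redRow H (q + 2) (p + 1) s - redRow H (q + 2) p s =
      redRow H (q + 2) (p + 1) p / redRow H (q + 1) (p + 1) p * redRow H (q + 1) (p + 1) s := by
  -- The top rows cancel in the difference, and the row below them occurs there with the
  -- coefficient `κ₁ 0 - κ₂ 0`.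
  obtain ⟨κ₁, h₁⟩ := hH.exists_redRow_expansion (q := q + 1) (p := p + 1) (by omega) (by omega)
    (by omega)
  obtain ⟨κ₂, h₂⟩ := hH.exists_redRow_expansion (q := q + 1) (p := p) (by omega) (by omega)
    (by omega)
  obtain ⟨κ₃, h₃⟩ := hH.exists_redRow_expansion (q := q) (p := p + 1) (by omega) (by omega)
    (by omega)
  have key : ∀ s, redRow H (q + 2) (p + 1) s - redRow H (q + 2) p s -
      (κ₁ 0 - κ₂ 0) * redRow H (q + 1) (p + 1) s =
      ∑ x : Fin q, (κ₁ x.succ - κ₂ x.succ - (κ₁ 0 - κ₂ 0) * κ₃ x) * brow H (q - x) s := by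
    intro s
    rw [h₁, h₂, h₃, Fin.sum_univ_succ, Fin.sum_univ_succ]
    simp only [sub_mul, Finset.sum_sub_distrib, Fin.val_succ, Nat.add_sub_add_right, Fin.val_zero,
      Nat.sub_zero, mul_assoc, ← Finset.mul_sum]
    ring
  have h0 := hH.combination_eq_zero (q := q) (p := p + 1) (by omega) (by omega) (by omega)
    (fun x => κ₁ x.succ - κ₂ x.succ - (κ₁ 0 - κ₂ 0) * κ₃ x) fun t ht1 ht2 => by
      rw [← key, redRow_eq_zero H hq (by omega) (by omega),
        redRow_eq_zero H hq (by omega) (by omega), redRow_eq_zero H (by omega) ht1 (by omega)]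
      ring
  have key2 : ∀ s, redRow H (q + 2) (p + 1) s - redRow H (q + 2) p s =
      (κ₁ 0 - κ₂ 0) * redRow H (q + 1) (p + 1) s := by
    intro s
    have h4 := key s
    rw [Finset.sum_eq_zero fun x _ => by rw [congrFun h0 x]; simp] at h4
    linarith
  have hne : redRow H (q + 1) (p + 1) p ≠ 0 :=
    (hH.redRow_pos (by omega) (by omega) (by omega) (by omega) (by omega) (by omega)).ne'
  have h5 := key2 p
  rw [redRow_eq_zero H hq le_rfl (by omega), sub_zero] at h5
  rw [key2 s, h5, mul_div_cancel_right₀ _ hne]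

/-- Lower rows do not reach the first column of the band. -/
theorem BandTP.redRow_first (hH : BandTP H) {r p : ℕ} (h1 : 1 ≤ r) (hr : r ≤ N)
    (hp1 : N - r + 2 ≤ p) (hp2 : p + r ≤ M + 2) :
    redRow H r p (N - r + 1) = brow H r (N - r + 1) := by
  obtain ⟨q, rfl⟩ : ∃ q, r = q + 1 := ⟨r - 1, by omega⟩
  obtain ⟨κ, h⟩ := hH.exists_redRow_expansion (q := q) (p := p) (by omega) (by omega) (by omega)
  rw [h, Finset.sum_eq_zero, add_zero]
  intro x _
  have := x.2
  rw [hH.support _ _ (by omega) (by omega) (by omega), mul_zero]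

theorem BandTP.redRow_left (hH : BandTP H) {r p s : ℕ} (h1 : 1 ≤ r) (hr : r ≤ N)
    (hp1 : N - r + 2 ≤ p) (hp2 : p + r ≤ M + 2) (hs : s ≤ N - r) :
    redRow H r p s = 0 := by
  obtain ⟨q, rfl⟩ : ∃ q, r = q + 1 := ⟨r - 1, by omega⟩
  obtain ⟨κ, h⟩ := hH.exists_redRow_expansion (q := q) (p := p) (by omega) (by omega) (by omega)
  rw [h, Finset.sum_eq_zero, add_zero, hH.support _ _ (by omega) (by omega) (by omega)]
  intro x _
  have := x.2
  rw [hH.support _ _ (by omega) (by omega) (by omega), mul_zero]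

theorem BandTP.redRow_last (hH : BandTP H) {r : ℕ} (h1 : 1 ≤ r) (hr : r ≤ N) (s : ℕ) :
    redRow H r (M - r + 2) s = brow H r s := by
  have := hH.hNM
  obtain ⟨q, rfl⟩ : ∃ q, r = q + 1 := ⟨r - 1, by omega⟩
  have h2 : M - (q + 1) + 2 = M - q + 1 := by omega
  rw [redRow, h2, hH.minorHead_eq_mul hr, Nat.add_sub_cancel,
    mul_div_cancel_left₀ _ (hH.minorRun_pos (by omega) (by omega) (by omega)).ne']

theorem BandTP.redSum_pos (hH : BandTP H) {r n : ℕ} (h1 : 1 ≤ r) (hr : r ≤ N) (hn : 2 ≤ n)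
    (hnM : n ≤ M - N + 2) : 0 < redSum H r n := by
  have := hH.hNM
  refine Finset.sum_pos (fun s hs => ?_) ⟨N - r + 1, Finset.mem_Icc.2 (by omega)⟩
  rw [Finset.mem_Icc] at hs
  exact hH.redRow_pos h1 hr hs.1 (by omega) (by omega) (by omega)

theorem BandTP.minorSum_pos (hH : BandTP H) {r n : ℕ} (h1 : 1 ≤ r) (hr : r ≤ N) (hn : 2 ≤ n)
    (hnM : n ≤ M - N + 2) : 0 < minorSum H r n := by
  have := hH.hNM
  refine Finset.sum_pos (fun s hs => ?_) ⟨N - r + 1, Finset.mem_Icc.2 (by omega)⟩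
  rw [Finset.mem_Icc] at hs
  exact hH.minorHead_pos hr hs.1 (by omega) (by omega) (by omega)

theorem hatB_succ_succ (H : Matrix (Fin N) (Fin M) ℝ) (q : ℕ) {l : ℕ} (hl : 2 ≤ l) :
    hatB H (q + 2) l = minorRun H (q + 2) (N - (q + 2) + l) *
        (∑ s ∈ Finset.Icc (N - (q + 2) + 2) (N - (q + 2) + l),
          minorHead H (q + 1) s (N - (q + 2) + l + 1)) /
      (minorRun H (q + 1) (N - (q + 2) + l + 1) * minorRun H (q + 1) (N - (q + 2) + l)) := by
  unfold hatB
  rw [if_neg (by omega), if_neg (by omega)]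
  rfl

theorem minorHead_run (H : Matrix (Fin N) (Fin M) ℝ) (r p : ℕ) :
    minorHead H r p (p + 1) = minorRun H r p := by
  unfold minorHead minorRun
  congr 1
  ext b
  split_ifs <;> omega

/-- In terms of reduced rows, `hatB` is the factor of the three-term relation, multiplied by the
normalizing sum. -/
theorem BandTP.hatB_eq (hH : BandTP H) {q l : ℕ} (hq : q + 2 ≤ N) (hl : 2 ≤ l)
    (hlM : l ≤ M - N + 1) :
    hatB H (q + 2) l = redRow H (q + 2) (N - (q + 2) + l + 1) (N - (q + 2) + l) /
      redRow H (q + 1) (N - (q + 2) + l + 1) (N - (q + 2) + l) * redSum H (q + 1) l := by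
  have := hH.hNM
  rw [hatB_succ_succ H q hl, redSum_eq, minorSum, redRow, redRow, minorHead_run, minorHead_run]
  have e1 : N - (q + 1) + l = N - (q + 2) + l + 1 := by omega
  have e2 : N - (q + 1) + 1 = N - (q + 2) + 2 := by omega
  rw [e1, e2, Nat.add_sub_cancel]
  have p1 := (hH.minorRun_pos (q := q + 1) (p := N - (q + 2) + l + 1) (by omega) (by omega)
    (by omega)).ne'
  have p2 := (hH.minorRun_pos (q := q + 1) (p := N - (q + 2) + l) (by omega) (by omega)
    (by omega)).ne'
  have p3 := (hH.minorRun_pos (q := q) (p := N - (q + 2) + l + 1) (by omega) (by omega)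
    (by omega)).ne'
  simp only [Nat.add_sub_cancel, show q + 2 - 1 = q + 1 from rfl]
  field_simp

theorem BandTP.hatB_mul (hH : BandTP H) {q l : ℕ} (hq : q + 2 ≤ N) (hl : 2 ≤ l)
    (hlM : l ≤ M - N + 1) (s : ℕ) :
    hatB H (q + 2) l * (redRow H (q + 1) (N - (q + 1) + l) s / redSum H (q + 1) l) =
      redRow H (q + 2) (N - (q + 2) + (l + 1)) s - redRow H (q + 2) (N - (q + 2) + l) s := by
  have := hH.hNM
  have e1 : N - (q + 1) + l = N - (q + 2) + l + 1 := by omega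
  rw [← add_assoc, hH.redRow_step hq (by omega) (by omega) s, hH.hatB_eq hq hl hlM, e1]
  have := (hH.redSum_pos (r := q + 1) (n := l) (by omega) (by omega) hl (by omega)).ne'
  field_simp

theorem hatB_one (H : Matrix (Fin N) (Fin M) ℝ) (j : ℕ) :
    hatB H 1 j = entry H N (N + j - 1) := if_pos rfl

theorem BandTP.hatB_one_eq (hH : BandTP H) (j : ℕ) : hatB H 1 j = brow H 1 (N + j - 1) := by
  rw [hatB_one, brow, Nat.sub_add_cancel hH.hN]

theorem hatB_first (H : Matrix (Fin N) (Fin M) ℝ) {r : ℕ} (h1 : 1 ≤ r) :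
    hatB H r 1 = brow H r (N - r + 1) := by
  unfold hatB brow
  by_cases h : r = 1
  · subst h
    rw [if_pos rfl]
    by_cases hN : N = 0
    -- For `N = 0` both sides are entries of an empty matrix, which are zero by convention.
    · subst hN
      simp [entry]
    · congr 1 <;> omega
  · rw [if_neg h, if_pos rfl]

theorem BandTP.hatB_pos (hH : BandTP H) {r l : ℕ} (h1 : 1 ≤ r) (hr : r ≤ N) (hl : 1 ≤ l)
    (hlM : l ≤ M - N + 1) : 0 < hatB H r l := by
  have := hH.hNM
  rcases hl.eq_or_lt with rfl | hl
  · rw [hatB_first H h1]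
    exact hH.brow_pos h1 hr le_rfl (by omega)
  obtain rfl | ⟨q, rfl⟩ : r = 1 ∨ ∃ q, r = q + 2 := by
    by_cases h : r = 1
    · exact Or.inl h
    · exact Or.inr ⟨r - 2, by omega⟩
  · rw [hH.hatB_one_eq]
    exact hH.brow_pos h1 hr (by omega) (by omega)
  · rw [hH.hatB_eq hr hl hlM]
    refine mul_pos (div_pos ?_ ?_) (hH.redSum_pos (by omega) (by omega) hl (by omega)) <;>
    exact hH.redRow_pos (by omega) (by omega) (by omega) (by omega) (by omega) (by omega)

theorem BandTP.redRow_one (hH : BandTP H) (p s : ℕ) : redRow H 1 p s = brow H 1 s := by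
  have hN := hH.hN
  unfold redRow
  rw [minorHead_eq_det H (by omega : 0 + 1 ≤ N)]
  simp [minorRun, lastMinor]

/-- The partial sums of the leading coefficients. In the induction on `n`, the telescoping relation
turns the reduced row for `n` into the one for `n + 1`. -/
theorem BandTP.sum_hatB (hH : BandTP H) {r n : ℕ} (h1 : 1 ≤ r) (hr : r ≤ N) (hn : 2 ≤ n)
    (hnM : n ≤ M - N + 2) : ∑ i ∈ Finset.Icc 1 (n - 1), hatB H r i = redSum H r n := by
  have hNM := hH.hNM
  have hN := hH.hN
  induction n, hn using Nat.le_induction with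
  | base =>
    have e : N - r + 2 - 1 = N - r + 1 := by omega
    simp only [redSum, e, Finset.Icc_self, Finset.sum_singleton, Nat.add_one_sub_one]
    rw [hatB_first H h1, hH.redRow_first h1 hr le_rfl (by omega)]
  | succ n hn ih =>
    have ih' := ih (by omega)
    have e1 : n + 1 - 1 = n - 1 + 1 := by omega
    rw [e1, Finset.sum_Icc_succ_top (by omega), ih', Nat.sub_add_cancel (by omega)]
    unfold redSum
    have e2 : N - r + (n + 1) - 1 = N - r + n - 1 + 1 := by omega
    rw [e2, Finset.sum_Icc_succ_top (by omega), Nat.sub_add_cancel (by omega)]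
    obtain rfl | ⟨q, rfl⟩ : r = 1 ∨ ∃ q, r = q + 2 := by
      by_cases h : r = 1
      · exact Or.inl h
      · exact Or.inr ⟨r - 2, by omega⟩
    · simp only [hH.redRow_one, hH.hatB_one_eq]
      congr 2
      omega
    · have e3 : redRow H (q + 2) (N - (q + 2) + n) (N - (q + 2) + n) = 0 :=
        redRow_eq_zero H hr le_rfl (by omega)
      have e4 : ∀ s, redRow H (q + 2) (N - (q + 2) + (n + 1)) s =
          redRow H (q + 2) (N - (q + 2) + n) s + hatB H (q + 2) n *
            (redRow H (q + 1) (N - (q + 1) + n) s / redSum H (q + 1) n) := fun s => by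
        rw [hH.hatB_mul hr hn (by omega)]; ring
      simp only [e4, e3, Finset.sum_add_distrib, zero_add, add_assoc]
      congr 1
      have e8 := Finset.sum_Icc_succ_top (a := N - (q + 2) + 1) (b := N - (q + 2) + n - 1)
        (by omega) (fun s => redRow H (q + 1) (N - (q + 1) + n) s / redSum H (q + 1) n)
      have e5 : N - (q + 2) + n - 1 + 1 = N - (q + 1) + n - 1 := by omega
      have e9 : N - (q + 2) + n = N - (q + 1) + n - 1 := by omega
      rw [← Finset.mul_sum, ← mul_add]
      rw [e5] at e8
      rw [e9] at e8 ⊢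
      rw [← e8, ← Finset.sum_div]
      · have e6 : Finset.Icc (N - (q + 2) + 1) (N - (q + 1) + n - 1) =
            insert (N - (q + 2) + 1) (Finset.Icc (N - (q + 1) + 1) (N - (q + 1) + n - 1)) := by
          ext x
          simp only [Finset.mem_Icc, Finset.mem_insert]
          omega
        have e7 : (∑ s ∈ Finset.Icc (N - (q + 2) + 1) (N - (q + 1) + n - 1),
            redRow H (q + 1) (N - (q + 1) + n) s) = redSum H (q + 1) n := by
          rw [e6, Finset.sum_insert (by simp only [Finset.mem_Icc]; omega),
            hH.redRow_left (by omega) (by omega) (by omega) (by omega) (by omega), zero_add]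
          rfl
        rw [e7, div_self (hH.redSum_pos (by omega) (by omega) hn (by omega)).ne', mul_one]

/-- The telescoping sum behind the closed formula for `hatB`. -/
theorem BandTP.sum_hatB_mul (hH : BandTP H) {q m n : ℕ} (hq : q + 2 ≤ N) (hm : 2 ≤ m)
    (hmn : m ≤ n) (hnM : n ≤ M - N + 2) (s : ℕ) :
    ∑ l ∈ Finset.Ico m n,
        hatB H (q + 2) l * (redRow H (q + 1) (N - (q + 1) + l) s / redSum H (q + 1) l) =
      redRow H (q + 2) (N - (q + 2) + n) s - redRow H (q + 2) (N - (q + 2) + m) s := by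
  rw [← Finset.sum_Ico_sub (fun l => redRow H (q + 2) (N - (q + 2) + l) s) hmn]
  refine Finset.sum_congr rfl fun l hl => ?_
  rw [Finset.mem_Ico] at hl
  exact hH.hatB_mul hq (by omega) (by omega) s

theorem hatSigma_succ_succ (H : Matrix (Fin N) (Fin M) ℝ) (r n s : ℕ) :
    hatSigma H (r + 2) n s = (if s = N - (r + 2) + 1 then hatB H (r + 2) 1
       else if s ≤ N - (r + 2) + n - 1 then
         ∑ j ∈ Finset.Icc (s + (r + 2) - N) (n - 1), hatB H (r + 2) j * hatSigma H (r + 1) j s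
       else if s ≤ N + n - 2 then
         (if n = 2 then 0 else hatB H (r + 2) (n - 1) * hatSigma H (r + 1) (n - 1) s)
           + hatB H (r + 2) n * hatSigma H (r + 1) n s
       else
         ∑ j ∈ Finset.Icc n (s - N + 1), hatB H (r + 2) j * hatSigma H (r + 1) j s) /
      ∑ i ∈ Finset.Icc 1 (n - 1), hatB H (r + 2) i := rfl

theorem Icc_eq_Ico_succ (a b : ℕ) : Finset.Icc a b = Finset.Ico a (b + 1) := by
  ext x
  simp only [Finset.mem_Icc, Finset.mem_Ico]
  omega

/-- Left of the gap the leading coefficients are the normalized entries of the reduced row. -/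
theorem BandTP.hatSigma_head (hH : BandTP H) {r : ℕ} (h1 : 1 ≤ r) (hr : r ≤ N) :
    ∀ n s, 2 ≤ n → n ≤ M - N + 1 → N - r + 1 ≤ s → s ≤ N - r + n - 1 →
      hatSigma H r n s = redRow H r (N - r + n) s / redSum H r n := by
  have hNM := hH.hNM
  have hN := hH.hN
  induction r, h1 using Nat.le_induction with
  | base =>
    intro n s hn hnM hs1 hs2
    rw [hH.redRow_one, ← hH.sum_hatB le_rfl hr hn (by omega)]
    simp only [hatSigma, hH.hatB_one_eq, brow, Nat.sub_add_cancel hN]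
    congr 1
    rw [Icc_eq_Ico_succ, Icc_eq_Ico_succ, Finset.sum_Ico_eq_sum_range, Finset.sum_Ico_eq_sum_range]
    refine Finset.sum_congr (by congr 1; omega) fun i _ => ?_
    congr 1
    omega
  | succ q hq ih =>
    obtain ⟨q, rfl⟩ : ∃ q', q = q' + 1 := ⟨q - 1, by omega⟩
    intro n s hn hnM hs1 hs2
    rw [show q + 1 + 1 = q + 2 from rfl] at *
    rw [hatSigma_succ_succ, hH.sum_hatB (by omega) hr hn (by omega)]
    congr 1
    by_cases h : s = N - (q + 2) + 1
    · rw [if_pos h, h, hatB_first H (by omega),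
        hH.redRow_first (by omega) hr (by omega) (by omega)]
    rw [if_neg h, if_pos hs2, Icc_eq_Ico_succ, Nat.sub_add_cancel (by omega)]
    have e := hH.sum_hatB_mul hr (m := s + (q + 2) - N) (n := n) (by omega) (by omega) (by omega) s
    rw [redRow_eq_zero H hr (p := N - (q + 2) + (s + (q + 2) - N)) (by omega) (by omega),
      sub_zero] at e
    rw [← e]
    refine Finset.sum_congr rfl fun l hl => ?_
    rw [Finset.mem_Ico] at hl
    rw [ih (by omega) l s (by omega) (by omega) (by omega) (by omega)]

/-- Right of the gap the same holds up to a sign. -/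
theorem BandTP.hatSigma_tail (hH : BandTP H) {r : ℕ} (h1 : 1 ≤ r) (hr : r ≤ N) :
    ∀ n s, 2 ≤ n → n ≤ M - N + 1 → N + n - 1 ≤ s → s ≤ M →
      hatSigma H r n s = (-1) ^ (r - 1) * redRow H r (N - r + n) s / redSum H r n := by
  have hNM := hH.hNM
  have hN := hH.hN
  induction r, h1 using Nat.le_induction with
  | base =>
    intro n s hn hnM hs1 hs2
    rw [hH.redRow_one, ← hH.sum_hatB le_rfl hr hn (by omega)]
    simp only [hatSigma, hH.hatB_one_eq, brow, Nat.sub_add_cancel hN]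
    rw [Nat.sub_self, pow_zero, one_mul]
    congr 1
    rw [Icc_eq_Ico_succ, Icc_eq_Ico_succ, Finset.sum_Ico_eq_sum_range, Finset.sum_Ico_eq_sum_range]
    refine Finset.sum_congr (by congr 1; omega) fun i _ => ?_
    congr 1
    omega
  | succ q hq ih =>
    obtain ⟨q, rfl⟩ : ∃ q', q = q' + 1 := ⟨q - 1, by omega⟩
    intro n s hn hnM hs1 hs2
    rw [show q + 1 + 1 = q + 2 from rfl] at *
    rw [hatSigma_succ_succ, hH.sum_hatB (by omega) hr hn (by omega), if_neg (by omega),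
      if_neg (by omega), if_neg (by omega)]
    congr 1
    rw [Icc_eq_Ico_succ]
    have e := hH.sum_hatB_mul hr (m := n) (n := s - N + 1 + 1) (by omega) (by omega) (by omega) s
    rw [redRow_eq_zero H hr (p := N - (q + 2) + (s - N + 1 + 1)) (by omega) (by omega),
      zero_sub] at e
    have e2 : (-1 : ℝ) ^ (q + 2 - 1) * redRow H (q + 2) (N - (q + 2) + n) s =
        (-1) ^ q * (-redRow H (q + 2) (N - (q + 2) + n) s) := by
      rw [show q + 2 - 1 = q + 1 from rfl]; ring
    rw [e2, ← e, Finset.mul_sum]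
    refine Finset.sum_congr rfl fun l hl => ?_
    rw [Finset.mem_Ico] at hl
    rw [ih (by omega) l s (by omega) (by omega) (by omega) (by omega), Nat.add_sub_cancel]
    ring

theorem BandTP.hatSigma_pos (hH : BandTP H) {r : ℕ} (h1 : 1 ≤ r) (hr : r ≤ N) :
    ∀ n s, 2 ≤ n → n ≤ M - N + 1 → N - r + 1 ≤ s → s ≤ M → 0 < hatSigma H r n s := by
  have hNM := hH.hNM
  have hN := hH.hN
  induction r, h1 using Nat.le_induction with
  | base =>
    intro n s hn hnM hs1 hs2
    have hb : ∀ t, entry H N t = brow H 1 t := fun t => by rw [brow, Nat.sub_add_cancel hN]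
    simp only [hatSigma, hb]
    refine div_pos (hH.brow_pos le_rfl hr hs1 (by omega)) (Finset.sum_pos (fun t ht => ?_)
      ⟨N, Finset.mem_Icc.2 (by omega)⟩)
    rw [Finset.mem_Icc] at ht
    exact hH.brow_pos le_rfl hr (by omega) (by omega)
  | succ q hq ih =>
    obtain ⟨q, rfl⟩ : ∃ q', q = q' + 1 := ⟨q - 1, by omega⟩
    intro n s hn hnM hs1 hs2
    rw [show q + 1 + 1 = q + 2 from rfl] at *
    have hB : ∀ l, 1 ≤ l → l ≤ M - N + 1 → 0 < hatB H (q + 2) l := fun l a b =>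
      hH.hatB_pos (by omega) hr a b
    rw [hatSigma_succ_succ]
    refine div_pos ?_ (Finset.sum_pos (fun i hi => ?_) ⟨1, Finset.mem_Icc.2 (by omega)⟩)
    · split_ifs with c1 c2 c3 c4
      · exact hB 1 le_rfl (by omega)
      · refine Finset.sum_pos (fun j hj => ?_) ⟨n - 1, Finset.mem_Icc.2 (by omega)⟩
        rw [Finset.mem_Icc] at hj
        exact mul_pos (hB _ (by omega) (by omega))
          (ih (by omega) _ _ (by omega) (by omega) (by omega) hs2)
      · rw [zero_add]
        exact mul_pos (hB _ (by omega) (by omega))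
          (ih (by omega) _ _ (by omega) (by omega) (by omega) hs2)
      · exact add_pos (mul_pos (hB _ (by omega) (by omega))
          (ih (by omega) _ _ (by omega) (by omega) (by omega) hs2))
          (mul_pos (hB _ (by omega) (by omega))
          (ih (by omega) _ _ (by omega) (by omega) (by omega) hs2))
      · refine Finset.sum_pos (fun j hj => ?_) ⟨n, Finset.mem_Icc.2 (by omega)⟩
        rw [Finset.mem_Icc] at hj
        exact mul_pos (hB _ (by omega) (by omega))
          (ih (by omega) _ _ (by omega) (by omega) (by omega) hs2)
    · rw [Finset.mem_Icc] at hi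
      exact hB _ hi.1 (by omega)

end Minors

/-! ### The recursive linear systems -/

/-- The coefficient of `e^{θ_s}` in `V^{(r)}_l`, where `E n s` is the coefficient of `e^{θ_s}` in
`Ψ^{(r-1)}(α_n)`. -/
def vcoef (N : ℕ) (E : ℕ → ℕ → ℝ) (r l s : ℕ) : ℝ :=
  if r = 1 then (if s = N + l - 1 then 1 else 0)
  else if l = 1 then (if s = N - r + 1 then 1 else 0)
  else E l s

/-- The matrix of the linear system for `B^{(r)}_1, …, B^{(r)}_{K+1}, ξ ε^{(r)}_1, …,
ξ^{r-1} ε^{(r)}_{r-1}`. Its row `i` is the coefficient of `e^{θ_s}`, `s = N - r + 1 + i`, in the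
limit condition, multiplied by `ξ^{i-K}` if `i > K`; the exponents are truncated differences.
Here `a i` is the `i`-th row from the bottom of the Grassmannian matrix. -/
def sysMat (N K : ℕ) (a : ℕ → ℕ → ℝ) (ξ : ℝ) (r : ℕ) (E : ℕ → ℕ → ℝ) :
    Matrix (Fin (K + r)) (Fin (K + r)) ℝ :=
  Matrix.of fun i c => ξ ^ ((i : ℕ) - K) *
    if (c : ℕ) ≤ K then vcoef N E r (c + 1) (N - r + 1 + i)
    else -(ξ⁻¹ ^ ((c : ℕ) - K) * a (r - (c - K)) (N - r + 1 + i))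

/-- The right-hand side of the linear system. -/
def sysRhs (N K : ℕ) (a : ℕ → ℕ → ℝ) (ξ : ℝ) (r : ℕ) : Fin (K + r) → ℝ :=
  fun i => ξ ^ ((i : ℕ) - K) * a r (N - r + 1 + i)

/-- The solution of the linear system, extended by zero. It is meaningful only if the matrix is
nonsingular. -/
def sysSol (N K : ℕ) (a : ℕ → ℕ → ℝ) (ξ : ℝ) (r : ℕ) (E : ℕ → ℕ → ℝ) (i : ℕ) : ℝ :=
  if h : i < K + r then ((sysMat N K a ξ r E)⁻¹.mulVec (sysRhs N K a ξ r)) ⟨i, h⟩ else 0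

/-- The weight of `V_l` in the value at `α_n` of the wave function with coefficients proportional
to `B`. -/
def weight (K : ℕ) (ξ : ℝ) (B : ℕ → ℝ) (n l : ℕ) : ℝ :=
  B l / (alphaPt ξ n - lamPt ξ l) /
    ∑ i ∈ Finset.Icc 1 (K + 1), B i / (alphaPt ξ n - lamPt ξ i)

/-- The coefficient of `e^{θ_s}` in `Ψ^{(r)}(α_n)`. -/
def Ecoef (N K : ℕ) (a : ℕ → ℕ → ℝ) (ξ : ℝ) : ℕ → ℕ → ℕ → ℝ
  | 0 => fun _ _ => 0
  | r + 1 => fun n s => ∑ l ∈ Finset.Icc 1 (K + 1),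
      weight K ξ (fun l => sysSol N K a ξ (r + 1) (Ecoef N K a ξ r) (l - 1)) n l *
        vcoef N (Ecoef N K a ξ r) (r + 1) l s

/-- The coefficients `B^{(r)}_l`. -/
def Bcoef (N K : ℕ) (a : ℕ → ℕ → ℝ) (ξ : ℝ) (r l : ℕ) : ℝ :=
  sysSol N K a ξ r (Ecoef N K a ξ (r - 1)) (l - 1)

/-- The parameters `ε^{(r)}_j`. -/
def epsCoef (N K : ℕ) (a : ℕ → ℕ → ℝ) (ξ : ℝ) (r j : ℕ) : ℝ :=
  ξ⁻¹ ^ j * sysSol N K a ξ r (Ecoef N K a ξ (r - 1)) (K + j)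

theorem Ecoef_succ (N K : ℕ) (a : ℕ → ℕ → ℝ) (ξ : ℝ) (r n s : ℕ) :
    Ecoef N K a ξ (r + 1) n s = ∑ l ∈ Finset.Icc 1 (K + 1),
      weight K ξ (Bcoef N K a ξ (r + 1)) n l * vcoef N (Ecoef N K a ξ r) (r + 1) l s := rfl

/-! ### Orders of magnitude -/

/-- The order of vanishing at `ξ = ∞` of the coefficient of `e^{θ_s}` in `Ψ^{(r)}(α_n)`:
it grows with slope one from the column `N - r + n - 1` on, and with slope two from the column
`N + n - 1` on. -/
def gapExp (N r n s : ℕ) : ℕ := (s - (N - r + n - 1)) + (s - (N + n - 1))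

/-- The order of vanishing of the weight of `V_l` at `α_n`. -/
def weightExp (n l : ℕ) : ℕ := (l + 1 - n) + (l - n)

theorem alphaPt_pos {ξ : ℝ} (hξ : 0 < ξ) (n : ℕ) : 0 < alphaPt ξ n := zpow_pos hξ _

theorem lamPt_nonpos {ξ : ℝ} (hξ : 0 < ξ) (l : ℕ) : lamPt ξ l ≤ 0 := by
  unfold lamPt
  split_ifs
  · exact le_rfl
  · have := pow_pos hξ (2 * (l - 2))
    linarith

theorem alphaPt_sub_lamPt_pos {ξ : ℝ} (hξ : 0 < ξ) (n l : ℕ) : 0 < alphaPt ξ n - lamPt ξ l := by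
  linarith [alphaPt_pos hξ n, lamPt_nonpos hξ l]

/-- Since `α_n = ξ^{2n-5}` lies between `-λ_{n-1}` and `-λ_n`, it dominates `λ_l` for `l < n` and
is dominated by it for `l ≥ n`. -/
theorem hasRatLimit_alpha_div {n l : ℕ} (hn : 2 ≤ n) (hl : 1 ≤ l) :
    HasRatLimit (fun ξ => ξ ^ weightExp n l * (alphaPt ξ n / (alphaPt ξ n - lamPt ξ l))) 1 := by
  have key : ∀ m : ℕ, HasRatLimit (fun ξ => (1 + ξ⁻¹ ^ (m + 1))⁻¹) 1 := fun m => by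
    simpa using ((HasRatLimit.const 1).add (HasRatLimit.inv_pow_succ m)).inv (by norm_num)
  rcases hl.eq_or_lt with rfl | hl
  · refine (HasRatLimit.const 1).congr ?_
    filter_upwards [eventually_gt_atTop 0] with ξ hξ
    have := (alphaPt_pos hξ n).ne'
    have e : weightExp n 1 = 0 := by unfold weightExp; omega
    simp [e, lamPt, this]
  have hlam : ∀ ξ, lamPt ξ l = -ξ ^ (2 * (l - 2)) := fun ξ => if_neg (by omega)
  by_cases h : l < n
  · refine (key (2 * (n - l) - 2)).congr ?_
    filter_upwards [eventually_gt_atTop 0] with ξ hξ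
    have e : weightExp n l = 0 := by unfold weightExp; omega
    have ha := (alphaPt_pos hξ n).ne'
    have e2 : ξ ^ (2 * (l - 2)) = alphaPt ξ n * ξ⁻¹ ^ (2 * (n - l) - 2 + 1) := by
      rw [alphaPt, inv_pow, ← zpow_natCast, ← zpow_natCast, ← zpow_neg, ← zpow_add₀ hξ.ne']
      congr 1
      omega
    rw [e, hlam, e2, pow_zero, one_mul, sub_neg_eq_add]
    have : 1 + ξ⁻¹ ^ (2 * (n - l) - 2 + 1) ≠ 0 := by positivity
    field_simp
  · refine (key (2 * (l - n))).congr ?_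
    filter_upwards [eventually_gt_atTop 0] with ξ hξ
    have e : weightExp n l = 2 * (l - n) + 1 := by unfold weightExp; omega
    have ha := (alphaPt_pos hξ n).ne'
    have e2 : ξ ^ (2 * (l - 2)) = ξ ^ (2 * (l - n) + 1) * alphaPt ξ n := by
      rw [alphaPt, ← zpow_natCast, ← zpow_natCast, ← zpow_add₀ hξ.ne']
      congr 1
      omega
    have h1 : alphaPt ξ n - lamPt ξ l ≠ 0 := (alphaPt_sub_lamPt_pos hξ n l).ne'
    rw [e]
    rw [hlam, e2, sub_neg_eq_add] at h1 ⊢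
    have : 1 + ξ⁻¹ ^ (2 * (l - n) + 1) ≠ 0 := by positivity
    rw [inv_pow] at this ⊢
    field_simp
    ring

/-- Multiplying by a power of `ξ` smaller than the order of vanishing makes the limit zero. -/
theorem HasRatLimit.pow_mul_of_le {f : ℝ → ℝ} {c : ℝ} {d e : ℕ}
    (hf : HasRatLimit (fun ξ => ξ ^ e * f ξ) c) (hde : d ≤ e) :
    HasRatLimit (fun ξ => ξ ^ d * f ξ) (if e - d = 0 then c else 0) := by
  have h := (HasRatLimit.inv_pow (e - d)).mul hf
  rw [ite_mul, one_mul, zero_mul] at h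
  refine h.congr ?_
  filter_upwards [eventually_gt_atTop 0] with ξ hξ
  obtain ⟨m, rfl⟩ : ∃ m, e = d + m := ⟨e - d, by omega⟩
  rw [Nat.add_sub_cancel_left, ← mul_assoc]
  congr 1
  rw [_root_.inv_pow, pow_add]
  field_simp

theorem sum_Icc_ite_le {K n : ℕ} (hnK : n ≤ K + 2) (f : ℕ → ℝ) :
    ∑ i ∈ Finset.Icc 1 (K + 1), (if i + 1 - n = 0 then f i else 0) =
      ∑ i ∈ Finset.Icc 1 (n - 1), f i := by
  rw [← Finset.sum_filter]
  refine Finset.sum_congr ?_ fun _ _ => rfl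
  ext i
  simp only [Finset.mem_filter, Finset.mem_Icc]
  omega

/-- Only the terms with `i < n` contribute to the limit of the normalizing sum. -/
theorem hasRatLimit_weight {K n l : ℕ} {B : ℝ → ℕ → ℝ} {B₀ : ℕ → ℝ}
    (hB : ∀ l ∈ Finset.Icc 1 (K + 1), HasRatLimit (fun ξ => B ξ l) (B₀ l))
    (hn : 2 ≤ n) (hnK : n ≤ K + 1) (hl : l ∈ Finset.Icc 1 (K + 1))
    (hpos : 0 < ∑ i ∈ Finset.Icc 1 (n - 1), B₀ i) :
    HasRatLimit (fun ξ => ξ ^ weightExp n l * weight K ξ (B ξ) n l)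
      (B₀ l / ∑ i ∈ Finset.Icc 1 (n - 1), B₀ i) := by
  have h1 := (hB l hl).mul (hasRatLimit_alpha_div hn (Finset.mem_Icc.1 hl).1)
  have h2 := HasRatLimit.sum (Finset.Icc 1 (K + 1)) fun i hi => (hB i hi).mul
    (by simpa using
      (hasRatLimit_alpha_div hn (Finset.mem_Icc.1 hi).1).pow_mul_of_le (Nat.zero_le _))
  have e : ∀ i, weightExp n i = 0 ↔ i + 1 - n = 0 := fun i => by unfold weightExp; omega
  simp only [e, mul_ite, mul_one, mul_zero, sum_Icc_ite_le (show n ≤ K + 2 by omega)] at h1 h2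
  refine (h1.div h2 hpos.ne').congr ?_
  filter_upwards [eventually_gt_atTop 0] with ξ hξ
  have ha := (alphaPt_pos hξ n).ne'
  have h3 : ∑ i ∈ Finset.Icc 1 (K + 1), B ξ i * (alphaPt ξ n / (alphaPt ξ n - lamPt ξ i)) =
      alphaPt ξ n * ∑ i ∈ Finset.Icc 1 (K + 1), B ξ i / (alphaPt ξ n - lamPt ξ i) := by
    rw [Finset.mul_sum]
    exact Finset.sum_congr rfl fun i _ => by ring
  rw [h3, weight]
  field_simp

section Limits

variable {N M : ℕ} {H : Matrix (Fin N) (Fin M) ℝ}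

/-! ### The limiting linear system -/

/-- The leading coefficient of `e^{θ_s}` in `V^{(r)}_l`. -/
def vhat (H : Matrix (Fin N) (Fin M) ℝ) (r l s : ℕ) : ℝ :=
  vcoef N (fun n s => if s ≤ N - r + 1 then 0 else hatSigma H (r - 1) n s) r l s

/-- The limit of the rescaled matrix of the linear system. In the first columns an entry survives if
its order of vanishing `gapExp` does not exceed the exponent of the factor of its row. -/
def limMat (H : Matrix (Fin N) (Fin M) ℝ) (r i c : ℕ) : ℝ :=
  if c ≤ M - N then
    (if gapExp N (r - 1) (c + 1) (N - r + 1 + i) - (i - (M - N)) = 0 then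
      vhat H r (c + 1) (N - r + 1 + i) else 0)
  else if i = c then -brow H (r - (c - (M - N))) (N - r + 1 + i) else 0

/-- The solution of the limiting system, its entries being numbered from zero. -/
def limSol (H : Matrix (Fin N) (Fin M) ℝ) (r c : ℕ) : ℝ :=
  if c ≤ M - N then hatB H r (c + 1) else eta H r (c - (M - N))

theorem vhat_one (H : Matrix (Fin N) (Fin M) ℝ) (l s : ℕ) :
    vhat H 1 l s = if s = N + l - 1 then 1 else 0 := by
  unfold vhat vcoef
  rw [if_pos rfl]

theorem vhat_first (H : Matrix (Fin N) (Fin M) ℝ) {r : ℕ} (hr : 2 ≤ r) (s : ℕ) :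
    vhat H r 1 s = if s = N - r + 1 then 1 else 0 := by
  unfold vhat vcoef
  rw [if_neg (by omega), if_pos rfl]

theorem vhat_of_le (H : Matrix (Fin N) (Fin M) ℝ) {r l s : ℕ} (hr : 2 ≤ r) (hl : 2 ≤ l)
    (hs : s ≤ N - r + 1) : vhat H r l s = 0 := by
  unfold vhat vcoef
  rw [if_neg (by omega), if_neg (by omega)]
  exact if_pos hs

theorem vhat_of_lt (H : Matrix (Fin N) (Fin M) ℝ) {r l s : ℕ} (hr : 2 ≤ r) (hl : 2 ≤ l)
    (hs : N - r + 1 < s) : vhat H r l s = hatSigma H (r - 1) l s := by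
  unfold vhat vcoef
  rw [if_neg (by omega), if_neg (by omega)]
  exact if_neg (by omega)

theorem sum_eq_sum_of_subset {ι : Type*} {s t : Finset ι} {f g : ι → ℝ} (h : t ⊆ s)
    (h0 : ∀ x ∈ s, x ∉ t → f x = 0) (h1 : ∀ x ∈ t, f x = g x) :
    ∑ x ∈ s, f x = ∑ x ∈ t, g x := by
  rw [← Finset.sum_subset h h0]
  exact Finset.sum_congr rfl h1

theorem BandTP.limMat_diag_ne_zero (hH : BandTP H) {r i : ℕ} (h1 : 1 ≤ r) (hr : r ≤ N)
    (hi : i < M - N + r) : limMat H r i i ≠ 0 := by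
  have hNM := hH.hNM
  have hN := hH.hN
  unfold limMat
  split_ifs with h2 h3
  · rcases h1.eq_or_lt with rfl | h1
    · rw [vhat_one, if_pos (by omega)]
      exact one_ne_zero
    rcases Nat.eq_zero_or_pos i with rfl | hi0
    · rw [vhat_first H h1, if_pos (by omega)]
      exact one_ne_zero
    · rw [vhat_of_lt H h1 (by omega) (by omega)]
      exact (hH.hatSigma_pos (by omega) (by omega) _ _ (by omega) (by omega) (by omega)
        (by omega)).ne'
  · unfold gapExp at h3
    omega
  · exact (neg_lt_zero.2 (hH.brow_pos (by omega) (by omega) (by omega) (by omega))).ne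
  · omega

/-- With `K = M - N`, the limiting matrix is upper triangular for the order
`K + 1, …, K + r - 1, 0, …, K` of the indices. -/
theorem limMat_eq_zero {r i c : ℕ} (h1 : 1 ≤ r)
    (h : (i ≤ M - N ∧ (c < i ∨ M - N < c)) ∨ (M - N < i ∧ M - N < c ∧ c ≠ i)) :
    limMat H r i c = 0 := by
  unfold limMat gapExp
  split_ifs <;> first | omega | rfl

theorem BandTP.limMat_det_ne_zero (hH : BandTP H) {r : ℕ} (h1 : 1 ≤ r) (hr : r ≤ N) :
    (Matrix.of fun i c : Fin (M - N + r) => limMat H r i c).det ≠ 0 := by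
  intro hdet
  obtain ⟨x, hx0, hx⟩ := Matrix.exists_mulVec_eq_zero_iff.2 hdet
  apply hx0
  have hrow : ∀ i : Fin (M - N + r), ∑ c : Fin (M - N + r), limMat H r i c * x c = 0 :=
    fun i => congrFun hx i
  -- Back substitution, first in the rows `0, …, M - N`, then in the others.
  have hlow : ∀ d, ∀ i : Fin (M - N + r), (i : ℕ) ≤ M - N → M - N - i = d → x i = 0 := by
    intro d
    induction d using Nat.strong_induction_on with
    | _ d ih =>
      intro i hi hd
      have h := hrow i
      rw [Finset.sum_eq_single i] at h
      · exact (mul_eq_zero.1 h).resolve_left (hH.limMat_diag_ne_zero h1 hr i.2)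
      · intro c _ hc
        by_cases hc2 : (c : ℕ) < i ∨ M - N < c
        · rw [limMat_eq_zero h1 (Or.inl ⟨hi, hc2⟩), zero_mul]
        · have hci : (c : ℕ) ≠ i := fun h => hc (Fin.ext h)
          rw [ih (M - N - c) (by omega) c (by omega) rfl, mul_zero]
      · simp
  ext i
  by_cases hi : (i : ℕ) ≤ M - N
  · exact hlow _ i hi rfl
  · have h := hrow i
    rw [Finset.sum_eq_single i] at h
    · exact (mul_eq_zero.1 h).resolve_left (hH.limMat_diag_ne_zero h1 hr i.2)
    · intro c _ hc
      by_cases hc2 : (c : ℕ) ≤ M - N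
      · rw [hlow _ c hc2 rfl, mul_zero]
      · have hci : (c : ℕ) ≠ i := fun h => hc (Fin.ext h)
        rw [limMat_eq_zero h1 (Or.inr ⟨by omega, by omega, hci⟩), zero_mul]
    · simp

/-- The closed formula for the leading coefficients, in the form of a linear relation. -/
theorem BandTP.sum_hatB_mul_hatSigma (hH : BandTP H) {r i : ℕ} (hr2 : 2 ≤ r) (hr : r ≤ N)
    (hi : 1 ≤ i) (hiM : i ≤ M - N) :
    ∑ l ∈ Finset.Ico (i + 1) (M - N + 2), hatB H r l * hatSigma H (r - 1) l (N - r + 1 + i) =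
      brow H r (N - r + 1 + i) := by
  have hNM := hH.hNM
  obtain ⟨q, rfl⟩ : ∃ q, r = q + 2 := ⟨r - 2, by omega⟩
  have e := hH.sum_hatB_mul hr (m := i + 1) (n := M - N + 2) (by omega) (by omega) le_rfl
    (N - (q + 2) + 1 + i)
  rw [redRow_eq_zero H hr (p := N - (q + 2) + (i + 1)) (by omega) (by omega), sub_zero,
    show N - (q + 2) + (M - N + 2) = M - (q + 2) + 2 by omega,
    hH.redRow_last (by omega) hr] at e
  rw [← e]
  refine Finset.sum_congr rfl fun l hl => ?_
  rw [Finset.mem_Ico] at hl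
  rw [show q + 2 - 1 = q + 1 from rfl, hH.hatSigma_head (by omega) (by omega) l _ (by omega)
    (by omega) (by omega) (by omega)]

theorem BandTP.hatB_mul_hatSigma_last (hH : BandTP H) {r : ℕ} (hr2 : 2 ≤ r) (hr : r ≤ N) :
    hatB H r (M - N + 1) * hatSigma H (r - 1) (M - N + 1) (M - r + 1) = brow H r (M - r + 1) := by
  have hNM := hH.hNM
  have h := hH.sum_hatB_mul_hatSigma hr2 hr (i := M - N) (by omega) le_rfl
  rw [Nat.Ico_succ_singleton, Finset.sum_singleton,
    show N - r + 1 + (M - N) = M - r + 1 by omega] at h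
  exact h

theorem eta_eq (H : Matrix (Fin N) (Fin M) ℝ) {r j : ℕ} (hj : j + 1 ≤ r) (hr : r ≤ N) :
    eta H r j = (sigma H (r - 1) (M - N + 1) (M - r + j + 1) * brow H r (M - r + 1)) /
      (sigma H (r - 1) (M - N + 1) (M - r + 1) * brow H (r - j) (M - r + j + 1)) := by
  unfold eta brow
  rw [show N - r + j + 1 = N - (r - j) + 1 by omega]

theorem BandTP.sigma_pos (hH : BandTP H) {r n s : ℕ} (h1 : 1 ≤ r) (hr : r ≤ N) (hn : 2 ≤ n)
    (hnM : n ≤ M - N + 1) (hs : N - r + 1 ≤ s) (hsM : s ≤ M) : 0 < sigma H r n s :=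
  mul_pos (hH.hatSigma_pos h1 hr n s hn hnM hs hsM) (hH.minorSum_pos h1 hr hn (by omega))

theorem BandTP.eta_pos (hH : BandTP H) {r j : ℕ} (hj : 1 ≤ j) (hjr : j + 1 ≤ r) (hr : r ≤ N) :
    0 < eta H r j := by
  have hNM := hH.hNM
  rw [eta_eq H hjr hr]
  refine div_pos (mul_pos ?_ ?_) (mul_pos ?_ ?_)
  · exact hH.sigma_pos (by omega) (by omega) (by omega) le_rfl (by omega) (by omega)
  · exact hH.brow_pos (by omega) hr (by omega) (by omega)
  · exact hH.sigma_pos (by omega) (by omega) (by omega) le_rfl (by omega) (by omega)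
  · exact hH.brow_pos (by omega) (by omega) (by omega) (by omega)

/-- The equation of the limiting system in a column to the right of the band of the row `r`. -/
theorem BandTP.brow_mul_eta (hH : BandTP H) {r j : ℕ} (hj : 1 ≤ j) (hjr : j + 1 ≤ r)
    (hr : r ≤ N) : brow H (r - j) (M - r + j + 1) * eta H r j =
      hatB H r (M - N + 1) * hatSigma H (r - 1) (M - N + 1) (M - r + j + 1) := by
  have hNM := hH.hNM
  have p1 := (hH.minorSum_pos (r := r - 1) (n := M - N + 1) (by omega) (by omega) (by omega)
    (by omega)).ne'
  have p2 := (hH.hatSigma_pos (r := r - 1) (by omega) (by omega) (M - N + 1) (M - r + 1)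
    (by omega) le_rfl (by omega) (by omega)).ne'
  have p3 := (hH.brow_pos (i := r - j) (s := M - r + j + 1) (by omega) (by omega) (by omega)
    (by omega)).ne'
  rw [eta_eq H hjr hr, ← hH.hatB_mul_hatSigma_last (by omega) hr, sigma, sigma]
  field_simp

/-- The equations of the limiting system. In the columns of the band they are the telescoped
three-term relations, and in the remaining `r - 1` columns they define `eta`. -/
theorem BandTP.limMat_mulVec (hH : BandTP H) {r : ℕ} (h1 : 1 ≤ r) (hr : r ≤ N) {i : ℕ}
    (hi : i < M - N + r) :
    ∑ c ∈ Finset.range (M - N + r), limMat H r i c * limSol H r c = brow H r (N - r + 1 + i) := by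
  have hNM := hH.hNM
  have hN := hH.hN
  by_cases hiK : i ≤ M - N
  · rcases h1.eq_or_lt with rfl | hr2
    · rw [Finset.sum_eq_single i]
      · unfold limMat limSol gapExp
        rw [if_pos hiK, if_pos hiK, if_pos (by omega), vhat_one, if_pos (by omega), one_mul,
          hH.hatB_one_eq]
        congr 1
        omega
      · intro c _ hc
        unfold limMat
        split_ifs with h2 h3
        · rw [vhat_one, if_neg (by omega), zero_mul]
        · rw [zero_mul]
        · omega
        · rw [zero_mul]
      · intro h
        rw [Finset.mem_range] at h
        omega
    rcases Nat.eq_zero_or_pos i with rfl | hi0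
    · rw [Finset.sum_eq_single 0]
      · unfold limMat limSol gapExp
        rw [if_pos hiK, if_pos hiK, if_pos (by omega), zero_add, vhat_first H hr2,
          if_pos (by omega), one_mul, hatB_first H h1]
      · intro c _ hc
        unfold limMat
        split_ifs with h2 h3
        · rw [vhat_of_le H hr2 (by omega) (by omega), zero_mul]
        · rw [zero_mul]
        · omega
        · rw [zero_mul]
      · intro h
        rw [Finset.mem_range] at h
        omega
    · rw [← hH.sum_hatB_mul_hatSigma hr2 hr hi0 hiK,
        ← Finset.sum_Ico_add' (fun l => hatB H r l * hatSigma H (r - 1) l (N - r + 1 + i))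
          i (M - N + 1) 1]
      refine sum_eq_sum_of_subset (fun c => ?_) (fun c _ hc => ?_) fun c hc => ?_
      · simp only [Finset.mem_Ico, Finset.mem_range]
        omega
      · rw [Finset.mem_Ico] at hc
        rw [limMat_eq_zero h1 (by omega), zero_mul]
      · rw [Finset.mem_Ico] at hc
        unfold limMat limSol gapExp
        rw [if_pos (by omega), if_pos (by omega), if_pos (by omega),
          vhat_of_lt H hr2 (by omega) (by omega), mul_comm]
  · have hK : M - N ≠ i := by omega
    rw [hH.support r _ h1 hr (by omega), sum_eq_sum_of_subset (t := {M - N, i})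
      (g := fun c => limMat H r i c * limSol H r c) _ _ fun _ _ => rfl, Finset.sum_pair hK]
    · have e := hH.brow_mul_eta (r := r) (j := i - (M - N)) (by omega) (by omega) hr
      rw [show M - r + (i - (M - N)) + 1 = N - r + 1 + i by omega] at e
      unfold limMat limSol gapExp
      rw [if_pos le_rfl, if_pos le_rfl, if_pos (by omega), if_neg hiK, if_neg hiK, if_pos rfl,
        vhat_of_lt H (by omega) (by omega) (by omega)]
      linarith
    · intro c
      simp only [Finset.mem_insert, Finset.mem_singleton, Finset.mem_range]
      omega
    · intro c _ hc
      simp only [Finset.mem_insert, Finset.mem_singleton, not_or] at hc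
      unfold limMat gapExp
      split_ifs <;> first | omega | simp

/-! ### Induction step -/

/-- The leading behaviour of the coefficients in `V^{(r)}_l`. -/
def VLimits (H : Matrix (Fin N) (Fin M) ℝ) (r : ℕ) : Prop :=
  ∀ l s, 1 ≤ l → l ≤ M - N + 1 → N - r + 1 ≤ s → s ≤ M →
    HasRatLimit (fun ξ => ξ ^ gapExp N (r - 1) l s *
      vcoef N (Ecoef N (M - N) (brow H) ξ (r - 1)) r l s) (vhat H r l s)

theorem BandTP.hasRatLimit_sysMat (hH : BandTP H) {r : ℕ} (h1 : 1 ≤ r) (hr : r ≤ N)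
    (hV : VLimits H r) (i c : Fin (M - N + r)) :
    HasRatLimit (fun ξ => sysMat N (M - N) (brow H) ξ r (Ecoef N (M - N) (brow H) ξ (r - 1)) i c)
      (limMat H r i c) := by
  have hNM := hH.hNM
  have hi := i.2
  have hc := c.2
  unfold limMat
  by_cases hcK : (c : ℕ) ≤ M - N
  · simp only [sysMat, Matrix.of_apply, if_pos hcK]
    exact (hV (c + 1) (N - r + 1 + i) (by omega) (by omega) (by omega) (by omega)).pow_mul_of_le
      (by unfold gapExp; omega)
  · simp only [sysMat, Matrix.of_apply, if_neg hcK]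
    by_cases hic : (c : ℕ) < i
    · rw [if_neg (by omega)]
      simp only [hH.support (r - (c - (M - N))) (N - r + 1 + i) (by omega) (by omega)
        (by omega), mul_zero, neg_zero]
      exact HasRatLimit.const 0
    · have h := ((HasRatLimit.inv_pow ((c - (M - N)) - (i - (M - N)))).mul
        (HasRatLimit.const (brow H (r - (c - (M - N))) (N - r + 1 + i)))).neg
      have e : -((if (c - (M - N)) - (i - (M - N)) = 0 then (1 : ℝ) else 0) *
          brow H (r - (c - (M - N))) (N - r + 1 + i)) =
          if (i : ℕ) = c then -brow H (r - (c - (M - N))) (N - r + 1 + i) else 0 := by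
        split_ifs <;> first | omega | simp
      rw [e] at h
      refine h.congr ?_
      filter_upwards [eventually_gt_atTop 0] with ξ hξ
      obtain ⟨m, hm⟩ : ∃ m, (c : ℕ) - (M - N) = (i - (M - N)) + m :=
        ⟨(c - (M - N)) - (i - (M - N)), by omega⟩
      rw [hm, Nat.add_sub_cancel_left, pow_add, inv_pow, inv_pow]
      have := hξ.ne'
      field_simp

theorem BandTP.hasRatLimit_sysRhs (hH : BandTP H) {r : ℕ} (h1 : 1 ≤ r) (hr : r ≤ N)
    (i : Fin (M - N + r)) :
    HasRatLimit (fun ξ => sysRhs N (M - N) (brow H) ξ r i) (brow H r (N - r + 1 + i)) := by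
  unfold sysRhs
  have hNM := hH.hNM
  by_cases hi : (i : ℕ) ≤ M - N
  · simpa [Nat.sub_eq_zero_of_le hi] using HasRatLimit.const _
  · rw [hH.support r _ h1 hr (by omega)]
    simpa using HasRatLimit.const 0

theorem BandTP.eventually_sysMat_det (hH : BandTP H) {r : ℕ} (h1 : 1 ≤ r) (hr : r ≤ N)
    (hV : VLimits H r) : ∀ᶠ ξ in atTop,
      (sysMat N (M - N) (brow H) ξ r (Ecoef N (M - N) (brow H) ξ (r - 1))).det ≠ 0 :=
  (HasRatLimit.det (F₀ := Matrix.of fun i c : Fin (M - N + r) => limMat H r i c)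
    (hH.hasRatLimit_sysMat h1 hr hV)).tendsto.eventually_ne (hH.limMat_det_ne_zero h1 hr)

theorem BandTP.hasRatLimit_sysSol (hH : BandTP H) {r : ℕ} (h1 : 1 ≤ r) (hr : r ≤ N)
    (hV : VLimits H r) {i : ℕ} (hi : i < M - N + r) :
    HasRatLimit (fun ξ => sysSol N (M - N) (brow H) ξ r (Ecoef N (M - N) (brow H) ξ (r - 1)) i)
      (limSol H r i) := by
  simp only [sysSol, dif_pos hi]
  refine HasRatLimit.inv_mulVec
    (F₀ := Matrix.of fun i c : Fin (M - N + r) => limMat H r i c)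
    (x₀ := fun c : Fin (M - N + r) => limSol H r c) (hH.hasRatLimit_sysMat h1 hr hV)
    (hH.hasRatLimit_sysRhs h1 hr) (hH.limMat_det_ne_zero h1 hr) ?_ ⟨i, hi⟩
  ext j
  simp only [Matrix.mulVec, dotProduct, Matrix.of_apply]
  rw [Fin.sum_univ_eq_sum_range (fun c => limMat H r j c * limSol H r c)]
  exact hH.limMat_mulVec h1 hr j.2

theorem BandTP.hasRatLimit_Bcoef (hH : BandTP H) {r : ℕ} (h1 : 1 ≤ r) (hr : r ≤ N)
    (hV : VLimits H r) {l : ℕ} (hl : 1 ≤ l) (hlM : l ≤ M - N + 1) :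
    HasRatLimit (fun ξ => Bcoef N (M - N) (brow H) ξ r l) (hatB H r l) := by
  have h := hH.hasRatLimit_sysSol h1 hr hV (i := l - 1) (by omega)
  rw [limSol, if_pos (by omega), Nat.sub_add_cancel hl] at h
  exact h

theorem BandTP.hasRatLimit_epsCoef (hH : BandTP H) {r : ℕ} (h1 : 1 ≤ r) (hr : r ≤ N)
    (hV : VLimits H r) {j : ℕ} (hj : 1 ≤ j) (hjr : j + 1 ≤ r) :
    HasRatLimit (fun ξ => ξ ^ j * epsCoef N (M - N) (brow H) ξ r j) (eta H r j) := by
  have h := hH.hasRatLimit_sysSol h1 hr hV (i := M - N + j) (by omega)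
  rw [limSol, if_neg (by omega), Nat.add_sub_cancel_left] at h
  refine h.congr ?_
  filter_upwards [eventually_gt_atTop 0] with ξ hξ
  have := hξ.ne'
  rw [epsCoef, inv_pow]
  field_simp

set_option maxHeartbeats 1000000 in
/-- The recursion for `hatSigma` collects those terms of the sum over `l` which have the lowest
order in `ξ⁻¹`. -/
theorem BandTP.sum_weight_vhat (hH : BandTP H) {r n s : ℕ} (h1 : 1 ≤ r) (hr : r ≤ N) (hn : 2 ≤ n)
    (hnM : n ≤ M - N + 1) (hs : N - r + 1 ≤ s) (hsM : s ≤ M) :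
    ∑ l ∈ Finset.Icc 1 (M - N + 1),
      (if weightExp n l + gapExp N (r - 1) l s - gapExp N r n s = 0 then
        hatB H r l / (∑ i ∈ Finset.Icc 1 (n - 1), hatB H r i) * vhat H r l s else 0) =
      hatSigma H r n s := by
  have hNM := hH.hNM
  have hN := hH.hN
  have e : ∀ l, (if weightExp n l + gapExp N (r - 1) l s - gapExp N r n s = 0 then
        hatB H r l / (∑ i ∈ Finset.Icc 1 (n - 1), hatB H r i) * vhat H r l s else 0) =
      (if weightExp n l + gapExp N (r - 1) l s - gapExp N r n s = 0 then
        hatB H r l * vhat H r l s else 0) / ∑ i ∈ Finset.Icc 1 (n - 1), hatB H r i := fun l => by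
    split_ifs <;> ring
  simp only [e]
  rw [← Finset.sum_div]
  obtain rfl | ⟨q, rfl⟩ : r = 1 ∨ ∃ q, r = q + 2 := by
    by_cases h : r = 1
    · exact Or.inl h
    · exact Or.inr ⟨r - 2, by omega⟩
  · rw [hH.sum_hatB le_rfl hr hn (by omega)]
    have h2 : hatSigma H 1 n s = brow H 1 s / redSum H 1 n := by
      rw [← hH.sum_hatB le_rfl hr hn (by omega)]
      simp only [hatSigma, hH.hatB_one_eq, brow, Nat.sub_add_cancel hN]
      congr 1
      rw [Icc_eq_Ico_succ, Icc_eq_Ico_succ, Finset.sum_Ico_eq_sum_range,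
        Finset.sum_Ico_eq_sum_range]
      refine Finset.sum_congr (by congr 1; omega) fun i _ => ?_
      congr 1
      omega
    rw [h2, Finset.sum_eq_single (s - N + 1)]
    · rw [if_pos (by unfold weightExp gapExp; omega), vhat_one, if_pos (by omega), mul_one,
        hH.hatB_one_eq]
      congr 2
      omega
    · intro l hl hl2
      rw [Finset.mem_Icc] at hl
      have hv : vhat H 1 l s = 0 := by rw [vhat_one, if_neg (by omega)]
      rw [hv, mul_zero, ite_self]
    · intro h
      rw [Finset.mem_Icc] at h
      omega
  · rw [hatSigma_succ_succ]
    congr 1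
    have hr2 : 2 ≤ q + 2 := by omega
    by_cases c1 : s = N - (q + 2) + 1
    · rw [if_pos c1, Finset.sum_eq_single 1]
      · rw [vhat_first H hr2, if_pos c1, mul_one, if_pos (by unfold weightExp gapExp; omega)]
      · intro l hl hl2
        rw [Finset.mem_Icc] at hl
        rw [vhat_of_le H hr2 (by omega) (by omega), mul_zero, ite_self]
      · intro h
        rw [Finset.mem_Icc] at h
        omega
    rw [if_neg c1]
    by_cases c2 : s ≤ N - (q + 2) + n - 1
    · rw [if_pos c2]
      refine sum_eq_sum_of_subset (fun l => ?_) (fun l hl hl2 => ?_) fun l hl => ?_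
      · simp only [Finset.mem_Icc]
        omega
      · rw [Finset.mem_Icc] at hl hl2
        by_cases hl1 : l = 1
        · rw [hl1, vhat_first H hr2, if_neg c1, mul_zero, ite_self]
        · rw [if_neg (by unfold weightExp gapExp; omega)]
      · rw [Finset.mem_Icc] at hl
        rw [if_pos (by unfold weightExp gapExp; omega), vhat_of_lt H hr2 (by omega) (by omega)]
        rfl
    rw [if_neg c2]
    by_cases c3 : s ≤ N + n - 2
    · rw [if_pos c3, sum_eq_sum_of_subset (t := {n - 1, n}) (g := fun l => hatB H (q + 2) l *
        vhat H (q + 2) l s), Finset.sum_pair (by omega)]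
      · rw [vhat_of_lt H hr2 hn (by omega)]
        congr 1
        split_ifs with c4
        · subst c4
          rw [vhat_first H hr2, if_neg c1, mul_zero]
        · rw [vhat_of_lt H hr2 (by omega) (by omega)]
          rfl
      · intro l
        simp only [Finset.mem_insert, Finset.mem_singleton, Finset.mem_Icc]
        omega
      · intro l hl hl2
        simp only [Finset.mem_insert, Finset.mem_singleton, not_or, Finset.mem_Icc] at hl hl2
        by_cases hl1 : l = 1
        · rw [hl1, vhat_first H hr2, if_neg c1, mul_zero, ite_self]
        · rw [if_neg (by unfold weightExp gapExp; omega)]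
      · intro l hl
        simp only [Finset.mem_insert, Finset.mem_singleton] at hl
        rw [if_pos (by unfold weightExp gapExp; omega)]
    · rw [if_neg c3]
      refine sum_eq_sum_of_subset (fun l => ?_) (fun l hl hl2 => ?_) fun l hl => ?_
      · simp only [Finset.mem_Icc]
        omega
      · rw [Finset.mem_Icc] at hl hl2
        by_cases hl1 : l = 1
        · rw [hl1, vhat_first H hr2, if_neg c1, mul_zero, ite_self]
        · rw [if_neg (by unfold weightExp gapExp; omega)]
      · rw [Finset.mem_Icc] at hl
        rw [if_pos (by unfold weightExp gapExp; omega), vhat_of_lt H hr2 (by omega) (by omega)]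
        rfl

theorem BandTP.sum_hatB_pos (hH : BandTP H) {r n : ℕ} (h1 : 1 ≤ r) (hr : r ≤ N) (hn : 2 ≤ n)
    (hnM : n ≤ M - N + 2) : 0 < ∑ i ∈ Finset.Icc 1 (n - 1), hatB H r i := by
  rw [hH.sum_hatB h1 hr hn hnM]
  exact hH.redSum_pos h1 hr hn hnM

theorem BandTP.hasRatLimit_Ecoef_of_vLimits (hH : BandTP H) {r : ℕ} (h1 : 1 ≤ r) (hr : r ≤ N)
    (hV : VLimits H r) {n s : ℕ} (hn : 2 ≤ n) (hnM : n ≤ M - N + 1) (hs : N - r + 1 ≤ s)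
    (hsM : s ≤ M) :
    HasRatLimit (fun ξ => ξ ^ gapExp N r n s * Ecoef N (M - N) (brow H) ξ r n s)
      (hatSigma H r n s) := by
  have hNM := hH.hNM
  rw [← hH.sum_weight_vhat h1 hr hn hnM hs hsM]
  obtain ⟨q, rfl⟩ : ∃ q, r = q + 1 := ⟨r - 1, by omega⟩
  simp only [Ecoef_succ, Finset.mul_sum]
  refine HasRatLimit.sum _ fun l hl => ?_
  have hl' := Finset.mem_Icc.1 hl
  have hw := hasRatLimit_weight (K := M - N) (n := n) (l := l)
    (B := fun ξ => Bcoef N (M - N) (brow H) ξ (q + 1)) (B₀ := hatB H (q + 1))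
    (fun l hl => hH.hasRatLimit_Bcoef h1 hr hV (Finset.mem_Icc.1 hl).1 (Finset.mem_Icc.1 hl).2)
    hn hnM hl (hH.sum_hatB_pos h1 hr hn (by omega))
  have hv := hV l s hl'.1 hl'.2 hs hsM
  have h := (hw.mul hv).congr (g := fun ξ => ξ ^ (weightExp n l + gapExp N (q + 1 - 1) l s) *
    (weight (M - N) ξ (Bcoef N (M - N) (brow H) ξ (q + 1)) n l *
      vcoef N (Ecoef N (M - N) (brow H) ξ q) (q + 1) l s)) (Eventually.of_forall fun ξ => by
        simp only [pow_add, Nat.add_sub_cancel]; ring)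
  exact h.pow_mul_of_le (by unfold weightExp gapExp; omega)

theorem Ecoef_eq_zero {N K : ℕ} {a : ℕ → ℕ → ℝ} {ξ : ℝ} {r n s : ℕ} (hr : r ≤ N)
    (hs : s < N - r + 1) : Ecoef N K a ξ r n s = 0 := by
  induction r generalizing n s with
  | zero => rfl
  | succ r ih =>
    rw [Ecoef_succ]
    refine Finset.sum_eq_zero fun l hl => ?_
    rw [Finset.mem_Icc] at hl
    unfold vcoef
    split_ifs with h1 h2 h3 h4
    · omega
    · rw [mul_zero]
    · omega
    · rw [mul_zero]
    · rw [ih (by omega) (by omega), mul_zero]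

/-- Induction over the sheets: the values of one wave function are the data of the next linear
system. -/
theorem BandTP.vLimits (hH : BandTP H) {r : ℕ} (h1 : 1 ≤ r) (hr : r ≤ N) : VLimits H r := by
  have hNM := hH.hNM
  induction r, h1 using Nat.le_induction with
  | base =>
    intro l s hl hlM hs hsM
    rw [vhat_one]
    simp only [vcoef, if_true]
    by_cases h : s = N + l - 1
    · have e : gapExp N (1 - 1) l s = 0 := by unfold gapExp; omega
      simp only [e, pow_zero, one_mul, if_pos h]
      exact HasRatLimit.const 1
    · simpa [h] using HasRatLimit.const 0
  | succ r h1 ih =>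
    intro l s hl hlM hs hsM
    by_cases hl1 : l = 1
    · subst hl1
      rw [vhat_first H (by omega)]
      simp only [vcoef, if_true, if_neg (show r + 1 ≠ 1 by omega)]
      by_cases h : s = N - (r + 1) + 1
      · have e : gapExp N (r + 1 - 1) 1 s = 0 := by unfold gapExp; omega
        simp only [e, pow_zero, one_mul, if_pos h]
        exact HasRatLimit.const 1
      · simpa [h] using HasRatLimit.const 0
    · simp only [vcoef, if_neg hl1, if_neg (show r + 1 ≠ 1 by omega), Nat.add_sub_cancel]
      by_cases h : s ≤ N - (r + 1) + 1
      · rw [vhat_of_le H (by omega) (by omega) h]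
        simp only [Ecoef_eq_zero (r := r) (show r ≤ N by omega) (show s < N - r + 1 by omega)]
        simpa using HasRatLimit.const 0
      · rw [vhat_of_lt H (by omega) (by omega) (by omega)]
        exact hH.hasRatLimit_Ecoef_of_vLimits h1 (by omega) (ih (by omega)) (by omega) (by omega)
          (by omega) hsM

end Limits

/-! ### The linear system for a fixed parameter -/

section System

variable {N K : ℕ} {a : ℕ → ℕ → ℝ} {ξ : ℝ} {r : ℕ} {E : ℕ → ℕ → ℝ}

/-- The unknowns of the linear system, in their order. -/
def packSol (K : ℕ) (ξ : ℝ) (B e : ℕ → ℝ) (c : ℕ) : ℝ :=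
  if c ≤ K then B (c + 1) else ξ ^ (c - K) * e (c - K)

theorem sysMat_mulVec_packSol (hr : 1 ≤ r) (hξ : ξ ≠ 0) (B e : ℕ → ℝ) (i : Fin (K + r)) :
    (sysMat N K a ξ r E).mulVec (fun c => packSol K ξ B e c) i =
      ξ ^ ((i : ℕ) - K) * (∑ l ∈ Finset.Icc 1 (K + 1), B l * vcoef N E r l (N - r + 1 + i) -
        ∑ j ∈ Finset.Icc 1 (r - 1), e j * a (r - j) (N - r + 1 + i)) := by
  obtain ⟨q, rfl⟩ : ∃ q, r = q + 1 := ⟨r - 1, by omega⟩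
  have hsplit : ∀ F : ℕ → ℝ, ∑ c ∈ Finset.range (K + (q + 1)), F c =
      ∑ c ∈ Finset.range (K + 1), F c + ∑ c ∈ Finset.range q, F (K + 1 + c) := fun F => by
    rw [show K + (q + 1) = K + 1 + q by omega, Finset.sum_range_add]
  simp only [Matrix.mulVec, dotProduct, sysMat, Matrix.of_apply]
  rw [Fin.sum_univ_eq_sum_range (fun c => ξ ^ ((i : ℕ) - K) *
    (if c ≤ K then vcoef N E (q + 1) (c + 1) (N - (q + 1) + 1 + i)
      else -(ξ⁻¹ ^ (c - K) * a (q + 1 - (c - K)) (N - (q + 1) + 1 + i))) * packSol K ξ B e c),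
    hsplit, mul_sub, Finset.mul_sum,
    Finset.mul_sum, sub_eq_add_neg, ← Finset.sum_neg_distrib, Nat.add_sub_cancel,
    Icc_eq_Ico_succ, Icc_eq_Ico_succ, Finset.sum_Ico_eq_sum_range, Finset.sum_Ico_eq_sum_range]
  congr 1
  · refine Finset.sum_congr rfl fun c hc => ?_
    rw [Finset.mem_range] at hc
    rw [packSol, if_pos (by omega), if_pos (by omega), add_comm 1 c]
    ring
  · refine Finset.sum_congr rfl fun c hc => ?_
    rw [Finset.mem_range] at hc
    rw [packSol, if_neg (by omega), if_neg (by omega), show K + 1 + c - K = 1 + c by omega,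
      inv_pow]
    field_simp

/-- For a nonsingular system the limit condition, read coefficient by coefficient, determines `B`
and `ε`. -/
theorem system_iff (hr : 1 ≤ r) (hξ : ξ ≠ 0)
    (hdet : (sysMat N K a ξ r E).det ≠ 0) (B e : ℕ → ℝ) :
    (∀ i < K + r, ∑ l ∈ Finset.Icc 1 (K + 1), B l * vcoef N E r l (N - r + 1 + i) =
      a r (N - r + 1 + i) + ∑ j ∈ Finset.Icc 1 (r - 1), e j * a (r - j) (N - r + 1 + i)) ↔
    (∀ l ∈ Finset.Icc 1 (K + 1), B l = sysSol N K a ξ r E (l - 1)) ∧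
      ∀ j ∈ Finset.Icc 1 (r - 1), e j = ξ⁻¹ ^ j * sysSol N K a ξ r E (K + j) := by
  have h1 : (∀ i < K + r, ∑ l ∈ Finset.Icc 1 (K + 1), B l * vcoef N E r l (N - r + 1 + i) =
      a r (N - r + 1 + i) + ∑ j ∈ Finset.Icc 1 (r - 1), e j * a (r - j) (N - r + 1 + i)) ↔
      (sysMat N K a ξ r E).mulVec (fun c => packSol K ξ B e c) = sysRhs N K a ξ r := by
    rw [funext_iff]
    simp only [sysMat_mulVec_packSol hr hξ, sysRhs]
    constructor
    · intro h i
      rw [h i i.2]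
      ring
    · intro h i hi
      have := mul_left_cancel₀ (pow_ne_zero _ hξ) (h ⟨i, hi⟩)
      linarith
  have h2 : (sysMat N K a ξ r E).mulVec (fun c => packSol K ξ B e c) = sysRhs N K a ξ r ↔
      (fun c : Fin (K + r) => packSol K ξ B e c) =
        (sysMat N K a ξ r E)⁻¹.mulVec (sysRhs N K a ξ r) := by
    constructor
    · intro h
      rw [← h, Matrix.mulVec_mulVec, Matrix.nonsing_inv_mul _ (Ne.isUnit hdet), Matrix.one_mulVec]
    · intro h
      rw [h, Matrix.mulVec_mulVec, Matrix.mul_nonsing_inv _ (Ne.isUnit hdet), Matrix.one_mulVec]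
  rw [h1, h2, funext_iff]
  constructor
  · intro h
    have h' : ∀ c < K + r, packSol K ξ B e c = sysSol N K a ξ r E c := fun c hc => by
      rw [sysSol, dif_pos hc]
      exact h ⟨c, hc⟩
    refine ⟨fun l hl => ?_, fun j hj => ?_⟩
    · rw [Finset.mem_Icc] at hl
      rw [← h' _ (by omega), packSol, if_pos (by omega), Nat.sub_add_cancel hl.1]
    · rw [Finset.mem_Icc] at hj
      rw [← h' _ (by omega), packSol, if_neg (by omega), Nat.add_sub_cancel_left, inv_pow]
      field_simp
  · rintro ⟨hB, he⟩ c
    have hc := c.2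
    have h' : packSol K ξ B e c = sysSol N K a ξ r E c := by
      unfold packSol
      split_ifs with h
      · rw [hB _ (Finset.mem_Icc.2 (by omega)), Nat.add_sub_cancel]
      · rw [he _ (Finset.mem_Icc.2 (by omega)), inv_pow, Nat.add_sub_cancel' (by omega)]
        field_simp
    rw [h', sysSol, dif_pos hc]

end System

section Parameters

variable {N M : ℕ} {H : Matrix (Fin N) (Fin M) ℝ}

/-- The values of `ξ` for which all linear systems are nonsingular with positive solutions. -/
structure GoodParam (H : Matrix (Fin N) (Fin M) ℝ) (ξ : ℝ) : Prop where
  one_lt : 1 < ξ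
  det_ne : ∀ r, 1 ≤ r → r ≤ N →
    (sysMat N (M - N) (brow H) ξ r (Ecoef N (M - N) (brow H) ξ (r - 1))).det ≠ 0
  B_pos : ∀ r, 1 ≤ r → r ≤ N → ∀ l ∈ Finset.Icc 1 (M - N + 1),
    0 < Bcoef N (M - N) (brow H) ξ r l
  eps_pos : ∀ r, 1 ≤ r → r ≤ N → ∀ j ∈ Finset.Icc 1 (r - 1),
    0 < epsCoef N (M - N) (brow H) ξ r j

theorem BandTP.eventually_goodParam (hH : BandTP H) : ∀ᶠ ξ in atTop, GoodParam H ξ := by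
  have hNM := hH.hNM
  have h1 : ∀ᶠ ξ : ℝ in atTop, ∀ r ∈ Finset.Icc 1 N,
      (sysMat N (M - N) (brow H) ξ r (Ecoef N (M - N) (brow H) ξ (r - 1))).det ≠ 0 := by
    rw [Filter.eventually_all_finset]
    intro r hr
    rw [Finset.mem_Icc] at hr
    exact hH.eventually_sysMat_det hr.1 hr.2 (hH.vLimits hr.1 hr.2)
  have h2 : ∀ᶠ ξ : ℝ in atTop, ∀ r ∈ Finset.Icc 1 N, ∀ l ∈ Finset.Icc 1 (M - N + 1),
      0 < Bcoef N (M - N) (brow H) ξ r l := by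
    rw [Filter.eventually_all_finset]
    intro r hr
    rw [Filter.eventually_all_finset]
    intro l hl
    rw [Finset.mem_Icc] at hr hl
    exact (hH.hasRatLimit_Bcoef hr.1 hr.2 (hH.vLimits hr.1 hr.2) hl.1 hl.2).tendsto.eventually
      (lt_mem_nhds (hH.hatB_pos hr.1 hr.2 hl.1 hl.2))
  have h3 : ∀ᶠ ξ : ℝ in atTop, ∀ r ∈ Finset.Icc 1 N, ∀ j ∈ Finset.Icc 1 (r - 1),
      0 < ξ ^ j * epsCoef N (M - N) (brow H) ξ r j := by
    rw [Filter.eventually_all_finset]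
    intro r hr
    rw [Filter.eventually_all_finset]
    intro j hj
    rw [Finset.mem_Icc] at hr hj
    exact (hH.hasRatLimit_epsCoef hr.1 hr.2 (hH.vLimits hr.1 hr.2) hj.1
      (by omega)).tendsto.eventually (lt_mem_nhds (hH.eta_pos hj.1 (by omega) hr.2))
  filter_upwards [h1, h2, h3, eventually_gt_atTop 1] with ξ a1 a2 a3 a4
  exact ⟨a4, fun r b1 b2 => a1 r (Finset.mem_Icc.2 ⟨b1, b2⟩),
    fun r b1 b2 => a2 r (Finset.mem_Icc.2 ⟨b1, b2⟩),
    fun r b1 b2 j hj => pos_of_mul_pos_right (a3 r (Finset.mem_Icc.2 ⟨b1, b2⟩) j hj)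
      (pow_nonneg (by linarith) _)⟩

namespace GoodParam

variable {ξ : ℝ}

theorem pos (h : GoodParam H ξ) : 0 < ξ := zero_lt_one.trans h.one_lt

theorem system (h : GoodParam H ξ) (hH : BandTP H) {r s : ℕ} (h1 : 1 ≤ r) (hr : r ≤ N)
    (hs : 1 ≤ s) (hsM : s ≤ M) :
    ∑ l ∈ Finset.Icc 1 (M - N + 1), Bcoef N (M - N) (brow H) ξ r l *
        vcoef N (Ecoef N (M - N) (brow H) ξ (r - 1)) r l s =
      brow H r s + ∑ j ∈ Finset.Icc 1 (r - 1), epsCoef N (M - N) (brow H) ξ r j *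
        brow H (r - j) s := by
  have hNM := hH.hNM
  by_cases hs2 : s < N - r + 1
  · rw [hH.support r s h1 hr (Or.inl hs2), Finset.sum_eq_zero, Finset.sum_eq_zero, zero_add]
    · intro j hj
      rw [Finset.mem_Icc] at hj
      rw [hH.support _ s (by omega) (by omega) (Or.inl (by omega)), mul_zero]
    · intro l hl
      rw [Finset.mem_Icc] at hl
      unfold vcoef
      split_ifs with c1 c2 c3 c4
      · omega
      · rw [mul_zero]
      · omega
      · rw [mul_zero]
      · rw [Ecoef_eq_zero (by omega) (by omega), mul_zero]
  · have h2 := (system_iff h1 h.pos.ne' (h.det_ne r h1 hr) (Bcoef N (M - N) (brow H) ξ r)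
      (epsCoef N (M - N) (brow H) ξ r)).2 ⟨fun _ _ => rfl, fun _ _ => rfl⟩ (s - (N - r + 1))
      (by omega)
    rwa [Nat.add_sub_cancel' (by omega)] at h2

theorem sum_div_pos (h : GoodParam H ξ) (n : ℕ) {r : ℕ} (h1 : 1 ≤ r) (hr : r ≤ N) :
    0 < ∑ i ∈ Finset.Icc 1 (M - N + 1),
      Bcoef N (M - N) (brow H) ξ r i / (alphaPt ξ n - lamPt ξ i) :=
  Finset.sum_pos (fun i hi => div_pos (h.B_pos r h1 hr i hi) (alphaPt_sub_lamPt_pos h.pos n i))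
    ⟨1, by simp⟩

theorem sum_weight (h : GoodParam H ξ) (n : ℕ) {r : ℕ} (h1 : 1 ≤ r) (hr : r ≤ N) :
    ∑ l ∈ Finset.Icc 1 (M - N + 1), weight (M - N) ξ (Bcoef N (M - N) (brow H) ξ r) n l = 1 := by
  unfold weight
  rw [← Finset.sum_div, div_self (h.sum_div_pos n h1 hr).ne']

/-- The values `V_l` and `Ψ^{(r)}(α_n)` are affine combinations of the exponentials. -/
theorem sum_Ecoef_and_sum_vcoef (h : GoodParam H ξ) (hH : BandTP H) {r : ℕ} (hr : r ≤ N) :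
    (1 ≤ r → ∀ n, ∑ s ∈ Finset.Icc 1 M, Ecoef N (M - N) (brow H) ξ r n s = 1) ∧
    (1 ≤ r → ∀ l ∈ Finset.Icc 1 (M - N + 1), ∑ s ∈ Finset.Icc 1 M,
      vcoef N (Ecoef N (M - N) (brow H) ξ (r - 1)) r l s = 1) := by
  have hNM := hH.hNM
  induction r with
  | zero => exact ⟨fun h => by omega, fun h => by omega⟩
  | succ r ih =>
    have hv : ∀ l ∈ Finset.Icc 1 (M - N + 1), ∑ s ∈ Finset.Icc 1 M,
        vcoef N (Ecoef N (M - N) (brow H) ξ r) (r + 1) l s = 1 := by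
      intro l hl
      rw [Finset.mem_Icc] at hl
      unfold vcoef
      split_ifs with c1 c2
      · rw [Finset.sum_ite_eq', if_pos (Finset.mem_Icc.2 (by omega))]
      · rw [Finset.sum_ite_eq', if_pos (Finset.mem_Icc.2 (by omega))]
      · exact (ih (by omega)).1 (by omega) l
    refine ⟨fun _ n => ?_, fun _ => hv⟩
    simp only [Ecoef_succ]
    rw [Finset.sum_comm, ← h.sum_weight n (r := r + 1) (by omega) hr]
    refine Finset.sum_congr rfl fun l hl => ?_
    rw [← Finset.mul_sum, hv l hl, mul_one]

/-- The coefficients of `Ψ^{(r)}` have sum one, by adding up the equations of the linear system over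
all columns. -/
theorem sum_Bcoef (h : GoodParam H ξ) (hH : BandTP H) (hsum : ∀ i, 1 ≤ i → i ≤ N → rowSum H i = 1)
    {r : ℕ} (h1 : 1 ≤ r) (hr : r ≤ N) :
    ∑ l ∈ Finset.Icc 1 (M - N + 1), Bcoef N (M - N) (brow H) ξ r l =
      1 + ∑ j ∈ Finset.Icc 1 (r - 1), epsCoef N (M - N) (brow H) ξ r j := by
  have h2 : ∑ s ∈ Finset.Icc 1 M, ∑ l ∈ Finset.Icc 1 (M - N + 1), Bcoef N (M - N) (brow H) ξ r l *
        vcoef N (Ecoef N (M - N) (brow H) ξ (r - 1)) r l s =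
      ∑ s ∈ Finset.Icc 1 M, (brow H r s + ∑ j ∈ Finset.Icc 1 (r - 1),
        epsCoef N (M - N) (brow H) ξ r j * brow H (r - j) s) :=
    Finset.sum_congr rfl fun s hs => h.system hH h1 hr (Finset.mem_Icc.1 hs).1
      (Finset.mem_Icc.1 hs).2
  rw [Finset.sum_comm, Finset.sum_add_distrib, Finset.sum_comm (s := Finset.Icc 1 M)] at h2
  simp only [← Finset.mul_sum] at h2
  have h3 : ∑ s ∈ Finset.Icc 1 M, brow H r s = 1 := hsum r h1 hr
  rw [h3] at h2
  rw [Finset.sum_congr rfl fun l hl => ?_, h2]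
  · congr 1
    refine Finset.sum_congr rfl fun j hj => ?_
    rw [Finset.mem_Icc] at hj
    have h4 : ∑ s ∈ Finset.Icc 1 M, brow H (r - j) s = 1 := hsum _ (by omega) (by omega)
    rw [h4, mul_one]
  · rw [(h.sum_Ecoef_and_sum_vcoef hH hr).2 h1 l hl, mul_one]

/-- Only `V_1` contains the first exponential `e^{θ_{N-r+1}}`. -/
theorem Bcoef_first (h : GoodParam H ξ) (hH : BandTP H) {r : ℕ} (h1 : 1 ≤ r) (hr : r ≤ N) :
    Bcoef N (M - N) (brow H) ξ r 1 = brow H r (N - r + 1) := by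
  have hNM := hH.hNM
  have h2 := h.system hH h1 hr (s := N - r + 1) (by omega) (by omega)
  rw [Finset.sum_eq_single 1, Finset.sum_eq_zero, add_zero] at h2
  · rw [← h2]
    unfold vcoef
    split_ifs with c1 c2 c3
    · rw [mul_one]
    · omega
    · rw [mul_one]
    · omega
    · omega
  · intro j hj
    rw [Finset.mem_Icc] at hj
    rw [hH.support _ _ (by omega) (by omega) (Or.inl (by omega)), mul_zero]
  · intro l hl hl1
    rw [Finset.mem_Icc] at hl
    unfold vcoef
    rw [if_neg hl1]
    split_ifs with c1 c2
    · omega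
    · rw [mul_zero]
    · rw [Ecoef_eq_zero (by omega) (by omega), mul_zero]
  · simp

end GoodParam

end Parameters

section Sheets

variable {N M : ℕ} {H : Matrix (Fin N) (Fin M) ℝ} {ξ : ℝ} {C eps b : ℕ → ℕ → ℝ} {k : ℕ → ℝ}

/-! ### The wave functions -/

/-- The coefficients and poles of the wave functions: the solution of the linear systems, normalized
to have sum one, and the roots of the resulting monic polynomial. -/
structure SheetData (H : Matrix (Fin N) (Fin M) ℝ) (ξ : ℝ) (C eps b : ℕ → ℕ → ℝ) : Prop where
  good : GoodParam H ξ
  eps_eq : ∀ r j, eps r j = epsCoef N (M - N) (brow H) ξ r j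
  C_eq : ∀ r l, C r l = Bcoef N (M - N) (brow H) ξ r l / epsNorm eps r
  pole_mem : ∀ r, 1 ≤ r → r ≤ N → ∀ m ∈ Finset.Icc 1 (M - N),
    lamPt ξ (m + 1) < b r m ∧ b r m < lamPt ξ m
  poly : ∀ r, 1 ≤ r → r ≤ N →
    ∑ l ∈ Finset.Icc 1 (M - N + 1), Polynomial.C (C r l) *
      ∏ j ∈ (Finset.Icc 1 (M - N + 1)).erase l, (Polynomial.X - Polynomial.C (lamPt ξ j)) =
      ∏ i ∈ Finset.Icc 1 (M - N), (Polynomial.X - Polynomial.C (b r i))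

theorem GoodParam.epsNorm_pos (h : GoodParam H ξ) {r : ℕ} (h1 : 1 ≤ r) (hr : r ≤ N) :
    0 < epsNorm (epsCoef N (M - N) (brow H) ξ) r := by
  have := Finset.sum_nonneg fun j hj => (h.eps_pos r h1 hr j hj).le
  unfold epsNorm
  linarith

theorem GoodParam.exists_sheetData (h : GoodParam H ξ) (hH : BandTP H)
    (hsum : ∀ i, 1 ≤ i → i ≤ N → rowSum H i = 1) :
    ∃ b, SheetData H ξ (fun r l => Bcoef N (M - N) (brow H) ξ r l /
      epsNorm (epsCoef N (M - N) (brow H) ξ) r) (epsCoef N (M - N) (brow H) ξ) b := by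
  have key : ∀ r, 1 ≤ r → r ≤ N → _ := fun r h1 hr => exists_interlacing (K := M - N)
    (p := lamPt ξ) (c := fun l => Bcoef N (M - N) (brow H) ξ r l /
      epsNorm (epsCoef N (M - N) (brow H) ξ) r) (lamPt_strictAntiOn h.one_lt _)
    (by
      rw [← Finset.sum_div, h.sum_Bcoef hH hsum h1 hr]
      exact div_self (h.epsNorm_pos h1 hr).ne')
    (fun l hl => div_pos (h.B_pos r h1 hr l hl) (h.epsNorm_pos h1 hr))
  choose! b hb using key
  exact ⟨b, h, fun _ _ => rfl, fun _ _ => rfl, fun r h1 hr => (hb r h1 hr).1,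
    fun r h1 hr => (hb r h1 hr).2⟩

/-- The coefficient of `V_l` in a wave function, at a real point. -/
def coefAt (K : ℕ) (ξ : ℝ) (C b : ℕ → ℝ) (l : ℕ) (x : ℝ) : ℝ :=
  C l * (nodeProd K (lamPt ξ) l x / ∏ m ∈ Finset.Icc 1 K, (x - b m))

theorem sheetFun_ofReal (K : ℕ) (ξ : ℝ) (C b : ℕ → ℝ) (V : ℕ → ℂ) (x : ℝ) :
    sheetFun K ξ C b V x = ∑ l ∈ Finset.Icc 1 (K + 1), (coefAt K ξ C b l x : ℂ) * V l := by
  unfold sheetFun coefAt nodeProd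
  refine Finset.sum_congr rfl fun l _ => ?_
  push_cast
  rfl

/-- At a marked point only one term of the wave function survives. -/
theorem sheetFun_lamPt {K n : ℕ} (hn : n ∈ Finset.Icc 1 (K + 1)) (ξ : ℝ) (C b : ℕ → ℝ)
    (V : ℕ → ℂ) :
    sheetFun K ξ C b V (lamPt ξ n : ℂ) = (coefAt K ξ C b n (lamPt ξ n) : ℂ) * V n := by
  rw [sheetFun_ofReal, Finset.sum_eq_single n]
  · intro l _ hl
    rw [coefAt, nodeProd_eq_zero hn hl]
    simp
  · exact fun h => absurd hn h

theorem Psi_succ (N M : ℕ) (k : ℕ → ℝ) (ξ : ℝ) (C b : ℕ → ℕ → ℝ) (r : ℕ) (z : ℂ) (t : ℕ → ℝ) :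
    Psi N M k ξ C b (r + 1) z t = sheetFun (M - N) ξ (C (r + 1)) (b (r + 1))
      (fun l => sheetValue N k ξ (Psi N M k ξ C b r) (r + 1) l t) z := rfl

/-- Wave functions depend on the poles only up to their order. -/
theorem Psi_congr {C' b' : ℕ → ℕ → ℝ} {r : ℕ}
    (hC : ∀ q ∈ Finset.Icc 1 r, ∀ l ∈ Finset.Icc 1 (M - N + 1), C' q l = C q l)
    (hb : ∀ q ∈ Finset.Icc 1 r,
      (Finset.Icc 1 (M - N)).val.map (b' q) = (Finset.Icc 1 (M - N)).val.map (b q)) :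
    Psi N M k ξ C' b' r = Psi N M k ξ C b r := by
  induction r with
  | zero => rfl
  | succ r ih =>
    have ih' := ih (fun q hq => hC q (Finset.Icc_subset_Icc le_rfl (Nat.le_succ r) hq))
      (fun q hq => hb q (Finset.Icc_subset_Icc le_rfl (Nat.le_succ r) hq))
    have hmem : r + 1 ∈ Finset.Icc 1 (r + 1) := by simp
    funext z t
    rw [Psi_succ, Psi_succ, ih']
    unfold sheetFun
    have hprod : ∏ m ∈ Finset.Icc 1 (M - N), (z - (b' (r + 1) m : ℂ)) =
        ∏ m ∈ Finset.Icc 1 (M - N), (z - (b (r + 1) m : ℂ)) := by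
      have h := congrArg (fun S : Multiset ℝ => (S.map fun x : ℝ => z - (x : ℂ)).prod)
        (hb (r + 1) hmem)
      simp only [Multiset.map_map, Function.comp_def] at h
      exact h
    refine Finset.sum_congr rfl fun l hl => ?_
    rw [hC (r + 1) hmem l hl, hprod]

theorem isTime_single (x : ℝ) : IsTime (Pi.single 0 x) := by
  intro z
  refine summable_of_ne_finset_zero (s := {0}) fun i hi => ?_
  rw [Finset.mem_singleton] at hi
  simp [Pi.single_eq_of_ne hi]

theorem theta_single (x y : ℝ) : theta x (Pi.single 0 y) = x * y := by
  unfold theta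
  rw [tsum_eq_single 0]
  · simp
  · intro i hi
    simp [Pi.single_eq_of_ne hi]

/-- Linear independence of the exponentials `e^{θ_s}`, from their values at the times
`t = (n, 0, 0, …)`. -/
theorem coeff_eq_zero_of_sum_exp_eq_zero (hk : StrictMonoOn k (Set.Icc 1 M)) {d : ℕ → ℝ}
    (h : ∀ t, IsTime t → ∑ s ∈ Finset.Icc 1 M, d s * Real.exp (theta (k s) t) = 0) :
    ∀ s ∈ Finset.Icc 1 M, d s = 0 := by
  have h0 : (fun j : Fin M => d (j + 1)) = 0 := by
    refine Matrix.eq_zero_of_forall_pow_sum_mul_pow_eq_zero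
      (f := fun j : Fin M => Real.exp (k (j + 1))) ?_ fun i => ?_
    · intro i j hij
      have h1 := hk.injOn (Set.mem_Icc.2 (by omega)) (Set.mem_Icc.2 (by omega))
        (Real.exp_injective hij)
      exact Fin.ext (by omega)
    · have h1 := h _ (isTime_single (i : ℕ))
      rw [sum_Icc_eq_sum_fin] at h1
      rw [← h1]
      refine Finset.sum_congr rfl fun j _ => ?_
      rw [theta_single, mul_comm (k _), Real.exp_nat_mul]
  intro s hs
  rw [Finset.mem_Icc] at hs
  have := congrFun h0 ⟨s - 1, by omega⟩
  simpa [Nat.sub_add_cancel hs.1] using this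

namespace SheetData

theorem epsNorm_pos (h : SheetData H ξ C eps b) {r : ℕ} (h1 : 1 ≤ r) (hr : r ≤ N) :
    0 < epsNorm eps r := by
  have := h.good.epsNorm_pos h1 hr
  rwa [← show eps = epsCoef N (M - N) (brow H) ξ from funext₂ h.eps_eq] at this

theorem C_pos (h : SheetData H ξ C eps b) {r l : ℕ} (h1 : 1 ≤ r) (hr : r ≤ N)
    (hl : l ∈ Finset.Icc 1 (M - N + 1)) : 0 < C r l := by
  rw [h.C_eq]
  exact div_pos (h.good.B_pos r h1 hr l hl) (h.epsNorm_pos h1 hr)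

theorem C_mul_epsNorm (h : SheetData H ξ C eps b) {r : ℕ} (l : ℕ) (h1 : 1 ≤ r) (hr : r ≤ N) :
    C r l * epsNorm eps r = Bcoef N (M - N) (brow H) ξ r l := by
  rw [h.C_eq, div_mul_cancel₀ _ (h.epsNorm_pos h1 hr).ne']

theorem prod_eq (h : SheetData H ξ C eps b) {r : ℕ} (h1 : 1 ≤ r) (hr : r ≤ N) (x : ℝ) :
    ∑ l ∈ Finset.Icc 1 (M - N + 1), C r l * nodeProd (M - N) (lamPt ξ) l x =
      ∏ i ∈ Finset.Icc 1 (M - N), (x - b r i) :=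
  eval_sum_nodeProd_eq (h.poly r h1 hr) x

theorem coefAt_pos (h : SheetData H ξ C eps b) {r l : ℕ} {x : ℝ} (h1 : 1 ≤ r) (hr : r ≤ N)
    (hl : l ∈ Finset.Icc 1 (M - N + 1)) (hx : 0 < x) :
    0 < coefAt (M - N) ξ (C r) (b r) l x := by
  refine mul_pos (h.C_pos h1 hr hl) (div_pos (Finset.prod_pos fun j _ => ?_)
    (Finset.prod_pos fun m hm => ?_))
  · linarith [lamPt_nonpos h.good.pos j]
  · linarith [(h.pole_mem r h1 hr m hm).2, lamPt_nonpos h.good.pos m]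

/-- The values at `α_n` can be computed without the poles. -/
theorem coefAt_alphaPt (h : SheetData H ξ C eps b) {r l : ℕ} (n : ℕ) (h1 : 1 ≤ r) (hr : r ≤ N)
    (hl : l ∈ Finset.Icc 1 (M - N + 1)) :
    coefAt (M - N) ξ (C r) (b r) l (alphaPt ξ n) =
      weight (M - N) ξ (Bcoef N (M - N) (brow H) ξ r) n l := by
  have hpos : ∀ j, 0 < alphaPt ξ n - lamPt ξ j := alphaPt_sub_lamPt_pos h.good.pos n
  set P := ∏ j ∈ Finset.Icc 1 (M - N + 1), (alphaPt ξ n - lamPt ξ j) with hP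
  have hP0 : P ≠ 0 := (Finset.prod_pos fun j _ => hpos j).ne'
  have e : ∀ i ∈ Finset.Icc 1 (M - N + 1), nodeProd (M - N) (lamPt ξ) i (alphaPt ξ n) =
      P / (alphaPt ξ n - lamPt ξ i) := fun i hi => by
    rw [hP, ← Finset.mul_prod_erase _ _ hi, mul_div_cancel_left₀ _ (hpos i).ne']
    rfl
  have e2 : ∏ i ∈ Finset.Icc 1 (M - N), (alphaPt ξ n - b r i) =
      P / epsNorm eps r * ∑ i ∈ Finset.Icc 1 (M - N + 1),
        Bcoef N (M - N) (brow H) ξ r i / (alphaPt ξ n - lamPt ξ i) := by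
    rw [← h.prod_eq h1 hr, Finset.mul_sum]
    refine Finset.sum_congr rfl fun i hi => ?_
    rw [e i hi, h.C_eq]
    ring
  have hS := (h.good.sum_div_pos n h1 hr).ne'
  have hE := (h.epsNorm_pos h1 hr).ne'
  have hl0 := (hpos l).ne'
  rw [coefAt, e2, e l hl, h.C_eq, weight]
  field_simp

/-- The values of the wave functions at the marked points, as combinations of exponentials. -/
theorem Psi_and_sheetValue_eq (h : SheetData H ξ C eps b) {r : ℕ} (hr : r ≤ N) (hNM : N < M) :
    (1 ≤ r → ∀ n t, Psi N M k ξ C b r (alphaPt ξ n : ℂ) t =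
      ((∑ s ∈ Finset.Icc 1 M, Ecoef N (M - N) (brow H) ξ r n s * Real.exp (theta (k s) t) : ℝ) :
        ℂ)) ∧
    (1 ≤ r → ∀ l ∈ Finset.Icc 1 (M - N + 1), ∀ t,
      sheetValue N k ξ (Psi N M k ξ C b (r - 1)) r l t =
      ((∑ s ∈ Finset.Icc 1 M, vcoef N (Ecoef N (M - N) (brow H) ξ (r - 1)) r l s *
        Real.exp (theta (k s) t) : ℝ) : ℂ)) := by
  induction r with
  | zero => exact ⟨fun h => by omega, fun h => by omega⟩
  | succ r ih =>
    have hv : ∀ l ∈ Finset.Icc 1 (M - N + 1), ∀ t,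
        sheetValue N k ξ (Psi N M k ξ C b r) (r + 1) l t =
        ((∑ s ∈ Finset.Icc 1 M, vcoef N (Ecoef N (M - N) (brow H) ξ r) (r + 1) l s *
          Real.exp (theta (k s) t) : ℝ) : ℂ) := by
      intro l hl t
      rw [Finset.mem_Icc] at hl
      unfold sheetValue vcoef
      split_ifs with c1 c2
      · rw [sato_ofReal]
        simp only [ite_mul, one_mul, zero_mul]
        rw [Finset.sum_ite_eq', if_pos (Finset.mem_Icc.2 (by omega))]
      · rw [sato_ofReal]
        simp only [ite_mul, one_mul, zero_mul]
        rw [Finset.sum_ite_eq', if_pos (Finset.mem_Icc.2 (by omega))]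
      · exact (ih (by omega)).1 (by omega) l t
    refine ⟨fun _ n t => ?_, fun _ => hv⟩
    rw [Psi_succ, sheetFun_ofReal]
    simp only [Ecoef_succ, Finset.sum_mul]
    rw [Finset.sum_comm, Complex.ofReal_sum]
    refine Finset.sum_congr rfl fun l hl => ?_
    rw [hv l hl t, ← Complex.ofReal_mul, h.coefAt_alphaPt n (by omega) hr hl, Finset.mul_sum]
    simp only [mul_assoc]

/-- To the right of all poles and marked points `λ_l`, a wave function is a combination of positive
functions with positive coefficients. -/
theorem Psi_pos (h : SheetData H ξ C eps b) {r : ℕ} (hr : r ≤ N) {x : ℝ} (hx : 0 < x)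
    (h1 : 1 ≤ r) (t : ℕ → ℝ) : ∃ y : ℝ, 0 < y ∧ Psi N M k ξ C b r (x : ℂ) t = y := by
  induction r, h1 using Nat.le_induction generalizing x with
  | base =>
    refine ⟨∑ l ∈ Finset.Icc 1 (M - N + 1), coefAt (M - N) ξ (C 1) (b 1) l x *
      Real.exp (theta (k (N + l - 1)) t), Finset.sum_pos (fun l hl => mul_pos
        (h.coefAt_pos le_rfl hr hl hx) (Real.exp_pos _)) ⟨1, by simp⟩, ?_⟩
    rw [Psi_succ, sheetFun_ofReal, Complex.ofReal_sum]
    refine Finset.sum_congr rfl fun l hl => ?_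
    rw [sheetValue, if_pos rfl, sato_ofReal, Complex.ofReal_mul]
  | succ r h1 ih =>
    have hv : ∀ l, ∃ y : ℝ, 0 < y ∧
        sheetValue N k ξ (Psi N M k ξ C b r) (r + 1) l t = y := by
      intro l
      unfold sheetValue
      split_ifs with c1 c2
      · exact ⟨_, Real.exp_pos _, sato_ofReal _ _⟩
      · exact ⟨_, Real.exp_pos _, sato_ofReal _ _⟩
      · exact ih (by omega) (alphaPt_pos h.good.pos l)
    choose y hy hy2 using hv
    refine ⟨∑ l ∈ Finset.Icc 1 (M - N + 1), coefAt (M - N) ξ (C (r + 1)) (b (r + 1)) l x * y l,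
      Finset.sum_pos (fun l hl => mul_pos (h.coefAt_pos (by omega) hr hl hx) (hy l))
        ⟨1, by simp⟩, ?_⟩
    rw [Psi_succ, sheetFun_ofReal, Complex.ofReal_sum]
    refine Finset.sum_congr rfl fun l hl => ?_
    rw [hy2, Complex.ofReal_mul]

theorem sheetValue_ne_zero (h : SheetData H ξ C eps b) {r : ℕ} (h1 : 1 ≤ r) (hr : r ≤ N) (l : ℕ)
    (t : ℕ → ℝ) : sheetValue N k ξ (Psi N M k ξ C b (r - 1)) r l t ≠ 0 := by
  unfold sheetValue
  split_ifs with c1 c2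
  · exact Complex.exp_ne_zero _
  · exact Complex.exp_ne_zero _
  · obtain ⟨y, hy, hy2⟩ := h.Psi_pos (k := k) (r := r - 1) (by omega)
      (alphaPt_pos h.good.pos l) (by omega) t
    rw [hy2]
    exact_mod_cast hy.ne'

theorem C_mul_nodeProd (h : SheetData H ξ C eps b) {r n : ℕ} (h1 : 1 ≤ r) (hr : r ≤ N)
    (hn : n ∈ Finset.Icc 1 (M - N + 1)) :
    C r n * nodeProd (M - N) (lamPt ξ) n (lamPt ξ n) =
      ∏ i ∈ Finset.Icc 1 (M - N), (lamPt ξ n - b r i) := by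
  rw [← h.prod_eq h1 hr, sum_mul_nodeProd _ hn]

theorem sum_C_mul_sheetValue (h : SheetData H ξ C eps b) (hH : BandTP H) {C' : ℕ → ℝ} {r : ℕ}
    (h1 : 1 ≤ r) (hr : r ≤ N) (t : ℕ → ℝ) :
    ∑ l ∈ Finset.Icc 1 (M - N + 1), (C' l : ℂ) *
        sheetValue N k ξ (Psi N M k ξ C b (r - 1)) r l t =
      ((∑ s ∈ Finset.Icc 1 M, (∑ l ∈ Finset.Icc 1 (M - N + 1), C' l *
        vcoef N (Ecoef N (M - N) (brow H) ξ (r - 1)) r l s) * Real.exp (theta (k s) t) : ℝ) :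
          ℂ) := by
  simp only [Finset.sum_mul]
  rw [Finset.sum_comm, Complex.ofReal_sum]
  refine Finset.sum_congr rfl fun l hl => ?_
  rw [(h.Psi_and_sheetValue_eq hr hH.hNM).2 h1 l hl t, ← Complex.ofReal_mul, Finset.mul_sum]
  simp only [mul_assoc]

theorem heatSol_add (H : Matrix (Fin N) (Fin M) ℝ) (k : ℕ → ℝ) (e : ℕ → ℝ) (r : ℕ) (t : ℕ → ℝ) :
    heatSol H k r t + ∑ j ∈ Finset.Icc 1 (r - 1), e j * heatSol H k (r - j) t =
      ∑ s ∈ Finset.Icc 1 M, (brow H r s + ∑ j ∈ Finset.Icc 1 (r - 1), e j * brow H (r - j) s) *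
        Real.exp (theta (k s) t) := by
  simp only [add_mul, Finset.sum_add_distrib, Finset.sum_mul]
  rw [Finset.sum_comm (s := Finset.Icc 1 M)]
  unfold heatSol brow
  simp only [Finset.mul_sum, mul_assoc]

theorem sheetConditions (h : SheetData H ξ C eps b) (hH : BandTP H) {r : ℕ} (h1 : 1 ≤ r)
    (hr : r ≤ N) : SheetConditions H k ξ C eps b r where
  norm_ne := (h.epsNorm_pos h1 hr).ne'
  limit t _ := by
    obtain ⟨q, rfl⟩ : ∃ q, r = q + 1 := ⟨r - 1, by omega⟩
    simp only [Psi_succ]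
    convert tendsto_sheetFun _ _ _ _ _ using 2
    have h2 := h.sum_C_mul_sheetValue (k := k) hH (C' := C (q + 1)) h1 hr t
    rw [Nat.add_sub_cancel] at h2
    rw [h2, heatSol_add]
    congr 1
    rw [Finset.sum_div]
    refine Finset.sum_congr rfl fun s hs => ?_
    rw [Finset.mem_Icc] at hs
    have h3 := h.good.system hH h1 hr hs.1 hs.2
    simp only [h.eps_eq, h.C_eq, Nat.add_sub_cancel] at h3 ⊢
    rw [← h3, Finset.sum_mul, Finset.sum_mul, Finset.sum_div]
    exact Finset.sum_congr rfl fun l _ => by ring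
  glue t _ n hn := by
    obtain ⟨q, rfl⟩ : ∃ q, r = q + 1 := ⟨r - 1, by omega⟩
    rw [Psi_succ, sheetFun_lamPt hn]
    have h2 : coefAt (M - N) ξ (C (q + 1)) (b (q + 1)) n (lamPt ξ n) = 1 := by
      rw [coefAt, mul_div_assoc', h.C_mul_nodeProd h1 hr hn, div_self]
      rw [← h.C_mul_nodeProd h1 hr hn]
      refine mul_ne_zero (h.C_pos h1 hr hn).ne' fun h0 => ?_
      have := nodeProd_sign (lamPt_strictAntiOn h.good.one_lt (M - N)) hn
      rw [h0, mul_zero] at this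
      exact lt_irrefl _ this
    rw [h2, Complex.ofReal_one, one_mul]
    rfl

/-- The conditions determine the coefficients because the exponentials are linearly independent and
the linear system is nonsingular, and then the poles because a monic polynomial of degree `M - N` is
determined by its values at the marked points. -/
theorem unique (h : SheetData H ξ C eps b) (hH : BandTP H) (hk : StrictMonoOn k (Set.Icc 1 M))
    {C' eps' b' : ℕ → ℕ → ℝ} {r : ℕ} (h1 : 1 ≤ r) (hr : r ≤ N)
    (h' : ∀ q ∈ Finset.Icc 1 r, SheetConditions H k ξ C' eps' b' q) :
    (∀ l ∈ Finset.Icc 1 (M - N + 1), C' r l = C r l) ∧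
      (∀ j ∈ Finset.Icc 1 (r - 1), eps' r j = eps r j) ∧
      (Finset.Icc 1 (M - N)).val.map (b' r) = (Finset.Icc 1 (M - N)).val.map (b r) := by
  have hNM := hH.hNM
  induction r using Nat.strong_induction_on with
  | _ r ih =>
    obtain ⟨q, rfl⟩ : ∃ q, r = q + 1 := ⟨r - 1, by omega⟩
    have hprev : ∀ p ∈ Finset.Icc 1 q, _ := fun p hp => by
      rw [Finset.mem_Icc] at hp
      exact ih p (by omega) hp.1 (by omega)
        fun p' hp' => h' p' (Finset.Icc_subset_Icc le_rfl (by omega) hp')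
    have hPsi : Psi N M k ξ C' b' q = Psi N M k ξ C b q :=
      Psi_congr (fun p hp => (hprev p hp).1) fun p hp => (hprev p hp).2.2
    have hc := h' (q + 1) (by simp)
    have hnorm := hc.norm_ne
    have hvec : ∀ s ∈ Finset.Icc 1 M, ∑ l ∈ Finset.Icc 1 (M - N + 1),
        (C' (q + 1) l * epsNorm eps' (q + 1)) *
          vcoef N (Ecoef N (M - N) (brow H) ξ q) (q + 1) l s -
        (brow H (q + 1) s + ∑ j ∈ Finset.Icc 1 q, eps' (q + 1) j * brow H (q + 1 - j) s) = 0 := by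
      refine coeff_eq_zero_of_sum_exp_eq_zero hk fun t ht => ?_
      have hl := hc.limit t ht
      simp only [Psi_succ, hPsi] at hl
      have hu := tendsto_nhds_unique hl (tendsto_sheetFun _ _ _ _ _)
      have h2 := h.sum_C_mul_sheetValue (k := k) hH (C' := C' (q + 1)) h1 hr t
      rw [Nat.add_sub_cancel] at h2
      rw [h2, heatSol_add, Complex.ofReal_inj, div_eq_iff hnorm, Nat.add_sub_cancel] at hu
      simp only [sub_mul, Finset.sum_sub_distrib]
      rw [hu, sub_eq_zero, Finset.sum_mul]
      refine Finset.sum_congr rfl fun s _ => ?_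
      rw [Finset.sum_mul, Finset.sum_mul, Finset.sum_mul]
      exact Finset.sum_congr rfl fun l _ => by ring
    have hsol := (system_iff h1 h.good.pos.ne' (h.good.det_ne (q + 1) h1 hr)
      (fun l => C' (q + 1) l * epsNorm eps' (q + 1)) (eps' (q + 1))).1 fun i hi =>
        sub_eq_zero.1 (hvec _ (Finset.mem_Icc.2 (by omega)))
    have heps : ∀ j ∈ Finset.Icc 1 (q + 1 - 1), eps' (q + 1) j = eps (q + 1) j := fun j hj => by
      rw [hsol.2 j hj, h.eps_eq]
      rfl
    have hnorm' : epsNorm eps' (q + 1) = epsNorm eps (q + 1) := by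
      unfold epsNorm
      rw [Finset.sum_congr rfl heps]
    have hC : ∀ l ∈ Finset.Icc 1 (M - N + 1), C' (q + 1) l = C (q + 1) l := fun l hl => by
      have h3 := hsol.1 l hl
      rw [h.C_eq, ← hnorm', eq_div_iff hnorm]
      exact h3
    refine ⟨hC, heps, map_val_eq_of_prod_eq (x := lamPt ξ) ?_ fun m hm => ?_⟩
    · exact (lamPt_strictAntiOn h.good.one_lt (M - N)).injOn.mono
        (Finset.coe_subset.2 (Finset.Icc_subset_Icc le_rfl (Nat.le_succ _)))
    · have hm' : m ∈ Finset.Icc 1 (M - N + 1) := Finset.Icc_subset_Icc le_rfl (Nat.le_succ _) hm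
      -- One time suffices, since `V_m` does not vanish.
      have hg := hc.glue (Pi.single 0 0) (isTime_single 0) m hm'
      rw [Psi_succ, sheetFun_lamPt hm', Nat.add_sub_cancel, hPsi] at hg
      have hV := h.sheetValue_ne_zero (k := k) h1 hr m (Pi.single 0 0)
      rw [Nat.add_sub_cancel] at hV
      have h4 := mul_right_cancel₀ hV (hg.trans (one_mul _).symm)
      have h5 : coefAt (M - N) ξ (C' (q + 1)) (b' (q + 1)) m (lamPt ξ m) = 1 := by
        exact_mod_cast h4
      rw [coefAt, mul_div_assoc', hC m hm', h.C_mul_nodeProd h1 hr hm'] at h5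
      exact (eq_of_div_eq_one h5).symm

end SheetData

end Sheets

section Dependence

variable {N M : ℕ} {H : Matrix (Fin N) (Fin M) ℝ}

/-! ### Dependence on the Fomin-Zelevinsky basis -/

theorem fzCoords_eq_minorRun {A A' : Matrix (Fin N) (Fin M) ℝ} {r : ℕ}
    (h : fzCoords A r = fzCoords A' r) {i s : ℕ} (hi : 1 ≤ i) (hir : i ≤ r) (hs : 1 ≤ s)
    (hsK : s ≤ M - N) : minorRun A i (N - i + 1 + s) = minorRun A' i (N - i + 1 + s) := by
  have h1 := congrFun (congrFun h ⟨i - 1, by omega⟩) ⟨s - 1, by omega⟩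
  simpa only [fzCoords, fzCoord, Nat.sub_add_cancel hi, Nat.sub_add_cancel hs] using h1

/-- The last `r` rows of the banded representative are determined by the coordinates `x_{l,s}`,
`l ≤ r`: each row is found from the rows below it, from right to left. -/
theorem IsBandedTP.brow_eq_of_fzCoords {A A' : Matrix (Fin N) (Fin M) ℝ} (hA : IsBandedTP A)
    (hA' : IsBandedTP A') (hN : 1 ≤ N) (hNM : N < M) {r : ℕ} (hr : r ≤ N)
    (h : fzCoords A r = fzCoords A' r) :
    ∀ i, 1 ≤ i → i ≤ r → ∀ s, brow A i s = brow A' i s := by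
  have hB := hA.bandTP hN hNM
  have hB' := hA'.bandTP hN hNM
  intro i
  induction i using Nat.strong_induction_on with
  | _ i ih =>
    intro hi hir
    obtain ⟨q, rfl⟩ : ∃ q, i = q + 1 := ⟨i - 1, by omega⟩
    have hlow : ∀ (x : Fin q) s, brow A (q - x) s = brow A' (q - x) s := fun x s => by
      have := x.2
      exact ih (q - x) (by omega) (by omega) (by omega) s
    -- Descending induction on the column. The minor with first column `p` is an affine function of
    -- the entry in the column `p`, whose coefficients involve only entries already known.
    have key : ∀ d s, M - s = d → brow A (q + 1) s = brow A' (q + 1) s := by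
      intro d
      induction d using Nat.strong_induction_on with
      | _ d ihd =>
        intro p hp
        by_cases h1 : p < N - (q + 1) + 1 ∨ M - (q + 1) + 1 < p
        · rw [hB.support _ _ hi (by omega) h1, hB'.support _ _ hi (by omega) h1]
        by_cases h2 : p = N - (q + 1) + 1
        · obtain ⟨t, rfl⟩ : ∃ t, p = t + 1 := ⟨p - 1, by omega⟩
          unfold brow
          rw [entry_eq _ (by omega) (by omega), entry_eq _ (by omega) (by omega),
            hA.diag _ _ (by simp only; omega), hA'.diag _ _ (by simp only; omega)]
        obtain ⟨κ, hκ⟩ := hB.exists_redRow_expansion (q := q) (p := p + 1) (by omega) (by omega)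
          (by omega)
        obtain ⟨κ', hκ'⟩ := hB'.exists_redRow_expansion (q := q) (p := p + 1) (by omega)
          (by omega) (by omega)
        have hz : (fun x => κ x - κ' x) = 0 := by
          refine hB.combination_eq_zero (q := q) (p := p + 1) (by omega) (by omega) (by omega) _
            fun s hs1 hs2 => ?_
          have e1 := hκ s
          have e2 := hκ' s
          rw [redRow_eq_zero _ (by omega) hs1 (by omega)] at e1 e2
          have e3 := ihd (M - s) (by omega) s rfl
          simp only [← hlow] at e2
          simp only [sub_mul, Finset.sum_sub_distrib]
          linarith
        have e1 := hκ p
        have e2 := hκ' p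
        simp only [← hlow] at e2
        have e4 : minorRun A (q + 1) p = minorRun A' (q + 1) p := by
          have := fzCoords_eq_minorRun h hi hir (s := p - (N - (q + 1) + 1)) (by omega) (by omega)
          rwa [Nat.add_sub_cancel' (by omega)] at this
        have e5 : minorRun A (q + 1 - 1) (p + 1) = minorRun A' (q + 1 - 1) (p + 1) :=
          lastMinor_congr (r := q) (by omega) (by omega)
            (fun i s a1 a2 => ih i (by omega) a1 (by omega) s) _
        rw [redRow, minorHead_run, e4, e5] at e1
        rw [redRow, minorHead_run] at e2
        have e6 : ∑ x : Fin q, κ x * brow A (q - x) p = ∑ x : Fin q, κ' x * brow A (q - x) p :=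
          Finset.sum_congr rfl fun x _ => by rw [sub_eq_zero.1 (congrFun hz x)]
        linarith
    exact fun s => key _ s rfl

theorem brow_hatA_congr {A A' : Matrix (Fin N) (Fin M) ℝ} {i : ℕ}
    (h : ∀ s, brow A i s = brow A' i s) (s : ℕ) : brow (hatA A) i s = brow (hatA A') i s := by
  rw [brow_hatA, brow_hatA, rowSum, rowSum]
  simp only [h]

section Congr

variable {K : ℕ} {a a' : ℕ → ℕ → ℝ} {ξ : ℝ} {r : ℕ}

theorem sysSol_congr (hr : 1 ≤ r) (h : ∀ i, 1 ≤ i → i ≤ r → ∀ s, a i s = a' i s)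
    (E : ℕ → ℕ → ℝ) : sysSol N K a ξ r E = sysSol N K a' ξ r E := by
  have h1 : sysMat N K a ξ r E = sysMat N K a' ξ r E := by
    ext i c
    have := c.2
    simp only [sysMat, Matrix.of_apply]
    by_cases hc : (c : ℕ) ≤ K
    · rw [if_pos hc, if_pos hc]
    · rw [if_neg hc, if_neg hc, h _ (by omega) (by omega)]
  have h2 : sysRhs N K a ξ r = sysRhs N K a' ξ r := by
    ext i
    simp only [sysRhs]
    rw [h r hr le_rfl]
  funext i
  unfold sysSol
  rw [h1, h2]

theorem Ecoef_congr (h : ∀ i, 1 ≤ i → i ≤ r → ∀ s, a i s = a' i s) :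
    Ecoef N K a ξ r = Ecoef N K a' ξ r := by
  induction r with
  | zero => rfl
  | succ r ih =>
    have ih' := ih fun i h1 h2 => h i h1 (by omega)
    funext n s
    rw [Ecoef_succ, Ecoef_succ, ih']
    have hB : Bcoef N K a ξ (r + 1) = Bcoef N K a' ξ (r + 1) := by
      funext l
      unfold Bcoef
      rw [Nat.add_sub_cancel, ih', sysSol_congr (by omega) h]
    rw [hB]

theorem Bcoef_congr (hr : 1 ≤ r) (h : ∀ i, 1 ≤ i → i ≤ r → ∀ s, a i s = a' i s) :
    Bcoef N K a ξ r = Bcoef N K a' ξ r := by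
  funext l
  unfold Bcoef
  rw [Ecoef_congr (r := r - 1) fun i h1 h2 => h i h1 (by omega), sysSol_congr hr h]

theorem epsCoef_congr (hr : 1 ≤ r) (h : ∀ i, 1 ≤ i → i ≤ r → ∀ s, a i s = a' i s) :
    epsCoef N K a ξ r = epsCoef N K a' ξ r := by
  funext l
  unfold epsCoef
  rw [Ecoef_congr (r := r - 1) fun i h1 h2 => h i h1 (by omega), sysSol_congr hr h]

end Congr

theorem BandTP.hasRatLimit_Ecoef (hH : BandTP H) {r : ℕ} (h1 : 1 ≤ r) (hr : r ≤ N) {n s : ℕ}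
    (hn : 2 ≤ n) (hnM : n ≤ M - N + 1) (hs : N - r + 1 ≤ s) (hsM : s ≤ M) :
    HasRatLimit (fun ξ => ξ ^ gapExp N r n s * Ecoef N (M - N) (brow H) ξ r n s)
      (hatSigma H r n s) :=
  hH.hasRatLimit_Ecoef_of_vLimits h1 hr (hH.vLimits h1 hr) hn hnM hs hsM

/-- The constants `σ` depend only on the last `r` rows, being limits of quantities which do. -/
theorem BandTP.sigma_congr {H' : Matrix (Fin N) (Fin M) ℝ} (hH : BandTP H) (hH' : BandTP H')
    {r : ℕ} (h1 : 1 ≤ r) (hr : r ≤ N)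
    (h : ∀ i, 1 ≤ i → i ≤ r → ∀ s, brow H i s = brow H' i s) {n s : ℕ} (hn : 2 ≤ n)
    (hnM : n ≤ M - N + 1) (hs : N - r + 1 ≤ s) (hsM : s ≤ M) :
    sigma H r n s = sigma H' r n s := by
  have e1 := (hH.hasRatLimit_Ecoef h1 hr hn hnM hs hsM).tendsto
  simp only [Ecoef_congr h] at e1
  unfold sigma minorSum
  rw [tendsto_nhds_unique e1 (hH'.hasRatLimit_Ecoef h1 hr hn hnM hs hsM).tendsto]
  congr 1
  exact Finset.sum_congr rfl fun t _ => lastMinor_congr le_rfl hr (fun i s a b => h i a b s) _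

theorem rowSum_hatA_of_isBandedTP {A : Matrix (Fin N) (Fin M) ℝ} (hA : IsBandedTP A)
    (hN : 1 ≤ N) (hNM : N < M) (i : ℕ) (h1 : 1 ≤ i) (hi : i ≤ N) : rowSum (hatA A) i = 1 :=
  (hA.bandTP hN hNM).rowSum_hatA h1 hi

/-- A rational germ determined by the coordinates `x_{l,s}`, `l ≤ r`, is given by a rational
function determined by them. -/
theorem exists_ratFunc_of_fzCoords (hN : 1 ≤ N) (hNM : N < M) {r : ℕ} (hr : r ≤ N)
    (F : (ℕ → ℕ → ℝ) → ℝ → ℝ)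
    (hF : ∀ A : Matrix (Fin N) (Fin M) ℝ, IsBandedTP A → RatGerm (F (brow (hatA A))))
    (hcongr : ∀ a a' : ℕ → ℕ → ℝ, (∀ i, 1 ≤ i → i ≤ r → ∀ s, a i s = a' i s) → F a = F a')
    (x : Fin r → Fin (M - N) → ℝ) :
    ∃ R : RatFunc ℝ, ∀ A : Matrix (Fin N) (Fin M) ℝ, IsBandedTP A → fzCoords A r = x →
      ∀ᶠ ξ in atTop, F (brow (hatA A)) ξ = R.eval (RingHom.id ℝ) ξ := by
  by_cases h : ∃ A : Matrix (Fin N) (Fin M) ℝ, IsBandedTP A ∧ fzCoords A r = x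
  · obtain ⟨A₀, hA₀, hx⟩ := h
    obtain ⟨R, hR⟩ := hF A₀ hA₀
    refine ⟨R, fun A hA hAx => ?_⟩
    rw [hcongr _ (brow (hatA A₀)) fun i h1 h2 s => brow_hatA_congr
      (hA.brow_eq_of_fzCoords hA₀ hN hNM hr (hAx.trans hx.symm) i h1 h2) s]
    exact hR
  · exact ⟨0, fun A hA hAx => absurd ⟨A, hA, hAx⟩ h⟩

theorem BandTP.ratGerm_Bcoef (hH : BandTP H) {r l : ℕ} (h1 : 1 ≤ r) (hr : r ≤ N) (hl : 1 ≤ l)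
    (hlM : l ≤ M - N + 1) : RatGerm fun ξ => Bcoef N (M - N) (brow H) ξ r l :=
  (hH.hasRatLimit_Bcoef h1 hr (hH.vLimits h1 hr) hl hlM).rat

theorem RatGerm.of_pow_mul {f : ℝ → ℝ} {e : ℕ} (h : RatGerm fun ξ => ξ ^ e * f ξ) :
    RatGerm f := by
  refine (((RatGerm.id.pow e).inv).mul h).congr ?_
  filter_upwards [eventually_gt_atTop 0] with ξ hξ
  field_simp

theorem BandTP.ratGerm_epsCoef (hH : BandTP H) {r j : ℕ} (h1 : 1 ≤ r) (hr : r ≤ N) (hj : 1 ≤ j)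
    (hjr : j + 1 ≤ r) : RatGerm fun ξ => epsCoef N (M - N) (brow H) ξ r j :=
  (hH.hasRatLimit_epsCoef h1 hr (hH.vLimits h1 hr) hj hjr).rat.of_pow_mul

theorem BandTP.ratGerm_Ecoef (hH : BandTP H) {r : ℕ} (h1 : 1 ≤ r) (hr : r ≤ N) {n s : ℕ}
    (hn : 2 ≤ n) (hnM : n ≤ M - N + 1) (hs : N - r + 1 ≤ s) (hsM : s ≤ M) :
    RatGerm fun ξ => Ecoef N (M - N) (brow H) ξ r n s :=
  (hH.hasRatLimit_Ecoef h1 hr hn hnM hs hsM).rat.of_pow_mul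

theorem ratGerm_lamPt (l : ℕ) : RatGerm fun ξ => lamPt ξ l := by
  unfold lamPt
  split_ifs
  · exact RatGerm.const 0
  · exact (RatGerm.id.pow _).neg

/-- The elementary symmetric functions of the poles in terms of the solution of the system. -/
def esymmSol (N K : ℕ) (r s : ℕ) (a : ℕ → ℕ → ℝ) (ξ : ℝ) : ℝ :=
  ∑ l ∈ Finset.Icc 1 (K + 1), Bcoef N K a ξ r l / epsNorm (epsCoef N K a ξ) r *
    ∑ S ∈ ((Finset.Icc 1 (K + 1)).erase l).powersetCard s, ∏ m ∈ S, lamPt ξ m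

theorem BandTP.ratGerm_esymmSol (hH : BandTP H) {r : ℕ} (h1 : 1 ≤ r) (hr : r ≤ N) (s : ℕ) :
    RatGerm (esymmSol N (M - N) r s (brow H)) := by
  unfold esymmSol epsNorm
  refine RatGerm.sum _ fun l hl => ?_
  rw [Finset.mem_Icc] at hl
  refine ((hH.ratGerm_Bcoef h1 hr hl.1 hl.2).div ((RatGerm.const 1).add
    (RatGerm.sum _ fun j hj => ?_))).mul (RatGerm.sum _ fun S _ => RatGerm.prod _ fun m _ =>
      ratGerm_lamPt m)
  rw [Finset.mem_Icc] at hj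
  exact hH.ratGerm_epsCoef h1 hr hj.1 (by omega)

theorem SheetData.esymmPoles_eq {ξ : ℝ} {C eps b : ℕ → ℕ → ℝ} (h : SheetData H ξ C eps b)
    {r s : ℕ} (h1 : 1 ≤ r) (hr : r ≤ N) (hs : s ≤ M - N) :
    esymmPoles (M - N) (b r) s = esymmSol N (M - N) r s (brow H) ξ := by
  rw [VacuumKP.esymmPoles_eq (h.poly r h1 hr) hs, esymmSol]
  simp only [h.C_eq, show eps = epsCoef N (M - N) (brow H) ξ from funext₂ h.eps_eq]

/-! ### Location of the poles -/

/-- Two-sided bounds for the root of `∑ B_l / (b - λ_l)` between `λ_{m+1}` and `λ_m`, in terms of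
`y = -b / ξ^{2(m-1)}`: the terms with `l ≤ m` are close to `B_l / b`, and those with `l > m + 1`
are negligible. -/
theorem pole_bounds {K m : ℕ} {ξ : ℝ} (hξ : 1 < ξ) {B : ℕ → ℝ}
    (hB : ∀ l ∈ Finset.Icc 1 (K + 1), 0 < B l) (hm : m ∈ Finset.Icc 1 K) {y : ℝ}
    (h1 : lamPt ξ (m + 1) < -(ξ ^ (2 * (m - 1)) * y)) (h2 : -(ξ ^ (2 * (m - 1)) * y) < lamPt ξ m)
    (h0 : ∑ l ∈ Finset.Icc 1 (K + 1), B l / (-(ξ ^ (2 * (m - 1)) * y) - lamPt ξ l) = 0) :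
    (∑ l ∈ Finset.Icc 1 m, B l - (∑ l ∈ Finset.Icc (m + 2) (K + 1), B l) / (ξ ^ 2 - 1)) /
        ∑ l ∈ Finset.Icc 1 (m + 1), B l ≤ y ∧
      y ≤ (∑ l ∈ Finset.Icc 1 m, B l + (ξ ^ 2)⁻¹ * B (m + 1)) /
        ∑ l ∈ Finset.Icc 1 (m + 1), B l := by
  rw [Finset.mem_Icc] at hm
  have hξ0 : 0 < ξ := by linarith
  have hξ2 : 1 < ξ ^ 2 := one_lt_pow₀ hξ (by norm_num)
  set X := ξ ^ (2 * (m - 1)) with hX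
  have hX0 : 0 < X := pow_pos hξ0 _
  have hanti := lamPt_strictAntiOn hξ K
  have mem : ∀ {l}, 1 ≤ l → l ≤ K + 1 → l ∈ ((Finset.Icc 1 (K + 1) : Finset ℕ) : Set ℕ) :=
    fun a b => Finset.mem_coe.2 (Finset.mem_Icc.2 ⟨a, b⟩)
  have hlm1 : lamPt ξ (m + 1) = -X := by
    unfold lamPt
    rw [if_neg (by omega), hX, show m + 1 - 2 = m - 1 by omega]
  have hlm : -(X * (ξ ^ 2)⁻¹) ≤ lamPt ξ m := by
    unfold lamPt
    split_ifs with h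
    · have : 0 ≤ X * (ξ ^ 2)⁻¹ := by positivity
      linarith
    · rw [hX, show 2 * (m - 1) = 2 * (m - 2) + 2 by omega, pow_add, mul_assoc,
        mul_inv_cancel₀ (by positivity), mul_one]
  have hlow : ∀ l ∈ Finset.Icc 1 m, 0 < lamPt ξ l + X * y ∧ lamPt ξ l + X * y ≤ X * y ∧
      X * (y - (ξ ^ 2)⁻¹) ≤ lamPt ξ l + X * y := by
    intro l hl
    rw [Finset.mem_Icc] at hl
    have h3 := hanti.antitoneOn (mem hl.1 (by omega)) (mem hm.1 (by omega)) hl.2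
    have h4 := lamPt_nonpos hξ0 l
    refine ⟨by linarith, by linarith, ?_⟩
    rw [mul_sub]
    linarith
  have hhigh : ∀ l ∈ Finset.Icc (m + 2) (K + 1), X * (ξ ^ 2 - 1) ≤ -(X * y) - lamPt ξ l := by
    intro l hl
    rw [Finset.mem_Icc] at hl
    have h3 := hanti.antitoneOn (mem (by omega) (by omega)) (mem (by omega) hl.2) hl.1
    have h4 : lamPt ξ (m + 2) = -(X * ξ ^ 2) := by
      unfold lamPt
      rw [if_neg (by omega), hX, ← pow_add]
      congr 2
      omega
    rw [mul_sub]
    linarith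
  have hy0 : 0 < y := by
    have := lamPt_nonpos hξ0 m
    by_contra hy
    have := mul_nonpos_of_nonneg_of_nonpos hX0.le (not_lt.1 hy)
    linarith
  have hy1 : y < 1 := by
    rw [hlm1] at h1
    by_contra hy
    have := le_mul_of_one_le_right hX0.le (not_lt.1 hy)
    linarith
  set S := ∑ l ∈ Finset.Icc 1 m, B l with hS
  set T := ∑ l ∈ Finset.Icc (m + 2) (K + 1), B l with hT
  set P := ∑ l ∈ Finset.Icc 1 m, B l / (lamPt ξ l + X * y) with hP
  set R := ∑ l ∈ Finset.Icc (m + 2) (K + 1), B l / (-(X * y) - lamPt ξ l) with hR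
  have hBlow : ∀ l ∈ Finset.Icc 1 m, 0 < B l := fun l hl => by
    rw [Finset.mem_Icc] at hl
    exact hB l (Finset.mem_Icc.2 (by omega))
  have hBhigh : ∀ l ∈ Finset.Icc (m + 2) (K + 1), 0 < B l := fun l hl => by
    rw [Finset.mem_Icc] at hl
    exact hB l (Finset.mem_Icc.2 (by omega))
  have hBm : 0 < B (m + 1) := hB _ (Finset.mem_Icc.2 (by omega))
  have hS0 : 0 < S := Finset.sum_pos hBlow ⟨1, Finset.mem_Icc.2 (by omega)⟩
  have hT0 : 0 ≤ T := Finset.sum_nonneg fun l hl => (hBhigh l hl).le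
  have hSm : ∑ l ∈ Finset.Icc 1 (m + 1), B l = S + B (m + 1) :=
    Finset.sum_Icc_succ_top (by omega) _
  -- The equation for the root, with `λ_{m+1} = -X`, and its terms sorted by sign.
  have hsplit : P = B (m + 1) / (X * (1 - y)) + R := by
    have e : Finset.Icc 1 (K + 1) = Finset.Icc 1 (m + 1) ∪ Finset.Icc (m + 2) (K + 1) := by
      ext j
      simp only [Finset.mem_union, Finset.mem_Icc]
      omega
    have hd : Disjoint (Finset.Icc 1 (m + 1)) (Finset.Icc (m + 2) (K + 1)) := by
      rw [Finset.disjoint_left]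
      intro j
      simp only [Finset.mem_Icc]
      omega
    rw [e, Finset.sum_union hd, Finset.sum_Icc_succ_top (by omega), hlm1] at h0
    have e2 : ∑ l ∈ Finset.Icc 1 m, B l / (-(X * y) - lamPt ξ l) = -P := by
      rw [hP, ← Finset.sum_neg_distrib]
      refine Finset.sum_congr rfl fun l _ => ?_
      rw [← div_neg]
      congr 1
      ring
    rw [e2, show -(X * y) - -X = X * (1 - y) by ring] at h0
    linarith
  have hX1 : 0 < X * (1 - y) := mul_pos hX0 (by linarith)
  have hR0 : 0 ≤ R := Finset.sum_nonneg fun l hl => div_nonneg (hBhigh l hl).le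
    ((mul_pos hX0 (by linarith)).le.trans (hhigh l hl))
  have hPX1 : B (m + 1) ≤ P * (X * (1 - y)) := by
    rw [hsplit, add_mul, div_mul_cancel₀ _ hX1.ne']
    have := mul_nonneg hR0 hX1.le
    linarith
  have hPlow : S ≤ P * (X * y) := by
    rw [hP, Finset.sum_mul]
    refine Finset.sum_le_sum fun l hl => ?_
    obtain ⟨a1, a2, -⟩ := hlow l hl
    rw [div_mul_eq_mul_div, le_div_iff₀ a1]
    exact mul_le_mul_of_nonneg_left a2 (hBlow l hl).le
  have hPup : P * (X * (y - (ξ ^ 2)⁻¹)) ≤ S := by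
    rw [hP, Finset.sum_mul]
    refine Finset.sum_le_sum fun l hl => ?_
    obtain ⟨a1, -, a3⟩ := hlow l hl
    rw [div_mul_eq_mul_div, div_le_iff₀ a1]
    exact mul_le_mul_of_nonneg_left a3 (hBlow l hl).le
  have hRX : R * X ≤ T / (ξ ^ 2 - 1) := by
    rw [hR, hT, Finset.sum_mul, Finset.sum_div]
    refine Finset.sum_le_sum fun l hl => ?_
    have a1 : 0 < X * (ξ ^ 2 - 1) := mul_pos hX0 (by linarith)
    have a2 := hhigh l hl
    rw [div_mul_eq_mul_div, div_le_div_iff₀ (a1.trans_le a2) (by linarith), mul_assoc]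
    exact mul_le_mul_of_nonneg_left a2 (hBhigh l hl).le
  have hT1 : 0 ≤ T / (ξ ^ 2 - 1) := div_nonneg hT0 (by linarith)
  have hSB : 0 < S + B (m + 1) := by linarith
  have hδ1 : (ξ ^ 2)⁻¹ < 1 := inv_lt_one_of_one_lt₀ hξ2
  rw [hSm]
  constructor
  · rw [div_le_iff₀ hSB]
    have e1 : P * (X * y) * (1 - y) = B (m + 1) * y + R * X * (y * (1 - y)) := by
      have : P * (X * (1 - y)) = B (m + 1) + R * (X * (1 - y)) := by
        rw [hsplit, add_mul, div_mul_cancel₀ _ hX1.ne']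
      calc P * (X * y) * (1 - y) = P * (X * (1 - y)) * y := by ring
        _ = _ := by rw [this]; ring
    have e2 : S * (1 - y) ≤ P * (X * y) * (1 - y) :=
      mul_le_mul_of_nonneg_right hPlow (by linarith)
    have e3 : R * X * (y * (1 - y)) ≤ T / (ξ ^ 2 - 1) * 1 :=
      mul_le_mul hRX (mul_le_one₀ hy1.le (by linarith) (by linarith))
        (mul_nonneg hy0.le (by linarith)) hT1
    linarith
  · rw [le_div_iff₀ hSB]
    rcases le_total y (ξ ^ 2)⁻¹ with h | h
    · have e1 := mul_le_mul_of_nonneg_right h hSB.le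
      have e2 := mul_le_mul_of_nonneg_right hδ1.le hS0.le
      linarith
    · have e1 : P * (X * (y - (ξ ^ 2)⁻¹)) * (1 - y) ≤ S * (1 - y) :=
        mul_le_mul_of_nonneg_right hPup (by linarith)
      have e2 : B (m + 1) * (y - (ξ ^ 2)⁻¹) ≤ P * (X * (1 - y)) * (y - (ξ ^ 2)⁻¹) :=
        mul_le_mul_of_nonneg_right hPX1 (by linarith)
      linarith

/-- The poles are the roots of `∑ B_l / (z - λ_l)`. -/
theorem SheetData.sum_div_eq_zero {ξ : ℝ} {C eps b : ℕ → ℕ → ℝ} (h : SheetData H ξ C eps b)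
    {r m : ℕ} (h1 : 1 ≤ r) (hr : r ≤ N) (hm : m ∈ Finset.Icc 1 (M - N)) :
    ∑ l ∈ Finset.Icc 1 (M - N + 1), Bcoef N (M - N) (brow H) ξ r l / (b r m - lamPt ξ l) = 0 := by
  have hm' := Finset.mem_Icc.1 hm
  have hanti := lamPt_strictAntiOn h.good.one_lt (M - N)
  have mem : ∀ {l}, 1 ≤ l → l ≤ M - N + 1 →
      l ∈ ((Finset.Icc 1 (M - N + 1) : Finset ℕ) : Set ℕ) :=
    fun a b => Finset.mem_coe.2 (Finset.mem_Icc.2 ⟨a, b⟩)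
  have hb := h.pole_mem r h1 hr m hm
  have hne : ∀ j ∈ Finset.Icc 1 (M - N + 1), b r m - lamPt ξ j ≠ 0 := by
    intro j hj
    have hj' := Finset.mem_Icc.1 hj
    rcases Nat.lt_or_ge m j with h3 | h3
    · have := hanti.antitoneOn (mem (l := m + 1) (by omega) (by omega)) (mem hj'.1 hj'.2) h3
      linarith
    · have := hanti.antitoneOn (mem hj'.1 hj'.2) (mem (l := m) hm'.1 (by omega)) h3
      linarith
  have h3 := h.prod_eq h1 hr (b r m)
  rw [Finset.prod_eq_zero hm (sub_self _)] at h3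
  have hP : ∏ j ∈ Finset.Icc 1 (M - N + 1), (b r m - lamPt ξ j) ≠ 0 :=
    Finset.prod_ne_zero_iff.2 hne
  refine (mul_eq_zero.1 (?_ : (∏ j ∈ Finset.Icc 1 (M - N + 1), (b r m - lamPt ξ j)) * _ =
    0)).resolve_left hP
  rw [← mul_zero (epsNorm eps r), ← h3, Finset.mul_sum, Finset.mul_sum]
  refine Finset.sum_congr rfl fun l hl => ?_
  rw [nodeProd, ← Finset.mul_prod_erase _ _ hl, ← h.C_mul_epsNorm l h1 hr]
  have := hne l hl
  field_simp

/-- The bounds of `pole_bounds` have the same limit, up to an error of order `ξ⁻¹`. -/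
theorem BandTP.leadingOrder_pole (hH : BandTP H) {r m : ℕ} (h1 : 1 ≤ r) (hr : r ≤ N)
    (hm : m ∈ Finset.Icc 1 (M - N)) {C eps b : ℝ → ℕ → ℕ → ℝ}
    (h : ∀ᶠ ξ in atTop, SheetData H ξ (C ξ) (eps ξ) (b ξ)) :
    LeadingOrder (fun ξ => b ξ r m)
      (fun ξ => -ξ ^ (2 * (m - 1)) * ((∑ l ∈ Finset.Icc 1 m, hatB H r l) /
        ∑ l ∈ Finset.Icc 1 (m + 1), hatB H r l)) := by
  have hm' := Finset.mem_Icc.1 hm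
  set B : ℝ → ℕ → ℝ := fun ξ => Bcoef N (M - N) (brow H) ξ r with hBdef
  set c := (∑ l ∈ Finset.Icc 1 m, hatB H r l) / ∑ l ∈ Finset.Icc 1 (m + 1), hatB H r l with hc
  have hlim : ∀ l, 1 ≤ l → l ≤ M - N + 1 → HasRatLimit (fun ξ => B ξ l) (hatB H r l) :=
    fun l a1 a2 => hH.hasRatLimit_Bcoef h1 hr (hH.vLimits h1 hr) a1 a2
  have hsum : ∀ i j, 1 ≤ i → j ≤ M - N + 1 → HasRatLimit
      (fun ξ => ∑ l ∈ Finset.Icc i j, B ξ l) (∑ l ∈ Finset.Icc i j, hatB H r l) :=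
    fun i j a1 a2 => HasRatLimit.sum _ fun l hl => by
      rw [Finset.mem_Icc] at hl
      exact hlim l (by omega) (by omega)
  have hS1 : 0 < ∑ l ∈ Finset.Icc 1 m, hatB H r l :=
    hH.sum_hatB_pos h1 hr (n := m + 1) (by omega) (by omega)
  have hS2 : 0 < ∑ l ∈ Finset.Icc 1 (m + 1), hatB H r l :=
    hH.sum_hatB_pos h1 hr (n := m + 2) (by omega) (by omega)
  have hinv2 : HasRatLimit (fun ξ => (ξ ^ 2)⁻¹) 0 := by
    simpa [inv_pow] using HasRatLimit.inv_pow_succ 1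
  have hinv3 : HasRatLimit (fun ξ => (ξ ^ 2 - 1)⁻¹) 0 := by
    have h2 := hinv2.mul (((HasRatLimit.const 1).sub hinv2).inv (by norm_num))
    rw [zero_mul] at h2
    refine h2.congr ?_
    filter_upwards [eventually_gt_atTop 1] with ξ hξ
    rw [← mul_inv]
    congr 1
    have : ξ ≠ 0 := by linarith
    field_simp
  have hL : HasRatLimit (fun ξ => (∑ l ∈ Finset.Icc 1 m, B ξ l -
      (∑ l ∈ Finset.Icc (m + 2) (M - N + 1), B ξ l) / (ξ ^ 2 - 1)) /
        ∑ l ∈ Finset.Icc 1 (m + 1), B ξ l) c := by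
    have h2 := ((hsum 1 m le_rfl (by omega)).sub
      ((hsum (m + 2) (M - N + 1) (by omega) le_rfl).mul hinv3)).div
        (hsum 1 (m + 1) le_rfl (by omega)) hS2.ne'
    rw [mul_zero, sub_zero] at h2
    exact h2
  have hU : HasRatLimit (fun ξ => (∑ l ∈ Finset.Icc 1 m, B ξ l + (ξ ^ 2)⁻¹ * B ξ (m + 1)) /
        ∑ l ∈ Finset.Icc 1 (m + 1), B ξ l) c := by
    have h2 := ((hsum 1 m le_rfl (by omega)).add
      (hinv2.mul (hlim (m + 1) (by omega) (by omega)))).div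
        (hsum 1 (m + 1) le_rfl (by omega)) hS2.ne'
    rw [zero_mul, add_zero] at h2
    exact h2
  -- A number between two bounds is at most as far from `c` as the two bounds together.
  have hy : (fun ξ => -b ξ r m / ξ ^ (2 * (m - 1)) - c) =O[atTop] fun ξ => ξ⁻¹ := by
    refine IsBigO.trans (IsBigO.of_bound 1 ?_) (hL.isBigO.norm_left.add hU.isBigO.norm_left)
    filter_upwards [h] with ξ hξ
    have hX : ξ ^ (2 * (m - 1)) ≠ 0 := (pow_pos hξ.good.pos _).ne'
    have e : -(ξ ^ (2 * (m - 1)) * (-b ξ r m / ξ ^ (2 * (m - 1)))) = b ξ r m := by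
      field_simp
    have hmem := hξ.pole_mem r h1 hr m hm
    obtain ⟨b1, b2⟩ := pole_bounds (K := M - N) (B := B ξ) hξ.good.one_lt
      (hξ.good.B_pos r h1 hr) hm (y := -b ξ r m / ξ ^ (2 * (m - 1)))
      (by rw [e]; exact hmem.1) (by rw [e]; exact hmem.2)
      (by rw [e]; exact hξ.sum_div_eq_zero h1 hr hm)
    simp only [Real.norm_eq_abs, one_mul]
    refine le_trans ?_ (le_abs_self _)
    rw [abs_le]
    constructor
    · have a1 := neg_abs_le ((∑ l ∈ Finset.Icc 1 m, B ξ l -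
        (∑ l ∈ Finset.Icc (m + 2) (M - N + 1), B ξ l) / (ξ ^ 2 - 1)) /
          ∑ l ∈ Finset.Icc 1 (m + 1), B ξ l - c)
      have a2 := abs_nonneg ((∑ l ∈ Finset.Icc 1 m, B ξ l + (ξ ^ 2)⁻¹ * B ξ (m + 1)) /
        ∑ l ∈ Finset.Icc 1 (m + 1), B ξ l - c)
      linarith
    · have a1 := abs_nonneg ((∑ l ∈ Finset.Icc 1 m, B ξ l -
        (∑ l ∈ Finset.Icc (m + 2) (M - N + 1), B ξ l) / (ξ ^ 2 - 1)) /
          ∑ l ∈ Finset.Icc 1 (m + 1), B ξ l - c)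
      have a2 := le_abs_self ((∑ l ∈ Finset.Icc 1 m, B ξ l + (ξ ^ 2)⁻¹ * B ξ (m + 1)) /
        ∑ l ∈ Finset.Icc 1 (m + 1), B ξ l - c)
      linarith
  have hc0 : c ≠ 0 := (div_pos hS1 hS2).ne'
  unfold LeadingOrder
  have h2 : (fun ξ : ℝ => -ξ ^ (2 * (m - 1)) * (-b ξ r m / ξ ^ (2 * (m - 1)) - c)) =O[atTop]
      fun ξ => -ξ ^ (2 * (m - 1)) * (c * ξ⁻¹) :=
    (isBigO_refl _ _).mul (hy.trans (isBigO_self_const_mul hc0 _ _))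
  refine h2.congr' ?_ (Eventually.of_forall fun ξ => by ring)
  filter_upwards [eventually_gt_atTop 0] with ξ hξ
  have hX : ξ ^ (2 * (m - 1)) ≠ 0 := (pow_pos hξ _).ne'
  field_simp
  ring

/-! ### Leading terms at the points `α_n` -/

theorem redRow_div_redSum {r n s : ℕ} (h : minorRun H (r - 1) (N - r + n) ≠ 0) :
    redRow H r (N - r + n) s / redSum H r n = minorHead H r s (N - r + n) / minorSum H r n := by
  rw [redSum_eq, redRow, div_div_div_cancel_right₀ h]

/-- The three ranges of `j` in the definition of `leadCoef` are those where `gapExp` has slope zero,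
one and two. -/
theorem BandTP.leadCoef_eq (hH : BandTP H) {r n j : ℕ} (h1 : 1 ≤ r) (hr : r ≤ N) (hn : 2 ≤ n)
    (hnM : n ≤ M - N + 1) (hj : N - r + 1 ≤ j) (hjM : j ≤ M) (ξ : ℝ) :
    leadCoef H r n j ξ = (ξ ^ gapExp N r n j)⁻¹ * hatSigma H r n j := by
  have hNM := hH.hNM
  have hD := (hH.minorSum_pos h1 hr hn (by omega)).ne'
  have hR : minorRun H (r - 1) (N - r + n) ≠ 0 :=
    (hH.minorRun_pos (by omega) (by omega) (by omega)).ne'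
  unfold leadCoef
  by_cases c1 : j ≤ N - r + n - 1
  · have e : gapExp N r n j = 0 := by unfold gapExp; omega
    rw [if_pos c1, e, pow_zero, inv_one, one_mul, hH.hatSigma_head h1 hr n j hn hnM hj c1,
      redRow_div_redSum hR]
  rw [if_neg c1]
  by_cases c2 : j ≤ N + n - 2
  · have e : (j : ℤ) - N + r - n + 1 = (gapExp N r n j : ℕ) := by unfold gapExp; omega
    rw [if_pos c2, e, zpow_natCast, sigma]
    field_simp
  · have e : (r : ℤ) + 2 * ((j : ℤ) - N - n + 1) = (gapExp N r n j : ℕ) := by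
      unfold gapExp; omega
    rw [if_neg c2, e, zpow_natCast, hH.hatSigma_tail h1 hr n j hn hnM (by omega) hjM,
      minorTail_eq H h1, mul_div_assoc _ (redRow H r (N - r + n) j), redRow_div_redSum hR]
    ring

theorem BandTP.leadCoef_pos (hH : BandTP H) {r n j : ℕ} (h1 : 1 ≤ r) (hr : r ≤ N) (hn : 2 ≤ n)
    (hnM : n ≤ M - N + 1) (hj : N - r + 1 ≤ j) (hjM : j ≤ M) {ξ : ℝ} (hξ : 0 < ξ) :
    0 < leadCoef H r n j ξ := by
  rw [hH.leadCoef_eq h1 hr hn hnM hj hjM]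
  exact mul_pos (inv_pos.2 (pow_pos hξ _)) (hH.hatSigma_pos h1 hr n j hn hnM hj hjM)

theorem BandTP.leadingOrder_Ecoef (hH : BandTP H) {r n j : ℕ} (h1 : 1 ≤ r) (hr : r ≤ N)
    (hn : 2 ≤ n) (hnM : n ≤ M - N + 1) (hj : N - r + 1 ≤ j) (hjM : j ≤ M) :
    LeadingOrder (fun ξ => Ecoef N (M - N) (brow H) ξ r n j) (fun ξ => leadCoef H r n j ξ) := by
  refine (hH.hasRatLimit_Ecoef h1 hr hn hnM hj hjM).leadingOrder
    (hH.hatSigma_pos h1 hr n j hn hnM hj hjM).ne' (w := fun ξ => (ξ ^ gapExp N r n j)⁻¹) ?_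
    (Eventually.of_forall fun ξ => hH.leadCoef_eq h1 hr hn hnM hj hjM ξ)
  filter_upwards [eventually_gt_atTop 0] with ξ hξ
  field_simp

/-- Only the coefficients to the left of the gap have a nonzero limit. -/
theorem BandTP.tendsto_Ecoef (hH : BandTP H) {r n j : ℕ} (h1 : 1 ≤ r) (hr : r ≤ N)
    (hn : 2 ≤ n) (hnM : n ≤ M - N + 1) (hjM : j ≤ M) :
    Tendsto (fun ξ => Ecoef N (M - N) (brow H) ξ r n j) atTop (𝓝 (hatE H r n j)) := by
  have hNM := hH.hNM
  unfold hatE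
  by_cases hj : N - r + 1 ≤ j
  · have h := ((hH.hasRatLimit_Ecoef h1 hr hn hnM hj hjM).pow_mul_of_le (Nat.zero_le _)).tendsto
    simp only [pow_zero, one_mul, Nat.sub_zero] at h
    convert h using 2
    by_cases c1 : j ≤ N - r + n - 1
    · rw [if_pos ⟨hj, c1⟩, if_pos (by unfold gapExp; omega),
        hH.hatSigma_head h1 hr n j hn hnM hj c1, redRow_div_redSum
          (hH.minorRun_pos (by omega) (by omega) (by omega)).ne']
    · rw [if_neg fun h => c1 h.2, if_neg (by unfold gapExp; omega)]
  · rw [if_neg fun h => hj h.1]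
    simp only [Ecoef_eq_zero hr (not_le.1 hj)]
    exact tendsto_const_nhds

theorem LeadingOrder.exists_bound {f g : ℝ → ℝ} (h : LeadingOrder f g)
    (hg : ∀ ξ, 0 < ξ → 0 < g ξ) :
    ∃ c : ℝ, 0 ≤ c ∧ ∀ᶠ ξ in atTop, |f ξ - g ξ| ≤ c * ξ⁻¹ * g ξ := by
  obtain ⟨c, hc0, hc⟩ := h.exists_nonneg
  refine ⟨c, hc0, ?_⟩
  filter_upwards [hc.bound, eventually_gt_atTop 0] with ξ h1 h2
  rw [Real.norm_eq_abs, Real.norm_eq_abs, abs_of_pos (mul_pos (hg ξ h2) (inv_pos.2 h2))] at h1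
  linarith

end Dependence

end

end VacuumKP

theorem mainTheorem1 (N M : ℕ) (hN : 1 ≤ N) (hNM : N < M) :
    ∃ (RB Reps RPi : (r : ℕ) → ℕ → (Fin r → Fin (M - N) → ℝ) → RatFunc ℝ)
      (Sig : (r : ℕ) → ℕ → ℕ → (Fin r → Fin (M - N) → ℝ) → ℝ),
    ∀ A : Matrix (Fin N) (Fin M) ℝ, IsBandedTP A →
    ∃ (ξ₀ : ℝ) (C eps b : ℝ → ℕ → ℕ → ℝ) (E : ℝ → ℕ → ℕ → ℕ → ℝ)
      (RE : ℕ → ℕ → ℕ → RatFunc ℝ), 1 < ξ₀ ∧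
    -- existence, uniqueness and position of the poles
    (∀ ξ, ξ₀ < ξ →
      (∀ k : ℕ → ℝ, StrictMonoOn k (Set.Icc 1 M) →
        (∀ r ∈ Finset.Icc 1 N, SheetConditions (hatA A) k ξ (C ξ) (eps ξ) (b ξ) r) ∧
        (∀ C' eps' b' : ℕ → ℕ → ℝ, ∀ r ∈ Finset.Icc 1 N,
          (∀ q ∈ Finset.Icc 1 r, SheetConditions (hatA A) k ξ C' eps' b' q) →
            (∀ l ∈ Finset.Icc 1 (M - N + 1), C' r l = C ξ r l) ∧
            (∀ j ∈ Finset.Icc 1 (r - 1), eps' r j = eps ξ r j) ∧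
            (Finset.Icc 1 (M - N)).val.map (b' r) = (Finset.Icc 1 (M - N)).val.map (b ξ r))) ∧
      (∀ r ∈ Finset.Icc 1 N, ∀ m ∈ Finset.Icc 1 (M - N),
        lamPt ξ (m + 1) < b ξ r m ∧ b ξ r m < lamPt ξ m)) ∧
    ∀ r ∈ Finset.Icc 2 N,
      -- rationality in `ξ`, with coefficients depending only on the FZ-basis
      (∀ ξ, ξ₀ < ξ →
        (∀ l ∈ Finset.Icc 1 (M - N + 1),
          C ξ r l * epsNorm (eps ξ) r = (RB r l (fzCoords A r)).eval (RingHom.id ℝ) ξ) ∧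
        (∀ j ∈ Finset.Icc 1 (r - 1),
          eps ξ r j = (Reps r j (fzCoords A r)).eval (RingHom.id ℝ) ξ) ∧
        (∀ s ∈ Finset.Icc 1 (M - N),
          esymmPoles (M - N) (b ξ r) s = (RPi r s (fzCoords A r)).eval (RingHom.id ℝ) ξ)) ∧
      -- positivity of the wave function
      (∀ ξ, ξ₀ < ξ → ∀ k : ℕ → ℝ, StrictMonoOn k (Set.Icc 1 M) →
        ∀ x : ℝ, 0 < x → ∀ t, IsTime t →
          0 < (Psi N M k ξ (C ξ) (b ξ) r (x : ℂ) t).re ∧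
          (Psi N M k ξ (C ξ) (b ξ) r (x : ℂ) t).im = 0) ∧
      -- positivity and leading order of `B`, `ε`
      (∀ ξ, ξ₀ < ξ →
        (∀ l ∈ Finset.Icc 1 (M - N + 1), 0 < C ξ r l * epsNorm (eps ξ) r) ∧
        (∀ j ∈ Finset.Icc 1 (r - 1), 0 < eps ξ r j) ∧
        C ξ r 1 * epsNorm (eps ξ) r = entry (hatA A) (N - r + 1) (N - r + 1)) ∧
      (∀ l ∈ Finset.Icc 2 (M - N + 1),
        LeadingOrder (fun ξ => C ξ r l * epsNorm (eps ξ) r) (fun _ => hatB (hatA A) r l)) ∧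
      (∀ j ∈ Finset.Icc 1 (r - 1), 0 < eta (hatA A) r j ∧
        LeadingOrder (fun ξ => eps ξ r j) (fun ξ => eta (hatA A) r j * (ξ ^ j)⁻¹)) ∧
      -- leading order of the poles
      (∀ m ∈ Finset.Icc 1 (M - N),
        LeadingOrder (fun ξ => b ξ r m)
          (fun ξ => -ξ ^ (2 * (m - 1)) *
            ((∑ l ∈ Finset.Icc 1 m, hatB (hatA A) r l) /
              ∑ l ∈ Finset.Icc 1 (m + 1), hatB (hatA A) r l))) ∧
      -- expansion at the points `α_n`
      (∀ n ∈ Finset.Icc 2 (M - N + 1),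
        (∀ ξ, ξ₀ < ξ → ∀ k : ℕ → ℝ, StrictMonoOn k (Set.Icc 1 M) → ∀ t, IsTime t →
          Psi N M k ξ (C ξ) (b ξ) r (alphaPt ξ n : ℂ) t =
            ((∑ j ∈ Finset.Icc 1 M, E ξ r n j * Real.exp (theta (k j) t) : ℝ) : ℂ)) ∧
        (∃ K : ℝ, ∀ ξ, ξ₀ < ξ → ∀ k : ℕ → ℝ, StrictMonoOn k (Set.Icc 1 M) → ∀ t, IsTime t →
          |(Psi N M k ξ (C ξ) (b ξ) r (alphaPt ξ n : ℂ) t).re -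
              ∑ j ∈ Finset.Icc (N - r + 1) M,
                leadCoef (hatA A) r n j ξ * Real.exp (theta (k j) t)| ≤
            K * ξ⁻¹ * ∑ j ∈ Finset.Icc (N - r + 1) M,
                leadCoef (hatA A) r n j ξ * Real.exp (theta (k j) t)) ∧
        (∀ j ∈ Finset.Icc (N - r + 1) M,
          LeadingOrder (fun ξ => E ξ r n j) (fun ξ => leadCoef (hatA A) r n j ξ)) ∧
        (∀ j ∈ Finset.Icc (N - r + n) (N + n - 2), 0 < sigma (hatA A) r n j ∧
          sigma (hatA A) r n j = Sig r n j (fzCoords A r)) ∧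
        (∀ ξ, ξ₀ < ξ → ∀ j ∈ Finset.Icc 1 (N - r), E ξ r n j = 0) ∧
        (∀ ξ, ξ₀ < ξ → ∀ j ∈ Finset.Icc (N - r + 1) M,
          E ξ r n j = (RE r n j).eval (RingHom.id ℝ) ξ) ∧
        (∀ j ∈ Finset.Icc 1 M,
          Tendsto (fun ξ => E ξ r n j) atTop (𝓝 (hatE (hatA A) r n j)))) := by
  classical
  have hB : ∀ A : Matrix (Fin N) (Fin M) ℝ, IsBandedTP A → BandTP (hatA A) :=
    fun A hA => (hA.bandTP hN hNM).hatA
  -- The rational functions have to be chosen before the matrix `A`. For values of the coordinates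
  -- which do not belong to any matrix, and for indices out of range, the choice does not matter.
  have exB : ∀ r l (x : Fin r → Fin (M - N) → ℝ), ∃ R : RatFunc ℝ, r ∈ Finset.Icc 1 N →
      l ∈ Finset.Icc 1 (M - N + 1) → ∀ A : Matrix (Fin N) (Fin M) ℝ, IsBandedTP A →
      fzCoords A r = x → ∀ᶠ ξ in atTop,
        Bcoef N (M - N) (brow (hatA A)) ξ r l = R.eval (RingHom.id ℝ) ξ := by
    intro r l x
    by_cases h : r ∈ Finset.Icc 1 N ∧ l ∈ Finset.Icc 1 (M - N + 1)
    · obtain ⟨hr, hl⟩ := h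
      rw [Finset.mem_Icc] at hr hl
      obtain ⟨R, hR⟩ := exists_ratFunc_of_fzCoords hN hNM hr.2
        (fun a ξ => Bcoef N (M - N) a ξ r l)
        (fun A hA => (hB A hA).ratGerm_Bcoef hr.1 hr.2 hl.1 hl.2)
        (fun a a' h => funext fun ξ => by rw [Bcoef_congr hr.1 h]) x
      exact ⟨R, fun _ _ => hR⟩
    · exact ⟨0, fun h1 h2 => absurd ⟨h1, h2⟩ h⟩
  have exEps : ∀ r j (x : Fin r → Fin (M - N) → ℝ), ∃ R : RatFunc ℝ, r ∈ Finset.Icc 1 N →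
      j ∈ Finset.Icc 1 (r - 1) → ∀ A : Matrix (Fin N) (Fin M) ℝ, IsBandedTP A →
      fzCoords A r = x → ∀ᶠ ξ in atTop,
        epsCoef N (M - N) (brow (hatA A)) ξ r j = R.eval (RingHom.id ℝ) ξ := by
    intro r j x
    by_cases h : r ∈ Finset.Icc 1 N ∧ j ∈ Finset.Icc 1 (r - 1)
    · obtain ⟨hr, hj⟩ := h
      rw [Finset.mem_Icc] at hr hj
      obtain ⟨R, hR⟩ := exists_ratFunc_of_fzCoords hN hNM hr.2
        (fun a ξ => epsCoef N (M - N) a ξ r j)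
        (fun A hA => (hB A hA).ratGerm_epsCoef hr.1 hr.2 hj.1 (by omega))
        (fun a a' h => funext fun ξ => by rw [epsCoef_congr hr.1 h]) x
      exact ⟨R, fun _ _ => hR⟩
    · exact ⟨0, fun h1 h2 => absurd ⟨h1, h2⟩ h⟩
  have exPi : ∀ r s (x : Fin r → Fin (M - N) → ℝ), ∃ R : RatFunc ℝ, r ∈ Finset.Icc 1 N →
      ∀ A : Matrix (Fin N) (Fin M) ℝ, IsBandedTP A → fzCoords A r = x → ∀ᶠ ξ in atTop,
        esymmSol N (M - N) r s (brow (hatA A)) ξ = R.eval (RingHom.id ℝ) ξ := by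
    intro r s x
    by_cases hr : r ∈ Finset.Icc 1 N
    · rw [Finset.mem_Icc] at hr
      obtain ⟨R, hR⟩ := exists_ratFunc_of_fzCoords hN hNM hr.2 (esymmSol N (M - N) r s)
        (fun A hA => (hB A hA).ratGerm_esymmSol hr.1 hr.2 s)
        (fun a a' h => funext fun ξ => by
          unfold esymmSol epsNorm
          rw [Bcoef_congr hr.1 h, epsCoef_congr hr.1 h]) x
      exact ⟨R, fun _ => hR⟩
    · exact ⟨0, fun h1 => absurd h1 hr⟩
  have exSig : ∀ r n j (x : Fin r → Fin (M - N) → ℝ), ∃ v : ℝ, r ∈ Finset.Icc 1 N →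
      n ∈ Finset.Icc 2 (M - N + 1) → j ∈ Finset.Icc (N - r + 1) M →
      ∀ A : Matrix (Fin N) (Fin M) ℝ, IsBandedTP A → fzCoords A r = x →
        sigma (hatA A) r n j = v := by
    intro r n j x
    by_cases h : ∃ A : Matrix (Fin N) (Fin M) ℝ, IsBandedTP A ∧ fzCoords A r = x
    · obtain ⟨A₀, hA₀, hx⟩ := h
      refine ⟨sigma (hatA A₀) r n j, fun hr hn hj A hA hAx => ?_⟩
      rw [Finset.mem_Icc] at hr hn hj
      exact (hB A hA).sigma_congr (hB A₀ hA₀) hr.1 hr.2 (fun i h1 h2 => brow_hatA_congr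
        (hA.brow_eq_of_fzCoords hA₀ hN hNM hr.2 (hAx.trans hx.symm) i h1 h2)) hn.1 hn.2 hj.1 hj.2
    · exact ⟨0, fun _ _ _ A hA hAx => absurd ⟨A, hA, hAx⟩ h⟩
  choose RB hRB using exB
  choose Reps hReps using exEps
  choose RPi hRPi using exPi
  choose Sig hSig using exSig
  refine ⟨RB, Reps, RPi, Sig, fun A hA => ?_⟩
  have hH := hB A hA
  have hsum := rowSum_hatA_of_isBandedTP hA hN hNM
  set H := hatA A with hHdef
  have exRE : ∀ r n j, ∃ R : RatFunc ℝ, r ∈ Finset.Icc 1 N → n ∈ Finset.Icc 2 (M - N + 1) →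
      j ∈ Finset.Icc (N - r + 1) M → ∀ᶠ ξ in atTop,
        Ecoef N (M - N) (brow H) ξ r n j = R.eval (RingHom.id ℝ) ξ := by
    intro r n j
    by_cases h : r ∈ Finset.Icc 1 N ∧ n ∈ Finset.Icc 2 (M - N + 1) ∧ j ∈ Finset.Icc (N - r + 1) M
    · obtain ⟨hr, hn, hj⟩ := h
      rw [Finset.mem_Icc] at hr hn hj
      obtain ⟨R, hR⟩ := hH.ratGerm_Ecoef hr.1 hr.2 hn.1 hn.2 hj.1 hj.2
      exact ⟨R, fun _ _ _ => hR⟩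
    · exact ⟨0, fun h1 h2 h3 => absurd ⟨h1, h2, h3⟩ h⟩
  have exBd : ∀ r n j, ∃ c : ℝ, 0 ≤ c ∧ (r ∈ Finset.Icc 1 N → n ∈ Finset.Icc 2 (M - N + 1) →
      j ∈ Finset.Icc (N - r + 1) M → ∀ᶠ ξ in atTop,
        |Ecoef N (M - N) (brow H) ξ r n j - leadCoef H r n j ξ| ≤
          c * ξ⁻¹ * leadCoef H r n j ξ) := by
    intro r n j
    by_cases h : r ∈ Finset.Icc 1 N ∧ n ∈ Finset.Icc 2 (M - N + 1) ∧ j ∈ Finset.Icc (N - r + 1) M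
    · obtain ⟨hr, hn, hj⟩ := h
      rw [Finset.mem_Icc] at hr hn hj
      obtain ⟨c, hc0, hc⟩ := (hH.leadingOrder_Ecoef hr.1 hr.2 hn.1 hn.2 hj.1 hj.2).exists_bound
        fun ξ hξ => hH.leadCoef_pos hr.1 hr.2 hn.1 hn.2 hj.1 hj.2 hξ
      exact ⟨c, hc0, fun _ _ _ => hc⟩
    · exact ⟨0, le_rfl, fun h1 h2 h3 => absurd ⟨h1, h2, h3⟩ h⟩
  choose RE hRE using exRE
  choose cE hcE0 hcE using exBd
  -- For small `ξ` the poles are arbitrary.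
  have exb : ∀ ξ, ∃ b, GoodParam H ξ → SheetData H ξ (fun r l => Bcoef N (M - N) (brow H) ξ r l /
      epsNorm (epsCoef N (M - N) (brow H) ξ) r) (epsCoef N (M - N) (brow H) ξ) b := by
    intro ξ
    by_cases h : GoodParam H ξ
    · obtain ⟨b, hb⟩ := h.exists_sheetData hH hsum
      exact ⟨b, fun _ => hb⟩
    · exact ⟨0, fun h' => absurd h' h⟩
  choose b hb using exb
  -- A threshold beyond which all the required identities and bounds hold.
  have ev : ∀ᶠ ξ : ℝ in atTop, GoodParam H ξ ∧ ∀ r ∈ Finset.Icc 1 N,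
      (∀ l ∈ Finset.Icc 1 (M - N + 1), Bcoef N (M - N) (brow H) ξ r l =
        (RB r l (fzCoords A r)).eval (RingHom.id ℝ) ξ) ∧
      (∀ j ∈ Finset.Icc 1 (r - 1), epsCoef N (M - N) (brow H) ξ r j =
        (Reps r j (fzCoords A r)).eval (RingHom.id ℝ) ξ) ∧
      (∀ s ∈ Finset.Icc 1 (M - N), esymmSol N (M - N) r s (brow H) ξ =
        (RPi r s (fzCoords A r)).eval (RingHom.id ℝ) ξ) ∧
      ∀ n ∈ Finset.Icc 2 (M - N + 1), ∀ j ∈ Finset.Icc (N - r + 1) M,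
        Ecoef N (M - N) (brow H) ξ r n j = (RE r n j).eval (RingHom.id ℝ) ξ ∧
        |Ecoef N (M - N) (brow H) ξ r n j - leadCoef H r n j ξ| ≤
          cE r n j * ξ⁻¹ * leadCoef H r n j ξ := by
    refine hH.eventually_goodParam.and ((Filter.eventually_all_finset _).2 fun r hr => ?_)
    refine Filter.Eventually.and ?_ (Filter.Eventually.and ?_ (Filter.Eventually.and ?_ ?_))
    · exact (Filter.eventually_all_finset _).2 fun l hl => hRB r l _ hr hl A hA rfl
    · exact (Filter.eventually_all_finset _).2 fun j hj => hReps r j _ hr hj A hA rfl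
    · exact (Filter.eventually_all_finset _).2 fun s _ => hRPi r s _ hr A hA rfl
    · exact (Filter.eventually_all_finset _).2 fun n hn => (Filter.eventually_all_finset _).2
        fun j hj => (hRE r n j hr hn hj).and (hcE r n j hr hn hj)
  obtain ⟨ξ₁, hξ₁⟩ := Filter.eventually_atTop.1 ev
  have hlt : ∀ {ξ}, max ξ₁ 2 < ξ → ξ₁ ≤ ξ := fun h => ((le_max_left _ _).trans_lt h).le
  have hgood : ∀ {ξ}, max ξ₁ 2 < ξ → GoodParam H ξ := fun h => (hξ₁ _ (hlt h)).1
  have hdata : ∀ {ξ}, max ξ₁ 2 < ξ → SheetData H ξ _ _ (b ξ) := fun {ξ} h => hb ξ (hgood h)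
  refine ⟨max ξ₁ 2, fun ξ r l => Bcoef N (M - N) (brow H) ξ r l /
      epsNorm (epsCoef N (M - N) (brow H) ξ) r, fun ξ => epsCoef N (M - N) (brow H) ξ, b,
    fun ξ => Ecoef N (M - N) (brow H) ξ, RE, lt_of_lt_of_le (by norm_num) (le_max_right _ _),
    ?_, ?_⟩
  · intro ξ hξ
    refine ⟨fun k hk => ⟨fun r hr => ?_, fun C' eps' b' r hr h' => ?_⟩, fun r hr => ?_⟩
    · rw [Finset.mem_Icc] at hr
      exact (hdata hξ).sheetConditions hH hr.1 hr.2
    · rw [Finset.mem_Icc] at hr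
      exact (hdata hξ).unique hH hk hr.1 hr.2 h'
    · rw [Finset.mem_Icc] at hr
      exact (hdata hξ).pole_mem r hr.1 hr.2
  · intro r hr
    have hr1 : r ∈ Finset.Icc 1 N := Finset.Icc_subset_Icc (by norm_num) le_rfl hr
    rw [Finset.mem_Icc] at hr
    obtain ⟨hr2, hrN⟩ := hr
    have h1 : 1 ≤ r := by omega
    have hV := hH.vLimits h1 hrN
    have hCe : ∀ {ξ}, max ξ₁ 2 < ξ → ∀ l, Bcoef N (M - N) (brow H) ξ r l /
        epsNorm (epsCoef N (M - N) (brow H) ξ) r * epsNorm (epsCoef N (M - N) (brow H) ξ) r =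
        Bcoef N (M - N) (brow H) ξ r l := fun h l => (hdata h).C_mul_epsNorm l h1 hrN
    refine ⟨fun ξ hξ => ⟨fun l hl => ?_, fun j hj => ?_, fun s hs => ?_⟩,
      fun ξ hξ k _ x hx t _ => ?_, fun ξ hξ => ⟨fun l hl => ?_, fun j hj => ?_, ?_⟩,
      fun l hl => ?_, fun j hj => ⟨?_, ?_⟩, fun m hm => ?_, fun n hn => ?_⟩
    · rw [hCe hξ]
      exact ((hξ₁ ξ (hlt hξ)).2 r hr1).1 l hl
    · exact ((hξ₁ ξ (hlt hξ)).2 r hr1).2.1 j hj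
    · rw [(hdata hξ).esymmPoles_eq h1 hrN (Finset.mem_Icc.1 hs).2]
      exact ((hξ₁ ξ (hlt hξ)).2 r hr1).2.2.1 s hs
    · obtain ⟨y, hy, hy2⟩ := (hdata hξ).Psi_pos (k := k) hrN hx h1 t
      rw [hy2]
      exact ⟨hy, rfl⟩
    · rw [hCe hξ]
      exact (hgood hξ).B_pos r h1 hrN l hl
    · exact (hgood hξ).eps_pos r h1 hrN j hj
    · rw [hCe hξ]
      exact (hgood hξ).Bcoef_first hH h1 hrN
    · rw [Finset.mem_Icc] at hl
      refine (hH.hasRatLimit_Bcoef h1 hrN hV (by omega) hl.2).leadingOrder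
        (hH.hatB_pos h1 hrN (by omega) hl.2).ne' (w := fun _ => 1) ?_
        (Eventually.of_forall fun ξ => (one_mul _).symm)
      filter_upwards [eventually_gt_atTop (max ξ₁ 2)] with ξ hξ
      rw [hCe hξ, one_mul]
    · rw [Finset.mem_Icc] at hj
      exact hH.eta_pos hj.1 (by omega) hrN
    · rw [Finset.mem_Icc] at hj
      refine (hH.hasRatLimit_epsCoef h1 hrN hV hj.1 (by omega)).leadingOrder
        (hH.eta_pos hj.1 (by omega) hrN).ne' (w := fun ξ => (ξ ^ j)⁻¹) ?_
        (Eventually.of_forall fun ξ => mul_comm _ _)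
      filter_upwards [eventually_gt_atTop 0] with ξ hξ
      field_simp
    · refine hH.leadingOrder_pole h1 hrN hm (C := fun ξ r l => Bcoef N (M - N) (brow H) ξ r l /
        epsNorm (epsCoef N (M - N) (brow H) ξ) r) (eps := fun ξ => epsCoef N (M - N) (brow H) ξ) ?_
      filter_upwards [eventually_gt_atTop (max ξ₁ 2)] with ξ hξ using hdata hξ
    · have hn' := Finset.mem_Icc.1 hn
      have hPsi : ∀ {ξ}, max ξ₁ 2 < ξ → ∀ (k : ℕ → ℝ) (t : ℕ → ℝ), _ := fun {ξ} hξ k t =>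
        ((hdata hξ).Psi_and_sheetValue_eq (k := k) hrN hNM).1 h1 n t
      refine ⟨fun ξ hξ k _ t _ => hPsi hξ k t, ⟨∑ j ∈ Finset.Icc (N - r + 1) M, cE r n j,
        fun ξ hξ k _ t _ => ?_⟩, fun j hj => ?_, fun j hj => ?_, fun ξ hξ j hj => ?_,
        fun ξ hξ j hj => ?_, fun j hj => ?_⟩
      · have hξ0 : 0 < ξ := (hgood hξ).pos
        rw [hPsi hξ k t, Complex.ofReal_re]
        have e : ∑ j ∈ Finset.Icc 1 M, Ecoef N (M - N) (brow H) ξ r n j *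
            Real.exp (theta (k j) t) = ∑ j ∈ Finset.Icc (N - r + 1) M,
              Ecoef N (M - N) (brow H) ξ r n j * Real.exp (theta (k j) t) := by
          refine sum_eq_sum_of_subset (Finset.Icc_subset_Icc (by omega) le_rfl)
            (fun j hj hj2 => ?_) fun _ _ => rfl
          rw [Finset.mem_Icc] at hj hj2
          rw [Ecoef_eq_zero hrN (by omega), zero_mul]
        rw [e, ← Finset.sum_sub_distrib, Finset.mul_sum]
        refine (Finset.abs_sum_le_sum_abs _ _).trans (Finset.sum_le_sum fun j hj => ?_)
        have hj' := Finset.mem_Icc.1 hj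
        rw [← sub_mul, abs_mul, abs_of_pos (Real.exp_pos _), ← mul_assoc]
        refine mul_le_mul_of_nonneg_right ?_ (Real.exp_pos _).le
        refine ((((hξ₁ ξ (hlt hξ)).2 r hr1).2.2.2 n hn j hj).2).trans ?_
        refine mul_le_mul_of_nonneg_right (mul_le_mul_of_nonneg_right ?_ (inv_pos.2 hξ0).le)
          (hH.leadCoef_pos h1 hrN hn'.1 hn'.2 hj'.1 hj'.2 hξ0).le
        exact Finset.single_le_sum (f := fun j => cE r n j) (fun i _ => hcE0 r n i) hj
      · rw [Finset.mem_Icc] at hj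
        exact hH.leadingOrder_Ecoef h1 hrN hn'.1 hn'.2 hj.1 hj.2
      · rw [Finset.mem_Icc] at hj
        exact ⟨hH.sigma_pos h1 hrN hn'.1 hn'.2 (by omega) (by omega),
          hSig r n j _ hr1 hn (Finset.mem_Icc.2 (by omega)) A hA rfl⟩
      · rw [Finset.mem_Icc] at hj
        exact Ecoef_eq_zero hrN (by omega)
      · exact (((hξ₁ ξ (hlt hξ)).2 r hr1).2.2.2 n hn j hj).1
      · rw [Finset.mem_Icc] at hj
        exact hH.tendsto_Ecoef h1 hrN hn'.1 hn'.2 hj.2
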